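/- Let $R$ be a Noetherian integrally closed domain with field of fractions $K$, let $m\ge 0$, let $A=R[x_0^{\pm1},\dots,x_m^{\pm1}]$, and let $K(\mathbf x)$ be the field of fractions of $A$. Let $H$ be an $A$-algebra that is free and finitely generated as an $A$-module, such that $K(\mathbf x)H:=K(\mathbf x)\otimes_A H$ is split semisimple, with a symmetrizing form $t:H\to A$ (an $A$-linear form with $t(hk)=t(kh)$ such that $h\mapsto(x\mapsto t(hx))$ is an isomorphism $H\to\mathrm{Hom}_A(H,A)$). For $\chi\in\mathrm{Irr}(K(\mathbf x)H)$ let $\chi^\vee\in K(\mathbf x)H$ be the element with $t(\chi^\vee h)=\chi(h)$ for all $h$, and let the Schur element $s_\chi$ be the scalar by which $\chi^\vee$ acts on the simple module with character $\chi$. Assume that $H$ is essential: every $s_\chi$ can be written as $$s_\chi=\xi_\chi N_\chi\prod_{i\in I_\chi}\Psi_{\chi,i}(M_{\chi,i})^{n_{\chi,i}}\qquad(*)$$ with $\xi_\chi\in R$, $N_\chi$ a monomial of total degree $0$, $I_\chi$ finite, $n_{\chi,i}\geq 1$, each $\Psi_{\chi,i}\in R[x]$ monic of degree at least $1$, irreducible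 over $K$, prime to $x$ and to $x-1$ in $K[x]$, with constant term a unit of $R$, and each $M_{\chi,i}=\prod_j x_j^{a_j}$ a monomial of total degree $0$ with $\gcd(a_j)=1$. Let $\mathfrak p$ be a prime ideal of $R$ and let $M=\prod_j x_j^{a_j}$ be a monomial with $\gcd(a_j)=1$. Say that $M$ is $\mathfrak p$-essential for $\chi$ if in some factorization $(*)$ of $s_\chi$ one has $M=M_{\chi,i}$ and $\Psi_{\chi,i}(1)\in\mathfrak p$ for some $i$. Put $\mathfrak q_M=(M-1)A+\mathfrak pA$; the ideals $\mathfrak pA$ and $\mathfrak q_M$ of $A$ are prime. For a prime ideal $\mathfrak q$ of $A$, a block of $A_{\mathfrak q}H:=A_{\mathfrak q}\otimes_A H$ is the set of all $\chi\in\mathrm{Irr}(K(\mathbf x)H)$ that belong to some primitive idempotent $e$ of the center of $A_{\mathfrak q}H$ (that is, $e$ acts as the identity on the simple module with character $\chi$); likewise for other base rings. 1. If $C$ is a block of $A_{\mathfrak pA}H$ and $M$ is not $\mathfrak p$-essential for any $\chi\in C$, then $C$ is a block of $A_{\mathfrak q_M}H$. 2. If $M$ is $\mathfrak p$-essential for no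 $\chi\in\mathrm{Irr}(K(\mathbf x)H)$, then the blocks of $A_{\mathfrak pA}H$ and of $A_{\mathfrak q_M}H$ coincide. 3. Let $B=R[y_1^{\pm1},\dots,y_m^{\pm1}]$ with field of fractions $K(\mathbf y)$, and let $\varphi_M:A\to B$ be a morphism associated with $M$, i.e. the $R$-algebra morphism induced on group algebras $R[\mathbb Z^{m+1}]\to R[\mathbb Z^m]$ by a surjective homomorphism $\mathbb Z^{m+1}\to\mathbb Z^m$ with kernel $\mathbb Z(a_0,\dots,a_m)$. Let $H_{\varphi_M}=B\otimes_A H$. Then $\chi(h)\in A$ for all $\chi\in\mathrm{Irr}(K(\mathbf x)H)$ and $h\in H$, and there is a bijection $\tau:\mathrm{Irr}(K(\mathbf x)H)\to\mathrm{Irr}(K(\mathbf y)H_{\varphi_M})$ with $\tau(\chi)(1\otimes h)=\varphi_M(\chi(h))$; and with this identification, every $C$ as in 1 is also a block of $B_{\mathfrak pB}H_{\varphi_M}$, and under the hypothesis of 2 the blocks of $A_{\mathfrak pA}H$ coincide with those of $B_{\mathfrak pB}H_{\varphi_M}$. -/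

import Mathlib

open scoped TensorProduct

noncomputable section

namespace EssentialAlgebra

universe u v w

/-! ### Laurent polynomial rings, monomials, and the ideals attached to them -/

/-- The Laurent polynomial ring over `R` in `n` indeterminates, as the group algebra `R[ℤⁿ]`. -/
abbrev Laurent (R : Type u) [CommRing R] (n : ℕ) : Type u :=
  AddMonoidAlgebra R (Fin n → ℤ)

/-- The monomial `∏ xᵢ ^ (a i)`. -/
def monomial (R : Type u) [CommRing R] {n : ℕ} (a : Fin n → ℤ) : Laurent R n :=
  AddMonoidAlgebra.single a 1

/-- The greatest common divisor of the exponents is `1`. -/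
def IsPrimitiveExponent {n : ℕ} (a : Fin n → ℤ) : Prop :=
  Finset.univ.gcd a = 1

/-- The ideal `𝔭 A` of `A = R[x, x⁻¹]`. -/
def extendedIdeal {R : Type u} [CommRing R] (p : Ideal R) (n : ℕ) : Ideal (Laurent R n) :=
  p.map (algebraMap R (Laurent R n))

/-- The ideal `𝔮_M = (M - 1) A + 𝔭 A`, where `M = ∏ xᵢ ^ (a i)`. -/
def monomialIdeal {R : Type u} [CommRing R] (p : Ideal R) {n : ℕ} (a : Fin n → ℤ) :
    Ideal (Laurent R n) :=
  Ideal.span {monomial R a - 1} ⊔ extendedIdeal p n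

/-- A morphism `R[x₀^±, …, x_m^±] → R[y₁^±, …, y_m^±]` associated with the monomial
`∏ xᵢ ^ (a i)`: it is induced by a surjection `ℤ^(m+1) → ℤ^m` with kernel `ℤ a`. -/
def IsAssociatedMorphism {R : Type u} [CommRing R] {m : ℕ} (a : Fin (m + 1) → ℤ)
    (φ : Laurent R (m + 1) →ₐ[R] Laurent R m) : Prop :=
  ∃ f : (Fin (m + 1) → ℤ) →+ (Fin m → ℤ),
    Function.Surjective f ∧ f.ker = AddSubgroup.zmultiples a ∧
      φ = AddMonoidAlgebra.mapDomainAlgHom R R f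

theorem ker_mapRingHom_mk {R : Type u} [CommRing R] (p : Ideal R) (n : ℕ) :
    RingHom.ker (AddMonoidAlgebra.mapRingHom (Fin n → ℤ) (Ideal.Quotient.mk p)) =
      extendedIdeal p n := by
  apply le_antisymm
  · intro f hf
    have hf' : ∀ g, f.coeff g ∈ p := fun g => by
      have h := congrArg (fun x => AddMonoidAlgebra.coeff x g) ((RingHom.mem_ker).1 hf)
      simpa [Ideal.Quotient.eq_zero_iff_mem] using h
    rw [← AddMonoidAlgebra.sum_coeff_single f, Finsupp.sum]
    refine Ideal.sum_mem _ fun g _ => ?_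
    have : AddMonoidAlgebra.single g (f.coeff g) =
        (AddMonoidAlgebra.single g 1 : Laurent R n) *
          algebraMap R (Laurent R n) (f.coeff g) := by
      simp [AddMonoidAlgebra.single_mul_single]
    rw [this]
    exact Ideal.mul_mem_left _ _ (Ideal.mem_map_of_mem _ (hf' g))
  · refine Ideal.map_le_iff_le_comap.2 fun r hr => ?_
    simp [RingHom.mem_ker, Ideal.Quotient.eq_zero_iff_mem.2 hr]

theorem extendedIdeal_isPrime {R : Type u} [CommRing R] (p : Ideal R) (hp : p.IsPrime) (n : ℕ) :
    (extendedIdeal p n).IsPrime := by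
  rw [← ker_mapRingHom_mk]
  exact RingHom.ker_isPrime _

theorem monomialIdeal_isPrime {R : Type u} [CommRing R] (p : Ideal R) (hp : p.IsPrime) {n : ℕ}
    (a : Fin n → ℤ) (ha : IsPrimitiveExponent a) : (monomialIdeal p a).IsPrime := by
  obtain ⟨c, hc⟩ := Finset.gcd_eq_sum_mul Finset.univ a
  rw [ha] at hc
  let u : (Fin n → ℤ) →+ ℤ :=
    { toFun := fun g => ∑ i, g i * c i
      map_zero' := by simp
      map_add' := fun g g' => by simp [add_mul, Finset.sum_add_distrib] }
  have hu : u a = 1 := hc.symm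
  let f : (Fin n → ℤ) →+ (Fin n → ℤ) :=
    { toFun := fun g => g - u g • a
      map_zero' := by simp
      map_add' := fun g g' => by simp only [map_add, add_smul]; abel }
  have hfg : ∀ g, f g = g - u g • a := fun _ => rfl
  let σ := AddMonoidAlgebra.mapDomainRingHom R f
  let red := AddMonoidAlgebra.mapRingHom (Fin n → ℤ) (Ideal.Quotient.mk p)
  have hσ1 : ∀ g r, σ (AddMonoidAlgebra.single g r) = AddMonoidAlgebra.single (f g) r :=
    fun g r => by simp [σ]
  have key : ∀ k : ℤ, (AddMonoidAlgebra.single (k • a) 1 : Laurent R n) - 1 ∈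
      Ideal.span {monomial R a - 1} := by
    intro k
    let π := Ideal.Quotient.mk (Ideal.span {monomial R a - 1})
    let θ : Multiplicative (Fin n → ℤ) →* (Laurent R n ⧸ Ideal.span {monomial R a - 1}) :=
      (π : Laurent R n →* _).comp (AddMonoidAlgebra.of R (Fin n → ℤ))
    have h1 : θ (Multiplicative.ofAdd a) = 1 := by
      have : π (monomial R a - 1) = 0 :=
        Ideal.Quotient.eq_zero_iff_mem.2 (Ideal.subset_span rfl)
      rw [map_sub, map_one, sub_eq_zero] at this
      exact this
    have h2 : θ (Multiplicative.ofAdd (k • a)) = 1 := by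
      have h1' : θ.toHomUnits (Multiplicative.ofAdd a) = 1 := Units.ext h1
      have : θ.toHomUnits (Multiplicative.ofAdd (k • a)) = 1 := by
        rw [ofAdd_zsmul, map_zpow, h1', one_zpow]
      exact congrArg Units.val this
    apply Ideal.Quotient.eq_zero_iff_mem.1
    rw [map_sub, map_one, sub_eq_zero]
    exact h2
  have hσ : ∀ x : Laurent R n, x - σ x ∈ Ideal.span {monomial R a - 1} := by
    intro x
    induction x using AddMonoidAlgebra.induction_linear with
    | zero => simp
    | add x y hx hy =>
      rw [map_add, add_sub_add_comm]
      exact Ideal.add_mem _ hx hy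
    | single g r =>
      have : AddMonoidAlgebra.single g r - σ (AddMonoidAlgebra.single g r) =
          AddMonoidAlgebra.single (f g) r *
            ((AddMonoidAlgebra.single (u g • a) 1 : Laurent R n) - 1) := by
        rw [hσ1, mul_sub, mul_one, AddMonoidAlgebra.single_mul_single, hfg, sub_add_cancel,
          mul_one]
      rw [this]
      exact Ideal.mul_mem_left _ _ (key _)
  have hker : monomialIdeal p a = RingHom.ker (red.comp σ) := by
    apply le_antisymm
    · refine sup_le ?_ ?_
      · rw [Ideal.span_singleton_le_iff_mem, RingHom.mem_ker]
        have : σ (monomial R a) = 1 := by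
          rw [monomial, hσ1, hfg, hu, one_smul, sub_self]
          rfl
        rw [RingHom.comp_apply, map_sub, map_one, this, sub_self, map_zero]
      · refine Ideal.map_le_iff_le_comap.2 fun r hr => ?_
        have : σ (algebraMap R (Laurent R n) r) = algebraMap R (Laurent R n) r := by
          simp [σ]
        rw [Ideal.mem_comap, RingHom.mem_ker, RingHom.comp_apply, this, ← RingHom.mem_ker,
          ker_mapRingHom_mk]
        exact Ideal.mem_map_of_mem _ hr
    · intro x hx
      have h1 : σ x ∈ extendedIdeal p n := by
        rw [← ker_mapRingHom_mk]
        exact hx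
      rw [← sub_add_cancel x (σ x)]
      exact Ideal.add_mem _ (Ideal.mem_sup_left (hσ x)) (Ideal.mem_sup_right h1)
  rw [hker]
  exact RingHom.ker_isPrime _

/-! ### Split semisimple algebras and irreducible characters -/

section Characters

variable (F : Type v) [Field F] (E : Type w) [Ring E] [Algebra F E]

/-- `E` is semisimple and every endomorphism of a simple `E`-module is a scalar. -/
def IsSplitSemisimple : Prop :=
  IsSemisimpleRing E ∧
    ∀ (V : Type w) [AddCommGroup V] [Module F V] [Module E V] [IsScalarTower F E V]
      [IsSimpleModule E V] (f : V →ₗ[E] V), ∃ c : F, ∀ x : V, f x = c • x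

/-- The character of an `E`-module. -/
def moduleCharacter (V : Type w) [AddCommGroup V] [Module F V] [Module E V]
    [IsScalarTower F E V] : E →ₗ[F] F :=
  LinearMap.trace F V ∘ₗ (Algebra.lsmul F F V : E →ₐ[F] Module.End F V).toLinearMap

variable {F E} in
/-- There is a simple `E`-module with character `χ` on which `e` acts as the scalar `c`. -/
def ActsAsScalar (χ : E →ₗ[F] F) (e : E) (c : F) : Prop :=
  ∃ (V : Type w) (_ : AddCommGroup V) (_ : Module F V) (_ : Module E V)
    (_ : IsScalarTower F E V), IsSimpleModule E V ∧ moduleCharacter F E V = χ ∧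
      ∀ x : V, e • x = c • x

/-- The irreducible characters of `E`, i.e. the characters of the simple `E`-modules. -/
def Irr : Type (max v w) :=
  {χ : E →ₗ[F] F // ∃ (V : Type w) (_ : AddCommGroup V) (_ : Module F V) (_ : Module E V)
    (_ : IsScalarTower F E V), IsSimpleModule E V ∧ moduleCharacter F E V = χ}

end Characters

/-! ### Blocks -/

/-- Block-idempotents: the primitive idempotents of the center. -/
structure IsBlockIdempotent {S : Type w} [Ring S] (e : S) : Prop where
  mem_center : e ∈ Subring.center S
  idem : IsIdempotentElem e
  ne_zero : e ≠ 0
  primitive : ∀ f g : S, f ∈ Subring.center S → g ∈ Subring.center S →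
    IsIdempotentElem f → IsIdempotentElem g → f * g = 0 → e = f + g → f = 0 ∨ g = 0

section Blocks

variable (A : Type u) [CommRing A] [IsDomain A] (H : Type v) [Ring H] [Algebra A H]

/-- The algebra `F H = F ⊗ H`, where `F` is the field of fractions of `A`. -/
abbrev GenericFiber : Type (max u v) := FractionRing A ⊗[A] H

/-- The irreducible characters of `F H`. -/
abbrev IrrGeneric : Type (max u v) := Irr (FractionRing A) (GenericFiber A H)

variable {A}

/-- The inclusion of `A_𝔮` into the field of fractions of `A`. -/
def localizationToFraction (q : Ideal A) [q.IsPrime] :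
    Localization.AtPrime q →ₐ[A] FractionRing A :=
  IsLocalization.liftAlgHom (M := q.primeCompl) (f := Algebra.ofId A (FractionRing A))
    fun s => IsUnit.mk0 _ <| by
      have hs : (s : A) ≠ 0 := fun h => s.2 (h ▸ q.zero_mem)
      simpa [Algebra.ofId_apply] using hs

/-- The canonical map `A_𝔮 H → F H`. -/
def localizedToGeneric (q : Ideal A) [q.IsPrime] :
    (Localization.AtPrime q ⊗[A] H) →ₐ[A] GenericFiber A H :=
  Algebra.TensorProduct.map (localizationToFraction q) (AlgHom.id A H)

variable {H}

/-- The set `C` of irreducible characters of `F H` is a block of `A_𝔮 H`: it consists of the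
characters that belong to some block-idempotent `e` of `A_𝔮 H`, i.e. of the characters of the
simple `F H`-modules on which `e` acts as the identity. -/
def IsBlockAt (q : Ideal A) (hq : q.IsPrime) (C : Set (IrrGeneric A H)) : Prop :=
  ∃ e : Localization.AtPrime q ⊗[A] H, IsBlockIdempotent e ∧
    C = {χ | ActsAsScalar χ.1 (localizedToGeneric H q e) 1}

end Blocks

/-! ### Symmetrizing forms and Schur elements -/

section Symmetric

variable {A : Type u} [CommRing A] {H : Type v} [Ring H] [Algebra A H]

/-- A trace function `t` such that `h ↦ (x ↦ t (h x))` is an isomorphism `H ≃ Hom_A(H, A)`. -/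
structure IsSymmetrizing (t : H →ₗ[A] A) : Prop where
  trace : ∀ h k : H, t (h * k) = t (k * h)
  bijective : Function.Bijective fun h : H => (t ∘ₗ LinearMap.mulLeft A h : H →ₗ[A] A)

/-- The extension of a linear form to `F H`. -/
def extendForm [IsDomain A] (t : H →ₗ[A] A) : GenericFiber A H →ₗ[FractionRing A] FractionRing A :=
  (TensorProduct.AlgebraTensorModule.rid A (FractionRing A) (FractionRing A)).toLinearMap ∘ₗ
    t.baseChange (FractionRing A)

/-- `s` is the Schur element of `χ` with respect to `t`: the scalar by which `χ^∨` acts on a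
simple module with character `χ`, where `χ^∨` is the element with `t (χ^∨ h) = χ h` for all `h`. -/
def IsSchurElement [IsDomain A] (t : H →ₗ[A] A) (χ : IrrGeneric A H) (s : FractionRing A) : Prop :=
  ∃ c : GenericFiber A H, (∀ h, extendForm t (c * h) = χ.1 h) ∧ ActsAsScalar χ.1 c s

end Symmetric

/-! ### Essential algebras and essential monomials -/

/-- The data of an expression `ξ N ∏ᵢ Ψᵢ(Mᵢ)^{nᵢ}` of the kind required of the Schur elements
of an essential algebra. -/
structure EssentialFactorization (R : Type u) [CommRing R] [IsDomain R] (n : ℕ) where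
  /-- the coefficient -/
  ξ : R
  /-- the exponent of the monomial `N` -/
  N : Fin n → ℤ
  N_degree : ∑ j, N j = 0
  /-- the number of factors -/
  card : ℕ
  /-- the polynomials -/
  Ψ : Fin card → Polynomial R
  Ψ_monic : ∀ i, (Ψ i).Monic
  Ψ_degree : ∀ i, 1 ≤ (Ψ i).natDegree
  Ψ_irreducible : ∀ i, Irreducible ((Ψ i).map (algebraMap R (FractionRing R)))
  Ψ_coprime_X : ∀ i, IsCoprime ((Ψ i).map (algebraMap R (FractionRing R))) Polynomial.X
  Ψ_coprime_X_sub_one : ∀ i,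
    IsCoprime ((Ψ i).map (algebraMap R (FractionRing R))) (Polynomial.X - 1)
  Ψ_const : ∀ i, IsUnit ((Ψ i).coeff 0)
  /-- the exponents of the monomials `Mᵢ` -/
  M : Fin card → (Fin n → ℤ)
  M_degree : ∀ i, ∑ j, M i j = 0
  M_primitive : ∀ i, IsPrimitiveExponent (M i)
  /-- the multiplicities -/
  mult : Fin card → ℕ
  mult_pos : ∀ i, 0 < mult i

/-- The element `ξ N ∏ᵢ Ψᵢ(Mᵢ)^{nᵢ}`. -/
def EssentialFactorization.value {R : Type u} [CommRing R] [IsDomain R] {n : ℕ}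
    (d : EssentialFactorization R n) : Laurent R n :=
  algebraMap R (Laurent R n) d.ξ * monomial R d.N *
    ∏ i, (Polynomial.aeval (monomial R (d.M i)) (d.Ψ i)) ^ d.mult i

section Essential

variable {R : Type u} [CommRing R] [IsDomain R] {n : ℕ}
  {H : Type v} [Ring H] [Algebra (Laurent R n) H]

/-- `H`, with the symmetrizing form `t`, is essential. -/
def IsEssential (t : H →ₗ[Laurent R n] Laurent R n) : Prop :=
  ∀ χ : IrrGeneric (Laurent R n) H, ∃ d : EssentialFactorization R n,
    IsSchurElement t χ (algebraMap (Laurent R n) (FractionRing (Laurent R n)) d.value)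

/-- The monomial with exponent `a` is `𝔭`-essential for `χ`: it occurs as some `Mᵢ` with
`Ψᵢ(1) ∈ 𝔭` in a factorization of the Schur element of `χ`. (The `Mᵢ` are determined by the Schur
element only up to inversion, so all its factorizations are admitted.) -/
def IsEssentialMonomial (t : H →ₗ[Laurent R n] Laurent R n) (p : Ideal R) (a : Fin n → ℤ)
    (χ : IrrGeneric (Laurent R n) H) : Prop :=
  ∃ d : EssentialFactorization R n,
    IsSchurElement t χ (algebraMap (Laurent R n) (FractionRing (Laurent R n)) d.value) ∧
      ∃ i, d.M i = a ∧ (d.Ψ i).eval 1 ∈ p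

end Essential

/-! ### Specialization -/

section Specialization

variable {A : Type u} [CommRing A] {B : Type u} [CommRing B]

/-- The algebra `H_φ = B ⊗_A H` obtained from `H` via `φ : A → B`. -/
def Specialization (φ : A →+* B) (H : Type v) [Ring H] [Algebra A H] : Type (max u v) :=
  letI := φ.toAlgebra
  B ⊗[A] H

variable (φ : A →+* B) (H : Type v) [Ring H] [Algebra A H]

instance : Ring (Specialization φ H) :=
  letI := φ.toAlgebra
  (inferInstance : Ring (B ⊗[A] H))

instance : Algebra B (Specialization φ H) :=
  letI := φ.toAlgebra
  (inferInstance : Algebra B (B ⊗[A] H))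

variable {H}

/-- The canonical map `h ↦ 1 ⊗ h`. -/
def Specialization.of (h : H) : Specialization φ H :=
  letI := φ.toAlgebra
  (1 ⊗ₜ[A] h : B ⊗[A] H)

/-- `ψ` is the specialization of the character `χ` via `φ`: `χ` takes values in `A` on `H`, and
`ψ (1 ⊗ h) = φ (χ h)` for all `h` in `H`. -/
def IsSpecializedCharacter [IsDomain A] [IsDomain B] (χ : IrrGeneric A H)
    (ψ : IrrGeneric B (Specialization φ H)) : Prop :=
  ∀ h : H, ∃ x : A, χ.1 (1 ⊗ₜ[A] h) = algebraMap A (FractionRing A) x ∧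
    ψ.1 (1 ⊗ₜ[B] Specialization.of φ h) = algebraMap B (FractionRing B) (φ x)

end Specialization

end EssentialAlgebra

end

open EssentialAlgebra

open scoped TensorProduct

noncomputable section

namespace EssentialAlgebra

universe u v w

/-! ### Split semisimple algebras as products of matrix algebras -/

/-! Write F for the field of fractions of A and split FH as a product of matrix algebras over F, so
that irreducible characters become factors. A central idempotent of any localization of H is then
the unit e_S of a set S of factors, and a block at a prime is a minimal nonempty S whose e_S is
defined over the local ring. Everything reduces to comparing, for different primes, which e_S are
defined.

From 𝔭A to 𝔮_M. Since 𝔭A ⊆ 𝔮_M, an idempotent defined at 𝔮_M is defined at 𝔭A. Conversely, by the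
symmetrizing form e_S is defined at 𝔮_M once every z = t(e_S h) = ∑_{χ ∈ S} χ(h)/s_χ lies in the
local ring, and χ(h) ∈ A because A is integrally closed. If M is not essential on S, the product of
the s_χ is ξg with ξ ∈ R and g ∉ 𝔮_M: a factor Ψ(M') with M' independent of M avoids 𝔮_M because Ψ
is monic, and for M' = M^{±1} its residue is Ψ(1) ∉ 𝔭. Thus ξgz ∈ A, and v₀z ∈ A for some v₀ ∉ 𝔭A. A
McCoy-type argument in the group algebra over R/ξ (`exists_mem_smul_eq_zero_of_mul_eq_zero`) trades
v₀ for a constant c ∈ R ∖ 𝔭 with cgz ∈ A, and cg ∉ 𝔮_M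
(`IsClosedAt.monomialIdeal_of_extendedIdeal`).

Specialization of characters. The kernel of φ_M is (M - 1)A, where the local ring of A is a
principal ideal domain. The matrix representation can therefore be made integral there. The Schur
elements are units there because Ψ(1) ≠ 0, so the localized algebra is a product of matrix algebras
and stays split over K(𝐲) (`IsSymmetrizing.exists_isCompatible`). This gives τ.

From 𝔮_M to 𝔭B. Idempotents at 𝔮_M specialize. In the other direction one has an element of A_{𝔮_M}H
that is a central idempotent only modulo the maximal ideal, and the local ring need not be
Henselian. Lifting works because the algebra is an order in a split semisimple algebra over an
integrally closed ring (`exists_unitOn_sub_mem_smul_top`). In a valuation ring dominating the base,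
the eigenvalues on each factor reduce all to 0 or all to 1. Hence the characteristic polynomials of
the two kinds are coprime already over the base, and a Bézout relation produces the idempotent.
`eq_of_smul_unitOn_sub_mem` shows that it belongs to the original set. -/

/-- The product of the full matrix algebras of sizes `d i` over `K`. -/
abbrev MatrixProd {ι : Type} (d : ι → ℕ) (K : Type*) : Type _ :=
  ∀ i, Matrix (Fin (d i)) (Fin (d i)) K

/-- A split semisimple algebra is a product of full matrix algebras over the base field. -/
theorem IsSplitSemisimple.exists_algEquiv {F : Type v} [Field F] {E : Type w} [Ring E]
    [Algebra F E] (h : IsSplitSemisimple F E) :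
    ∃ (n : ℕ) (d : Fin n → ℕ), (∀ i, NeZero (d i)) ∧ Nonempty (E ≃ₐ[F] MatrixProd d F) := by
  have := h.1
  obtain ⟨n, S, d, hS, hd, ⟨e⟩⟩ := IsSemisimpleRing.exists_algEquiv_pi_matrix_end_mulOpposite F E
  -- Splitness turns each endomorphism algebra in the Wedderburn–Artin decomposition into F.
  have key : ∀ i, Function.Bijective (Algebra.ofId F (Module.End E (S i))ᵐᵒᵖ) := by
    intro i
    have := hS i
    have hnt : Nontrivial (S i) := IsSimpleModule.nontrivial E (S i)
    have hnt' : Nontrivial (Module.End E (S i))ᵐᵒᵖ := by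
      refine ⟨0, 1, fun h01 => ?_⟩
      obtain ⟨x, hx⟩ := exists_ne (0 : S i)
      have h10 : (1 : Module.End E (S i)) = 0 := congrArg MulOpposite.unop h01.symm
      exact hx (by simpa using LinearMap.congr_fun h10 x)
    refine ⟨(algebraMap F (Module.End E (S i))ᵐᵒᵖ).injective, fun f => ?_⟩
    obtain ⟨c, hc⟩ := h.2 (S i) f.unop
    refine ⟨c, MulOpposite.unop_injective (LinearMap.ext fun x => ?_)⟩
    rw [hc]
    rfl
  refine ⟨n, d, hd, ⟨e.trans (AlgEquiv.piCongrRight fun i =>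
    (AlgEquiv.ofBijective _ (key i)).symm.mapMatrix)⟩⟩

section Columns

variable {F : Type v} [Field F] {E : Type (max v w)} [Ring E] [Algebra F E]
  {ι : Type} {d : ι → ℕ} (Φ : E ≃ₐ[F] MatrixProd d F)

/-- The module of column vectors of the `i`-th factor. -/
def Column (_ : E ≃ₐ[F] MatrixProd d F) (i : ι) : Type (max v w) := ULift.{w} (Fin (d i) → F)

/-- The universe lift in `Column` makes the column vectors admissible in `Irr`, whose simple modules
live in the universe of E. -/
instance (i : ι) : AddCommGroup (Column.{v, w} Φ i) :=
  inferInstanceAs (AddCommGroup (ULift.{w} (Fin (d i) → F)))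

instance (i : ι) : Module F (Column.{v, w} Φ i) :=
  inferInstanceAs (Module F (ULift.{w} (Fin (d i) → F)))

/-- The underlying vector space of a column module. -/
def columnEquiv (i : ι) : Column.{v, w} Φ i ≃ₗ[F] (Fin (d i) → F) :=
  ULift.moduleEquiv

instance (i : ι) : Module E (Column.{v, w} Φ i) where
  smul x c := (columnEquiv Φ i).symm ((Φ x i).mulVec (columnEquiv Φ i c))
  one_smul c := by
    change (columnEquiv Φ i).symm ((Φ 1 i).mulVec (columnEquiv Φ i c)) = c
    simp
  mul_smul x y c := by
    change (columnEquiv Φ i).symm ((Φ (x * y) i).mulVec (columnEquiv Φ i c)) =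
      (columnEquiv Φ i).symm ((Φ x i).mulVec (columnEquiv Φ i
        ((columnEquiv Φ i).symm ((Φ y i).mulVec (columnEquiv Φ i c)))))
    simp
  smul_zero x := by
    change (columnEquiv Φ i).symm ((Φ x i).mulVec (columnEquiv Φ i 0)) = 0
    simp
  smul_add x c c' := by
    change (columnEquiv Φ i).symm ((Φ x i).mulVec (columnEquiv Φ i (c + c'))) =
      (columnEquiv Φ i).symm ((Φ x i).mulVec (columnEquiv Φ i c)) +
      (columnEquiv Φ i).symm ((Φ x i).mulVec (columnEquiv Φ i c'))
    simp [Matrix.mulVec_add]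
  add_smul x y c := by
    change (columnEquiv Φ i).symm ((Φ (x + y) i).mulVec (columnEquiv Φ i c)) =
      (columnEquiv Φ i).symm ((Φ x i).mulVec (columnEquiv Φ i c)) +
      (columnEquiv Φ i).symm ((Φ y i).mulVec (columnEquiv Φ i c))
    simp [Matrix.add_mulVec]
  zero_smul c := by
    change (columnEquiv Φ i).symm ((Φ 0 i).mulVec (columnEquiv Φ i c)) = 0
    simp

theorem columnEquiv_smul (i : ι) (x : E) (c : Column.{v, w} Φ i) :
    columnEquiv Φ i (x • c) = (Φ x i).mulVec (columnEquiv Φ i c) :=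
  (columnEquiv Φ i).apply_symm_apply _

instance (i : ι) : IsScalarTower F E (Column.{v, w} Φ i) :=
  ⟨fun r x c => (columnEquiv Φ i).injective <| by
    simp [columnEquiv_smul, Matrix.smul_mulVec]⟩

theorem moduleCharacter_column (i : ι) (x : E) :
    moduleCharacter F E (Column.{v, w} Φ i) x = (Φ x i).trace := by
  rw [← Matrix.trace_toLin'_eq]
  change LinearMap.trace F _ _ = _
  rw [← LinearMap.trace_conj' _ (columnEquiv Φ i)]
  congr 1

variable [DecidableEq ι]

instance (i : ι) [NeZero (d i)] : IsSimpleModule E (Column.{v, w} Φ i) := by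
  rw [isSimpleModule_iff_toSpanSingleton_surjective]
  refine ⟨(columnEquiv Φ i).toEquiv.nontrivial, fun c hc c' => ?_⟩
  obtain ⟨j, hj⟩ : ∃ j, columnEquiv Φ i c j ≠ 0 := by
    by_contra! h
    exact hc ((columnEquiv Φ i).injective (by ext j; simpa using h j))
  -- A rank-one matrix with column c' and with its row normalized at a nonzero coordinate of c
  -- carries c to c'.
  refine ⟨Φ.symm (Pi.single i (Matrix.vecMulVec (columnEquiv Φ i c')
    (Pi.single j (columnEquiv Φ i c j)⁻¹))), (columnEquiv Φ i).injective ?_⟩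
  rw [LinearMap.toSpanSingleton_apply, columnEquiv_smul, AlgEquiv.apply_symm_apply,
    Pi.single_eq_same]
  ext k
  simp [Matrix.vecMulVec_mulVec, hj]

/-- Every simple module is isomorphic to a column module. -/
theorem exists_column_linearEquiv [Fintype ι] [∀ i, NeZero (d i)] (V : Type*) [AddCommGroup V]
    [Module E V] [IsSimpleModule E V] : ∃ i, Nonempty (Column.{v, w} Φ i ≃ₗ[E] V) := by
  have := IsSimpleModule.nontrivial E V
  obtain ⟨v, hv⟩ := exists_ne (0 : V)
  have hone : (1 : E) = ∑ i, ∑ j, Φ.symm (Pi.single i (Matrix.single j j 1)) := by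
    rw [← map_one Φ.symm, ← Finset.univ_sum_single (1 : MatrixProd d F), map_sum]
    refine Finset.sum_congr rfl fun i _ => ?_
    rw [← map_sum]
    congr 1
    rw [Pi.one_apply, ← Matrix.sum_single_one]
    exact map_sum (AddMonoidHom.single _ i) _ _
  obtain ⟨i, j, hij⟩ : ∃ i j, Φ.symm (Pi.single i (Matrix.single j j 1)) • v ≠ 0 := by
    by_contra! h
    apply hv
    rw [← one_smul E v, hone, Finset.sum_smul]
    exact Finset.sum_eq_zero fun i _ => by
      rw [Finset.sum_smul]
      exact Finset.sum_eq_zero fun j _ => h i j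
  -- The matrices supported in column j form a left ideal isomorphic to the column module. Letting
  -- them act on v gives a map that is nonzero because the j-th diagonal unit does not kill v, hence
  -- bijective by Schur's lemma.
  let f : Column.{v, w} Φ i →ₗ[E] V :=
    { toFun := fun c =>
        Φ.symm (Pi.single i (Matrix.vecMulVec (columnEquiv Φ i c) (Pi.single j 1))) • v
      map_add' := fun c c' => by
        rw [map_add, Matrix.add_vecMulVec, Pi.single_add, map_add, add_smul]
      map_smul' := fun x c => by
        rw [columnEquiv_smul, ← Matrix.mul_vecMulVec, RingHom.id_apply, ← mul_smul]
        congr 1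
        apply Φ.injective
        ext k : 1
        rcases eq_or_ne k i with rfl | hk
        · simp
        · simp [hk] }
  refine ⟨i, ⟨LinearEquiv.ofBijective f (LinearMap.bijective_of_ne_zero fun h0 => hij ?_)⟩⟩
  have := LinearMap.congr_fun h0 ((columnEquiv Φ i).symm (Pi.single j 1))
  simpa [f, Matrix.single_eq_single_vecMulVec_single] using this

theorem moduleCharacter_congr {V W : Type (max v w)} [AddCommGroup V] [Module F V] [Module E V]
    [IsScalarTower F E V] [AddCommGroup W] [Module F W] [Module E W] [IsScalarTower F E W]
    (e : V ≃ₗ[E] W) : moduleCharacter F E V = moduleCharacter F E W := by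
  refine LinearMap.ext fun x => ?_
  change LinearMap.trace F V _ = LinearMap.trace F W _
  rw [← LinearMap.trace_conj' _ (e.restrictScalars F)]
  congr 1
  refine LinearMap.ext fun c => ?_
  simp [LinearEquiv.conj_apply]

variable [Fintype ι] [∀ i, NeZero (d i)]

/-- The irreducible characters of a product of matrix algebras are the traces of its factors. -/
def irrEquiv : ι ≃ Irr.{v, max v w} F E :=
  Equiv.ofBijective
    (fun i => ⟨moduleCharacter F E (Column.{v, w} Φ i), Column.{v, w} Φ i, inferInstance,
      inferInstance, inferInstance, inferInstance, inferInstance, rfl⟩) <| by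
    constructor
    · intro i j hij
      by_contra hne
      have h := LinearMap.congr_fun (congrArg Subtype.val hij)
        (Φ.symm (Pi.single i (Matrix.single 0 0 1)))
      simp [moduleCharacter_column, Ne.symm hne] at h
    · rintro ⟨χ, V, _, _, _, _, _, rfl⟩
      obtain ⟨i, ⟨e⟩⟩ := exists_column_linearEquiv Φ V
      exact ⟨i, Subtype.ext (moduleCharacter_congr e)⟩

theorem irrEquiv_apply (i : ι) (x : E) : (irrEquiv Φ i).1 x = (Φ x i).trace :=
  moduleCharacter_column Φ i x

/-- `ActsAsScalar` only asks for some simple module with the given character. Characters separate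
the column modules, so that module is the i-th one up to isomorphism. -/
theorem actsAsScalar_irrEquiv_iff (i : ι) (x : E) (c : F) :
    ActsAsScalar (irrEquiv Φ i).1 x c ↔ Φ x i = c • 1 := by
  constructor
  · rintro ⟨V, _, _, _, _, _, hχ, hx⟩
    obtain ⟨j, ⟨e⟩⟩ := exists_column_linearEquiv Φ V
    obtain rfl : j = i := (irrEquiv Φ).injective
      (Subtype.ext ((moduleCharacter_congr e).trans hχ))
    have h : ∀ w : Fin (d j) → F, (Φ x j).mulVec w = c • w := fun w => by
      have h1 : x • (columnEquiv Φ j).symm w = c • (columnEquiv Φ j).symm w :=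
        e.injective <| by
          rw [e.map_smul, hx]
          exact ((e.restrictScalars F).map_smul c _).symm
      simpa [columnEquiv_smul] using congrArg (columnEquiv Φ j) h1
    refine Matrix.ext_of_mulVec_single fun k => ?_
    rw [h, Matrix.smul_mulVec, Matrix.one_mulVec]
  · intro h
    refine ⟨Column.{v, w} Φ i, inferInstance, inferInstance, inferInstance, inferInstance,
      inferInstance, rfl, fun z => (columnEquiv Φ i).injective ?_⟩
    rw [columnEquiv_smul, h, Matrix.smul_mulVec, Matrix.one_mulVec, map_smul]

end Columns

/-! ### Blocks as minimal closed sets of factors -/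

section UnitOn

variable {ι : Type} (d : ι → ℕ) (K : Type*) [CommRing K]

open Classical in
/-- The central idempotent of a product of matrix algebras attached to a set of factors. -/
def unitOn (S : Set ι) : MatrixProd d K := fun i => if i ∈ S then 1 else 0

variable {d K}

theorem unitOn_apply_mem {S : Set ι} {i : ι} (hi : i ∈ S) : unitOn d K S i = 1 := if_pos hi

theorem unitOn_apply_notMem {S : Set ι} {i : ι} (hi : i ∉ S) : unitOn d K S i = 0 := if_neg hi

theorem unitOn_mul (S T : Set ι) : unitOn d K S * unitOn d K T = unitOn d K (S ∩ T) := by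
  ext i : 1
  by_cases hS : i ∈ S <;> by_cases hT : i ∈ T <;> simp [unitOn, hS, hT]

theorem unitOn_commute (S : Set ι) (x : MatrixProd d K) : Commute (unitOn d K S) x := by
  refine funext fun i => ?_
  by_cases hS : i ∈ S <;> simp [unitOn, hS]

theorem unitOn_empty : unitOn d K ∅ = 0 := by
  ext i : 1
  simp [unitOn]

theorem unitOn_add_of_disjoint {S T : Set ι} (h : Disjoint S T) :
    unitOn d K S + unitOn d K T = unitOn d K (S ∪ T) := by
  ext i : 1
  have := (fun j hj => Set.disjoint_left.1 h hj : ∀ j, j ∈ S → j ∉ T) i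
  by_cases hS : i ∈ S <;> by_cases hT : i ∈ T <;> simp_all [unitOn]

theorem unitOn_injective [Nontrivial K] [∀ i, NeZero (d i)] :
    Function.Injective (unitOn d K) := by
  intro S T h
  ext i
  have := congrFun h i
  by_cases hS : i ∈ S <;> by_cases hT : i ∈ T <;> simp_all [unitOn]

/-- Every central idempotent of a product of matrix algebras over a domain is attached to a set of
factors. -/
theorem exists_eq_unitOn [IsDomain K] [DecidableEq ι] {x : MatrixProd d K}
    (hc : ∀ i j k, Commute x (Pi.single i (Matrix.single j k 1))) (hx : IsIdempotentElem x) :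
    ∃ S, x = unitOn d K S := by
  have h : ∀ i, x i = 0 ∨ x i = 1 := by
    intro i
    obtain ⟨c, hc⟩ : x i ∈ Set.range (Matrix.scalar (Fin (d i))) := by
      refine Matrix.mem_range_scalar_of_commute_single fun j k _ => ?_
      have := congrFun (hc i j k) i
      simp only [Pi.mul_apply, Pi.single_eq_same] at this
      exact this.symm
    -- Sizes are not assumed positive here; a factor of size zero contains only the zero matrix.
    rcases isEmpty_or_nonempty (Fin (d i)) with h0 | ⟨⟨j⟩⟩
    · exact Or.inl (Subsingleton.elim _ _)
    have h1 : x i * x i = x i := congrFun hx i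
    rw [← hc, ← map_mul] at h1
    have h2 : c * c = c := by simpa using congrFun (congrFun h1 j) j
    rcases IsIdempotentElem.iff_eq_zero_or_one.1 (show IsIdempotentElem c from h2) with rfl | rfl
    · left; rw [← hc]; simp
    · right; rw [← hc]; simp
  refine ⟨{i | x i = 1}, funext fun i => ?_⟩
  by_cases hi : x i = 1
  · rw [unitOn_apply_mem (by exact hi), hi]
  · rw [unitOn_apply_notMem (by exact hi), (h i).resolve_right hi]

end UnitOn

/-- `S` is minimal among the nonempty sets with the property `P`. -/
def IsMinimalNonempty {ι : Type*} (P : Set ι → Prop) (S : Set ι) : Prop :=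
  S.Nonempty ∧ P S ∧ ∀ T ⊆ S, T.Nonempty → P T → T = S

/-- The idempotent attached to `S` lies in the localization at `q` of the image of `ρ`. -/
def IsClosedAt {A : Type*} [CommRing A] {H : Type*} [Ring H] [Algebra A H] {ι : Type} {d : ι → ℕ}
    {K : Type*} [CommRing K] [Algebra A K] (ρ : H →ₐ[A] MatrixProd d K) (q : Ideal A)
    (S : Set ι) : Prop :=
  ∃ v ∉ q, ∃ h, ρ h = v • unitOn d K S

section Blocks

variable {A : Type u} [CommRing A] {H : Type v} [Ring H] [Algebra A H] {ι : Type} {d : ι → ℕ}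

theorem exists_smul_eq_one_tmul {S : Type*} [CommRing S] [Algebra A S] (M : Submonoid A)
    [IsLocalization M S] (e : S ⊗[A] H) : ∃ s ∈ M, ∃ h : H, s • e = 1 ⊗ₜ h := by
  induction e using TensorProduct.induction_on with
  | zero => exact ⟨1, M.one_mem, 0, by simp⟩
  | tmul x h =>
    obtain ⟨⟨a, s⟩, hs⟩ := IsLocalization.surj M x
    refine ⟨s, s.2, a • h, ?_⟩
    rw [TensorProduct.smul_tmul', Algebra.smul_def, mul_comm, hs, Algebra.algebraMap_eq_smul_one,
      TensorProduct.smul_tmul]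
  | add x y hx hy =>
    obtain ⟨s, hs, h, hx⟩ := hx
    obtain ⟨s', hs', h', hy⟩ := hy
    refine ⟨s * s', M.mul_mem hs hs', s' • h + s • h', ?_⟩
    rw [smul_add, mul_smul, smul_comm s s' x, hx, mul_smul, hy, TensorProduct.tmul_add,
      TensorProduct.tmul_smul, TensorProduct.tmul_smul]

theorem matrixProd_smul_cancel {K : Type*} [Field K] [Algebra A K] [FaithfulSMul A K] {a : A}
    (ha : a ≠ 0) {x y : MatrixProd d K} (h : a • x = a • y) : x = y := by
  have ha' : algebraMap A K a ≠ 0 := by simpa using ha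
  rw [← algebraMap_smul K a x, ← algebraMap_smul K a y] at h
  rw [← inv_smul_smul₀ ha' x, h, inv_smul_smul₀ ha']

variable (Φ : GenericFiber A H ≃ₐ[FractionRing A] MatrixProd d (FractionRing A))

/-- The matrices of the elements of `H`. -/
def rep : H →ₐ[A] MatrixProd d (FractionRing A) :=
  (Φ.toAlgHom.restrictScalars A).comp Algebra.TensorProduct.includeRight

theorem rep_apply (h : H) : rep Φ h = Φ (1 ⊗ₜ h) := rfl

variable [IsDomain A]

theorem localizationToFraction_injective (q : Ideal A) [q.IsPrime] :
    Function.Injective (localizationToFraction q) := by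
  refine (injective_iff_map_eq_zero _).2 fun x hx => ?_
  obtain ⟨⟨a, s⟩, hs⟩ := IsLocalization.surj q.primeCompl x
  have h1 := congrArg (localizationToFraction q) hs
  rw [map_mul, hx, zero_mul, AlgHom.commutes] at h1
  have h2 : a = 0 := (IsFractionRing.injective A (FractionRing A)) (by rw [map_zero]; exact h1.symm)
  have h3 : IsUnit (algebraMap A (Localization.AtPrime q) s) :=
    IsLocalization.map_units (Localization.AtPrime q) s
  rw [h2, map_zero] at hs
  exact (h3.mul_left_eq_zero).1 hs

theorem localizedToGeneric_injective [Module.Free A H] (q : Ideal A) [q.IsPrime] :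
    Function.Injective (localizedToGeneric H q) := by
  exact Module.Flat.rTensor_preserves_injective_linearMap (M := H)
    (localizationToFraction q).toLinearMap (localizationToFraction_injective q)

theorem localizedToGeneric_tmul (q : Ideal A) [q.IsPrime] (x : Localization.AtPrime q) (h : H) :
    localizedToGeneric H q (x ⊗ₜ h) = localizationToFraction q x ⊗ₜ h := rfl

/-- The matrices of the elements of the localization of `H` at `q`. -/
def localizedRep (q : Ideal A) [q.IsPrime] :
    Localization.AtPrime q ⊗[A] H →ₐ[A] MatrixProd d (FractionRing A) :=
  (Φ.toAlgHom.restrictScalars A).comp (localizedToGeneric H q)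

theorem localizedRep_apply (q : Ideal A) [q.IsPrime] (e : Localization.AtPrime q ⊗[A] H) :
    localizedRep Φ q e = Φ (localizedToGeneric H q e) := rfl

theorem localizedRep_one_tmul (q : Ideal A) [q.IsPrime] (h : H) :
    localizedRep Φ q (1 ⊗ₜ h) = rep Φ h := by
  rw [localizedRep_apply, localizedToGeneric_tmul, map_one, rep_apply]

theorem localizedRep_injective [Module.Free A H] (q : Ideal A) [q.IsPrime] :
    Function.Injective (localizedRep Φ q) :=
  Φ.injective.comp (localizedToGeneric_injective q)

/-- Clearing one denominator. The form with an element of H and a scalar outside q is the one that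
transports along a morphism of base rings. -/
theorem isClosedAt_iff (q : Ideal A) [q.IsPrime] (S : Set ι) :
    IsClosedAt (rep Φ) q S ↔ ∃ e, localizedRep Φ q e = unitOn d _ S := by
  constructor
  · rintro ⟨v, hv, h, hh⟩
    let v' : q.primeCompl := ⟨v, hv⟩
    refine ⟨IsLocalization.mk' _ 1 v' ⊗ₜ h, ?_⟩
    have h1 : v • (IsLocalization.mk' (Localization.AtPrime q) 1 v' ⊗ₜ[A] h) =
        (1 : Localization.AtPrime q) ⊗ₜ h := by
      rw [TensorProduct.smul_tmul', Algebra.smul_def]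
      congr 1
      exact (IsLocalization.mk'_spec' (Localization.AtPrime q) 1 v').trans (map_one _)
    refine matrixProd_smul_cancel (fun h0 => hv (h0 ▸ q.zero_mem)) (a := v) ?_
    rw [← map_smul, h1, localizedRep_one_tmul, hh]
  · rintro ⟨e, he⟩
    obtain ⟨v, hv, h, hh⟩ := exists_smul_eq_one_tmul q.primeCompl e
    exact ⟨v, hv, h, by rw [← localizedRep_one_tmul Φ q, ← hh, map_smul, he]⟩

/-- Every matrix becomes the image of an element of H after multiplication by a denominator, so a
central element of the localized algebra is central in the whole product. -/
theorem exists_localizedRep_eq_unitOn [DecidableEq ι] {q : Ideal A} [q.IsPrime]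
    {e : Localization.AtPrime q ⊗[A] H}
    (hc : e ∈ Subring.center (Localization.AtPrime q ⊗[A] H)) (he : IsIdempotentElem e) :
    ∃ S, localizedRep Φ q e = unitOn d _ S := by
  suffices h : ∀ y, Commute (localizedRep Φ q e) y from
    exists_eq_unitOn (fun _ _ _ => h _) (he.map (localizedRep Φ q))
  intro y
  obtain ⟨s, hs, h, hy⟩ := exists_smul_eq_one_tmul (nonZeroDivisors A) (Φ.symm y)
  have hy' : s • y = rep Φ h := by
    have := congrArg (Φ.toAlgHom.restrictScalars A) hy
    rw [map_smul] at this
    simpa [rep_apply] using this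
  refine matrixProd_smul_cancel (nonZeroDivisors.ne_zero hs) ?_
  rw [← mul_smul_comm, ← smul_mul_assoc, hy', ← localizedRep_one_tmul Φ q, ← map_mul, ← map_mul,
    Subring.mem_center_iff.1 hc]

variable [Module.Free A H]

theorem mem_center_of_localizedRep_eq_unitOn {q : Ideal A} [q.IsPrime] {S : Set ι}
    {e : Localization.AtPrime q ⊗[A] H} (he : localizedRep Φ q e = unitOn d _ S) :
    e ∈ Subring.center (Localization.AtPrime q ⊗[A] H) :=
  Subring.mem_center_iff.2 fun g => localizedRep_injective Φ q <| by
    rw [map_mul, map_mul, he]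
    exact (unitOn_commute S _).symm.eq

theorem isIdempotentElem_of_localizedRep_eq_unitOn {q : Ideal A} [q.IsPrime] {S : Set ι}
    {e : Localization.AtPrime q ⊗[A] H} (he : localizedRep Φ q e = unitOn d _ S) :
    IsIdempotentElem e :=
  localizedRep_injective Φ q <| by
    rw [map_mul, he, unitOn_mul, Set.inter_self]

/-- The blocks are the minimal nonempty sets of factors whose idempotent lies in the localized
algebra. -/
theorem isBlockAt_iff [Fintype ι] [DecidableEq ι] [∀ i, NeZero (d i)] (q : Ideal A)
    (hq : q.IsPrime) (C : Set (IrrGeneric A H)) :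
    IsBlockAt q hq C ↔
      IsMinimalNonempty (IsClosedAt (rep Φ) q) (irrEquiv.{u, v} Φ ⁻¹' C) := by
  have hact : ∀ (S : Set ι) (e : Localization.AtPrime q ⊗[A] H),
      localizedRep Φ q e = unitOn d _ S →
      irrEquiv.{u, v} Φ ⁻¹' {χ | ActsAsScalar χ.1 (localizedToGeneric H q e) 1} = S := by
    intro S e he
    ext i
    rw [Set.mem_preimage, Set.mem_ofPred_eq, actsAsScalar_irrEquiv_iff, ← localizedRep_apply, he,
      one_smul]
    by_cases hi : i ∈ S <;> simp [unitOn, hi]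
  have hzero : ∀ (S : Set ι) (e : Localization.AtPrime q ⊗[A] H),
      localizedRep Φ q e = unitOn d _ S → (e = 0 ↔ S = ∅) := by
    intro S e he
    rw [← (localizedRep_injective Φ q).eq_iff, he, map_zero, ← unitOn_empty,
      unitOn_injective.eq_iff]
  constructor
  · rintro ⟨e, he, rfl⟩
    obtain ⟨S, hS⟩ := exists_localizedRep_eq_unitOn Φ he.mem_center he.idem
    rw [hact S e hS]
    refine ⟨?_, (isClosedAt_iff Φ q S).2 ⟨e, hS⟩, fun T hTS hT hTc => ?_⟩
    · rw [Set.nonempty_iff_ne_empty, Ne, ← hzero S e hS]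
      exact he.ne_zero
    -- A smaller closed set T would decompose e into the orthogonal central idempotents of T and of
    -- its complement.
    obtain ⟨f, hf⟩ := (isClosedAt_iff Φ q T).1 hTc
    have hg : localizedRep Φ q (e - f) = unitOn d _ (S \ T) := by
      rw [map_sub, hS, hf, sub_eq_iff_eq_add, unitOn_add_of_disjoint Set.disjoint_sdiff_left,
        Set.sdiff_union_of_subset hTS]
    rcases he.primitive f (e - f) (mem_center_of_localizedRep_eq_unitOn Φ hf)
      (mem_center_of_localizedRep_eq_unitOn Φ hg)
      (isIdempotentElem_of_localizedRep_eq_unitOn Φ hf)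
      (isIdempotentElem_of_localizedRep_eq_unitOn Φ hg)
      (localizedRep_injective Φ q (by
        rw [map_mul, hf, hg, unitOn_mul, Set.inter_sdiff_self, unitOn_empty, map_zero]))
      (add_sub_cancel f e).symm with h0 | h0
    · exact absurd ((hzero T f hf).1 h0) hT.ne_empty
    · exact hTS.antisymm (Set.sdiff_eq_empty.1 ((hzero _ _ hg).1 h0))
  · rintro ⟨hne, hcl, hmin⟩
    obtain ⟨e, he⟩ := (isClosedAt_iff Φ q _).1 hcl
    refine ⟨e, ⟨mem_center_of_localizedRep_eq_unitOn Φ he,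
      isIdempotentElem_of_localizedRep_eq_unitOn Φ he, ?_, ?_⟩, ?_⟩
    · rw [Ne, hzero _ _ he, ← Ne, ← Set.nonempty_iff_ne_empty]
      exact hne
    · intro f g hfc hgc hfi hgi hfg hefg
      -- An orthogonal decomposition of e partitions the set into closed sets T and U; if T is
      -- nonempty, minimality leaves nothing for U.
      obtain ⟨T, hT⟩ := exists_localizedRep_eq_unitOn Φ hfc hfi
      obtain ⟨U, hU⟩ := exists_localizedRep_eq_unitOn Φ hgc hgi
      have hTU : Disjoint T U := by
        rw [Set.disjoint_iff_inter_eq_empty, ← hzero (T ∩ U) (f * g) (by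
          rw [map_mul, hT, hU, unitOn_mul]), hfg]
      have hS : T ∪ U = irrEquiv.{u, v} Φ ⁻¹' C := unitOn_injective (K := FractionRing A) <| by
        rw [← unitOn_add_of_disjoint hTU, ← hT, ← hU, ← map_add, ← hefg, he]
      by_contra! h0
      have hTne : T.Nonempty := by
        rw [Set.nonempty_iff_ne_empty, Ne, ← hzero T f hT]
        exact h0.1
      have hTS := hmin T (hS ▸ Set.subset_union_left) hTne ((isClosedAt_iff Φ q T).2 ⟨f, hT⟩)
      refine h0.2 ((hzero U g hU).2 (Set.eq_empty_of_forall_notMem fun i hi => ?_))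
      exact Set.disjoint_right.1 hTU hi (hTS ▸ hS ▸ Set.mem_union_right _ hi)
    · refine (Set.preimage_injective.2 (irrEquiv.{u, v} Φ).surjective) ?_
      exact (hact _ e he).symm

end Blocks

/-! ### Lifting central idempotents -/

section Lifting

open Polynomial IsLocalRing

/-- Q - X vanishes at 0 and at 1. The point is that Q(f) is then congruent to f modulo f² - f. -/
theorem exists_eq_X_add_mul {V : Type*} [CommRing V] {Q : V[X]} (h0 : Q.eval 0 = 0)
    (h1 : Q.eval 1 = 1) : ∃ G : V[X], Q = X + (X ^ 2 - X) * G := by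
  obtain ⟨Q', rfl⟩ := X_dvd_iff.2 (by rwa [coeff_zero_eq_eval_zero] : Q.coeff 0 = 0)
  have h2 : (Q' - 1).eval 1 = 0 := by simp_all
  obtain ⟨G, hG⟩ := dvd_iff_isRoot.2 h2
  refine ⟨G, ?_⟩
  rw [sub_eq_iff_eq_add.1 hG, C_1]
  ring

theorem mul_mem_smul_top {O Λ : Type*} [CommRing O] [Ring Λ] [Algebra O Λ] {I : Ideal O} {y : Λ}
    (hy : y ∈ I • (⊤ : Submodule O Λ)) (x : Λ) :
    y * x ∈ I • (⊤ : Submodule O Λ) ∧ x * y ∈ I • (⊤ : Submodule O Λ) := by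
  constructor
  · have : I • (⊤ : Submodule O Λ) ≤ (I • (⊤ : Submodule O Λ)).comap (LinearMap.mulRight O x) := by
      rw [← Submodule.map_le_iff_le_comap, Submodule.map_smul'']
      exact smul_mono_right _ le_top
    exact this hy
  · have : I • (⊤ : Submodule O Λ) ≤ (I • (⊤ : Submodule O Λ)).comap (LinearMap.mulLeft O x) := by
      rw [← Submodule.map_le_iff_le_comap, Submodule.map_smul'']
      exact smul_mono_right _ le_top
    exact this hy

/-- An element of `I Λ` is a root of a monic polynomial whose lower coefficients lie in `I`. -/
theorem exists_monic_aeval_eq_zero_of_mem_smul_top {O Λ : Type*} [CommRing O] [Ring Λ]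
    [Algebra O Λ] [Module.Finite O Λ] (I : Ideal O) {y : Λ} (hy : y ∈ I • (⊤ : Submodule O Λ)) :
    ∃ p : O[X], p.Monic ∧ (∀ k < p.natDegree, p.coeff k ∈ I) ∧ aeval y p = 0 := by
  -- Determinant trick for left multiplication by y. The k-th coefficient lies in a power of I whose
  -- exponent is positive below the degree, and evaluating the operator relation at 1 gives the
  -- relation for y.
  obtain ⟨p, hp, -, hI, h0⟩ :=
    LinearMap.exists_monic_and_natDegree_eq_and_coeff_mem_pow_and_aeval_eq_zero
      O (Algebra.lmul O Λ y) I (by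
        rintro _ ⟨x, rfl⟩
        exact (mul_mem_smul_top hy x).1)
  refine ⟨p, hp, fun k hk => ?_, ?_⟩
  · exact Ideal.pow_le_self (by omega) (hI k)
  · rw [aeval_algHom_apply] at h0
    simpa using LinearMap.congr_fun h0 1

/-- An idempotent that is central modulo the maximal ideal is central. -/
theorem commute_of_sub_mem_smul_top {V Λ : Type*} [CommRing V] [IsLocalRing V] [Ring Λ]
    [Algebra V Λ] [Module.Finite V Λ] {e : Λ} (he : IsIdempotentElem e)
    (hc : ∀ x, e * x - x * e ∈ maximalIdeal V • (⊤ : Submodule V Λ)) (x : Λ) : Commute e x := by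
  -- The map x ↦ ex(1 - e) is a projection with values in 𝔪Λ, since ex(1 - e) = e(ex - xe). Its
  -- range N thus satisfies N = 𝔪N and vanishes by Nakayama. Applied to e and to 1 - e, this gives
  -- ex = exe = xe.
  have key : ∀ e : Λ, IsIdempotentElem e →
      (∀ x, e * x - x * e ∈ maximalIdeal V • (⊤ : Submodule V Λ)) →
      ∀ x, e * x * (1 - e) = 0 := by
    intro e he hc x
    let g : Λ →ₗ[V] Λ := LinearMap.mulRight V (1 - e) ∘ₗ LinearMap.mulLeft V e
    have hg : ∀ x, g x = e * x * (1 - e) := fun _ => rfl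
    have hN : LinearMap.range g = ⊥ := by
      refine Submodule.eq_bot_of_le_smul_of_le_jacobson_bot (maximalIdeal V) _ ?_ ?_ ?_
      · rw [LinearMap.range_eq_map]
        exact Submodule.FG.map _ Module.Finite.fg_top
      · rintro _ ⟨x, rfl⟩
        have h1 : g x ∈ maximalIdeal V • (⊤ : Submodule V Λ) := by
          have : g x = e * (e * x - x * e) := by
            rw [hg, mul_sub, mul_sub, ← mul_assoc e e x, he.eq]
            noncomm_ring
          rw [this]
          exact (mul_mem_smul_top (hc x) e).2
        have h2 : g (g x) = g x := by
          have h3 : (1 - e) * (1 - e) = 1 - e := he.one_sub.eq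
          rw [hg, hg, mul_assoc, mul_assoc (e * x), h3, ← mul_assoc, ← mul_assoc, he.eq]
        rw [← h2, LinearMap.range_eq_map, ← Submodule.map_smul'']
        exact Submodule.mem_map_of_mem h1
      · exact (IsLocalRing.jacobson_eq_maximalIdeal ⊥ bot_ne_top).ge
    have : g x ∈ LinearMap.range g := ⟨x, rfl⟩
    rw [hN] at this
    exact this
  have h1 := key e he hc x
  have h2 := key (1 - e) he.one_sub (fun x => by
    have : (1 - e) * x - x * (1 - e) = -(e * x - x * e) := by noncomm_ring
    rw [this]
    exact neg_mem (hc x)) x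
  rw [mul_sub, mul_one, sub_eq_zero] at h1
  rw [sub_sub_cancel, sub_mul, sub_mul, one_mul, sub_eq_zero] at h2
  rw [Commute, SemiconjBy, h1, h2]

/-- A polynomial in a matrix with scalar value takes this value at the eigenvalues. -/
theorem eval_eq_of_aeval_eq_smul_one {K : Type*} [Field K] {n : ℕ} {X : Matrix (Fin n) (Fin n) K}
    {l c : K} (hl : l ∈ X.charpoly.roots) {p : K[X]} (hp : aeval X p = c • 1) :
    p.eval l = c := by
  have h1 : l ∈ spectrum K X := by
    rw [Matrix.mem_spectrum_iff_isRoot_charpoly]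
    exact isRoot_of_mem_roots hl
  have h2 := spectrum.subset_polynomial_aeval X p ⟨l, h1, rfl⟩
  have : NeZero n := ⟨by rintro rfl; simp at hl⟩
  rw [hp, ← Algebra.algebraMap_eq_smul_one, spectrum.scalar_eq] at h2
  exact h2

/-- The characteristic polynomial of an integral matrix has coefficients in the base ring. -/
theorem exists_monic_map_eq_charpoly {O F : Type*} [CommRing O] [IsDomain O] [IsIntegrallyClosed O]
    [Field F] [Algebra O F] [IsFractionRing O F] {n : ℕ} {X : Matrix (Fin n) (Fin n) F}
    (hX : IsIntegral O X) : ∃ P : O[X], P.Monic ∧ P.map (algebraMap O F) = X.charpoly := by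
  let K := AlgebraicClosure F
  obtain ⟨p, hp, hpX⟩ := hX
  -- An eigenvalue is a root of the monic polynomial that kills X. The coefficients of the
  -- characteristic polynomial, being polynomials in the eigenvalues, are integral over O and lie in
  -- F.
  have hroots : ∀ l ∈ (X.charpoly.map (algebraMap F K)).roots, IsIntegral O l := by
    intro l hl
    refine ⟨p, hp, ?_⟩
    rw [← Matrix.charpoly_map] at hl
    have h1 : aeval ((algebraMap F K).mapMatrix X) (p.map (algebraMap O K)) =
        (0 : K) • (1 : Matrix (Fin n) (Fin n) K) := by
      rw [zero_smul]
      have h2 : eval₂ (algebraMap O (Matrix (Fin n) (Fin n) F)) X p = 0 := hpX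
      have h3 := congrArg (AlgHom.mapMatrix (IsScalarTower.toAlgHom O F K)) h2
      rw [map_zero, ← aeval_def, ← aeval_algHom_apply] at h3
      rw [aeval_map_algebraMap]
      exact h3
    rw [eval₂_eq_eval_map]
    exact eval_eq_of_aeval_eq_smul_one hl h1
  have hcoeff : ∀ k, ∃ o : O, algebraMap O F o = X.charpoly.coeff k := by
    intro k
    refine IsIntegrallyClosed.isIntegral_iff.1 ?_
    have h1 : (X.charpoly.map (algebraMap F K)).coeff k ∈ integralClosure O K := by
      have hs := IsAlgClosed.splits (X.charpoly.map (algebraMap F K))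
      rw [hs.eq_prod_roots_of_monic (X.charpoly_monic.map _)]
      have : (((X.charpoly.map (algebraMap F K)).roots.map (fun a => Polynomial.X - C a)).prod) ∈
          Polynomial.lifts (algebraMap (integralClosure O K) K) := by
        refine Subsemiring.multiset_prod_mem _ _ fun q hq => ?_
        obtain ⟨l, hl, rfl⟩ := Multiset.mem_map.1 hq
        exact ⟨Polynomial.X - C (⟨l, hroots l hl⟩ : integralClosure O K), by simp⟩
      obtain ⟨q, hq⟩ := this
      rw [← hq]
      simp
    rw [coeff_map] at h1
    exact (isIntegral_algebraMap_iff (algebraMap F K).injective).1 h1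
  obtain ⟨P, hP, -, hPm⟩ := lifts_and_natDegree_eq_and_monic (f := algebraMap O F)
    ((lifts_iff_coeff_lifts _).2 fun k => hcoeff k) X.charpoly_monic
  exact ⟨P, hPm, hP⟩

/-- Products of linear factors with roots in a given set. -/
def linearProducts {V : Type*} [CommRing V] (W : Set V) : Submonoid V[X] :=
  Submonoid.closure ((fun l => X - C l) '' W)

/-- A root reducing to 0 and a root reducing to 1 differ by a unit of the local ring, so the linear
factors are coprime in pairs. -/
theorem isCoprime_of_mem_linearProducts {V : Type*} [CommRing V] [IsLocalRing V] {a b : V[X]}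
    (ha : a ∈ linearProducts {l : V | l ∈ maximalIdeal V})
    (hb : b ∈ linearProducts {l : V | l - 1 ∈ maximalIdeal V}) : IsCoprime a b := by
  induction ha using Submonoid.closure_induction with
  | one => exact isCoprime_one_left
  | mul x y _ _ hx hy => exact hx.mul_left hy
  | mem x hx =>
    obtain ⟨l, hl, rfl⟩ := hx
    induction hb using Submonoid.closure_induction with
    | one => exact isCoprime_one_right
    | mul x y _ _ hx hy => exact hx.mul_right hy
    | mem x hx =>
      obtain ⟨k, hk, rfl⟩ := hx
      refine isCoprime_X_sub_C_of_isUnit_sub ?_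
      by_contra h
      have h1 : l - k ∈ maximalIdeal V := h
      have h2 := sub_mem (sub_mem hl h1) hk
      simp at h2

theorem mem_linearProducts {V K : Type*} [CommRing V] [CommRing K] [IsDomain K] [Algebra V K]
    [FaithfulSMul V K] {W : Set V} {G : V[X]} (hG : (G.map (algebraMap V K)).Monic)
    (hs : (G.map (algebraMap V K)).Splits)
    (hr : ∀ l ∈ (G.map (algebraMap V K)).roots, ∃ l' ∈ W, algebraMap V K l' = l) :
    G ∈ linearProducts W := by
  choose! g hgW hg using hr
  have : G = ((G.map (algebraMap V K)).roots.map fun l => X - C (g l)).prod := by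
    apply map_injective _ (FaithfulSMul.algebraMap_injective V K)
    conv_lhs => rw [hs.eq_prod_roots_of_monic hG]
    rw [Polynomial.map_multiset_prod, Multiset.map_map]
    refine congrArg Multiset.prod (Multiset.map_congr rfl fun l hl => ?_)
    simp [hg l hl]
  rw [this]
  refine Submonoid.multiset_prod_mem _ _ fun q hq => ?_
  obtain ⟨l, hl, rfl⟩ := Multiset.mem_map.1 hq
  exact Submonoid.subset_closure ⟨g l, hgW l hl, rfl⟩

end Lifting

section LiftingTheorem

open Polynomial IsLocalRing

/-- The entrywise application of an algebra morphism. -/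
def matrixProdMap {ι : Type} (d : ι → ℕ) {A K L : Type*} [CommRing A] [CommRing K] [CommRing L]
    [Algebra A K] [Algebra A L] (g : K →ₐ[A] L) : MatrixProd d K →ₐ[A] MatrixProd d L :=
  AlgHom.pi fun i => g.mapMatrix.comp (Pi.evalAlgHom A _ i)

theorem matrixProdMap_apply {ι : Type} {d : ι → ℕ} {A K L : Type*} [CommRing A] [CommRing K]
    [CommRing L] [Algebra A K] [Algebra A L] (g : K →ₐ[A] L) (x : MatrixProd d K) (i : ι) :
    matrixProdMap d g x i = (x i).map g := rfl

theorem matrixProdMap_unitOn {ι : Type} {d : ι → ℕ} {A K L : Type*} [CommRing A] [CommRing K]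
    [CommRing L] [Algebra A K] [Algebra A L] (g : K →ₐ[A] L) (S : Set ι) :
    matrixProdMap d g (unitOn d K S) = unitOn d L S := by
  ext i : 1
  rw [matrixProdMap_apply]
  by_cases hi : i ∈ S
  · rw [unitOn_apply_mem hi, unitOn_apply_mem hi, Matrix.map_one _ (map_zero g) (map_one g)]
  · rw [unitOn_apply_notMem hi, unitOn_apply_notMem hi, Matrix.map_zero _ (map_zero g)]

/-! ### Polynomials in an idempotent modulo the maximal ideal, over a dominating local ring -/

section LocalBase

variable {O : Type*} [CommRing O] [IsLocalRing O] {Λ : Type*} [Ring Λ] [Algebra O Λ]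
  {V : Type*} [CommRing V] [IsLocalRing V] [Algebra O V] [IsLocalHom (algebraMap O V)]

theorem algebraMap_mem_maximalIdeal {r : O} (hr : r ∈ maximalIdeal O) :
    algebraMap O V r ∈ maximalIdeal V :=
  (mem_maximalIdeal _).2 fun h => (mem_maximalIdeal r).1 hr (isUnit_of_map_unit _ _ h)

theorem one_tmul_mem_smul_top {y : Λ} (hy : y ∈ maximalIdeal O • (⊤ : Submodule O Λ)) :
    (1 : V) ⊗ₜ[O] y ∈ maximalIdeal V • (⊤ : Submodule V (V ⊗[O] Λ)) := by
  refine Submodule.smul_induction_on hy (fun r hr n _ => ?_) fun x y hx hy => ?_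
  · rw [TensorProduct.tmul_smul, ← algebraMap_smul V r]
    exact Submodule.smul_mem_smul (algebraMap_mem_maximalIdeal hr) trivial
  · rw [TensorProduct.tmul_add]
    exact add_mem hx hy

/-- Modulo the maximal ideal the equation reads y^n = 0. -/
theorem mem_maximalIdeal_of_aeval_eq_zero {p : O[X]} (hp : p.Monic)
    (hI : ∀ k < p.natDegree, p.coeff k ∈ maximalIdeal O) {y : V} (hy : aeval y p = 0) :
    y ∈ maximalIdeal V := by
  rw [hp.as_sum, map_add, map_pow, aeval_X, map_sum, add_eq_zero_iff_eq_neg] at hy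
  have : y ^ p.natDegree ∈ maximalIdeal V := by
    rw [hy]
    refine neg_mem (sum_mem fun k hk => ?_)
    rw [map_mul, aeval_C]
    exact Ideal.mul_mem_right _ _ (algebraMap_mem_maximalIdeal (hI k (Finset.mem_range.1 hk)))
  exact (maximalIdeal.isMaximal V).isPrime.mem_of_pow_mem _ this

/-- An element that is idempotent modulo the maximal ideal is killed by a monic polynomial whose
roots reduce to `0` or `1`. -/
theorem exists_monic_forall_root [Module.Finite O Λ] [IsDomain V] [IsIntegrallyClosed V]
    {K : Type*} [Field K] [Algebra V K] [IsFractionRing V K] [Algebra O K] [IsScalarTower O V K]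
    {f : Λ} (hf : f * f - f ∈ maximalIdeal O • (⊤ : Submodule O Λ)) :
    ∃ P : O[X], P.Monic ∧ aeval f P = 0 ∧ ∀ l : K, aeval l P = 0 → ∃ l' : V,
      algebraMap V K l' = l ∧ (l' ∈ maximalIdeal V ∨ l' - 1 ∈ maximalIdeal V) := by
  obtain ⟨p, hp, hpI, hpf⟩ := exists_monic_aeval_eq_zero_of_mem_smul_top (maximalIdeal O) hf
  have hX : (X * (X - C 1) : O[X]).Monic := monic_X.mul (monic_X_sub_C 1)
  have hXd : (X * (X - C 1) : O[X]).natDegree ≠ 0 := by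
    rw [monic_X.natDegree_mul (monic_X_sub_C 1), natDegree_X, natDegree_X_sub_C]
    omega
  -- With p annihilating f² - f, the polynomial p(X(X - 1)) annihilates f. If l is one of its roots,
  -- then l(l - 1) is a root of p and lies in the maximal ideal.
  have hP : (p.comp (X * (X - C 1))).Monic := hp.comp hX hXd
  have hPf : aeval f (p.comp (X * (X - C 1))) = 0 := by
    rw [aeval_comp, map_mul, map_sub, aeval_X, aeval_C, map_one, mul_sub, mul_one, hpf]
  refine ⟨p.comp (X * (X - C 1)), hP, hPf, fun l hl => ?_⟩
  have hintO : IsIntegral O l := ⟨p.comp (X * (X - C 1)), hP, hl⟩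
  have hint : IsIntegral V l := hintO.tower_top
  obtain ⟨l', rfl⟩ := IsIntegrallyClosed.isIntegral_iff.1 hint
  refine ⟨l', rfl, ?_⟩
  have h1 : aeval (l' * (l' - 1)) p = 0 := by
    apply FaithfulSMul.algebraMap_injective V K
    rw [← aeval_algebraMap_apply, map_zero, ← hl, aeval_comp, map_mul, map_mul, map_sub, map_sub,
      aeval_X, aeval_C, map_one, map_one]
  have h2 := mem_maximalIdeal_of_aeval_eq_zero hp hpI h1
  exact (maximalIdeal.isMaximal V).isPrime.mem_or_mem h2

/-- A monic polynomial whose roots reduce to `0` or `1` divides `Q (1 - Q)` for some polynomial `Q`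
with `Q(0) = 0` and `Q(1) = 1`. -/
theorem exists_dvd_mul_one_sub {K : Type*} [Field K] [IsAlgClosed K] [Algebra V K]
    [FaithfulSMul V K] {P : V[X]} (hP : P.Monic)
    (hroot : ∀ l : K, aeval l P = 0 → ∃ l' : V,
      algebraMap V K l' = l ∧ (l' ∈ maximalIdeal V ∨ l' - 1 ∈ maximalIdeal V)) :
    ∃ Q : V[X], Q.eval 0 = 0 ∧ Q.eval 1 = 1 ∧ P ∣ Q * (1 - Q) := by
  obtain ⟨a, ha, b, hb, hab⟩ : ∃ a ∈ linearProducts {l : V | l ∈ maximalIdeal V},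
      ∃ b ∈ linearProducts {l : V | l - 1 ∈ maximalIdeal V}, a * b = P := by
    rw [← Submonoid.mem_sup, linearProducts, linearProducts, ← Submonoid.closure_union,
      ← Set.image_union]
    refine mem_linearProducts (K := K) (hP.map _) (IsAlgClosed.splits _) fun l hl => ?_
    obtain ⟨l', h1, h2⟩ := hroot l (by
      have := isRoot_of_mem_roots hl
      rwa [IsRoot, eval_map_algebraMap] at this)
    exact ⟨l', h2, h1⟩
  -- The additional factors X and X - 1 keep the two products coprime and force Q(0) = 0 and Q(1) =
  -- 1 for Q = U·X·a taken from the Bézout relation.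
  have hX0 : (X : V[X]) * a ∈ linearProducts {l : V | l ∈ maximalIdeal V} :=
    mul_mem (Submonoid.subset_closure ⟨0, by simp, by simp⟩) ha
  have hX1 : (X - 1 : V[X]) * b ∈ linearProducts {l : V | l - 1 ∈ maximalIdeal V} :=
    mul_mem (Submonoid.subset_closure ⟨1, by simp, by simp⟩) hb
  obtain ⟨U, W, hUW⟩ := isCoprime_of_mem_linearProducts hX0 hX1
  have h1 : 1 - U * (X * a) = W * ((X - 1) * b) := sub_eq_of_eq_add' hUW.symm
  refine ⟨U * (X * a), by simp, ?_, ?_⟩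
  · have : U * (X * a) = 1 - W * ((X - 1) * b) := eq_sub_of_add_eq hUW
    rw [this]
    simp
  · rw [h1, ← hab]
    exact ⟨U * X * W * (X - 1), by ring⟩

/-- An idempotent polynomial expression in an element that is a central idempotent modulo the
maximal ideal is central after base change. -/
theorem aeval_one_tmul_commute [Module.Finite O Λ] {f : Λ}
    (hf : f * f - f ∈ maximalIdeal O • (⊤ : Submodule O Λ))
    (hc : ∀ x, f * x - x * f ∈ maximalIdeal O • (⊤ : Submodule O Λ)) {Q : V[X]}
    (hQ0 : Q.eval 0 = 0) (hQ1 : Q.eval 1 = 1)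
    (he : IsIdempotentElem (aeval ((1 : V) ⊗ₜ[O] f) Q)) (x : V ⊗[O] Λ) :
    Commute (aeval ((1 : V) ⊗ₜ[O] f) Q) x := by
  have hef : aeval ((1 : V) ⊗ₜ[O] f) Q - 1 ⊗ₜ f ∈
      maximalIdeal V • (⊤ : Submodule V (V ⊗[O] Λ)) := by
    obtain ⟨G, rfl⟩ := exists_eq_X_add_mul hQ0 hQ1
    have h1 : aeval ((1 : V) ⊗ₜ[O] f) (X + (X ^ 2 - X) * G) - 1 ⊗ₜ f =
        (1 ⊗ₜ (f * f - f)) * aeval ((1 : V) ⊗ₜ[O] f) G := by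
      simp [sq, TensorProduct.tmul_sub]
    rw [h1]
    have h2 : (1 : V) ⊗ₜ[O] (f * f - f) ∈ maximalIdeal V • (⊤ : Submodule V (V ⊗[O] Λ)) :=
      one_tmul_mem_smul_top hf
    exact (mul_mem_smul_top (O := V) (Λ := V ⊗[O] Λ) (I := maximalIdeal V) h2 _).1
  have hfc : ∀ x, ((1 : V) ⊗ₜ[O] f) * x - x * 1 ⊗ₜ f ∈
      maximalIdeal V • (⊤ : Submodule V (V ⊗[O] Λ)) := by
    intro x
    induction x using TensorProduct.induction_on with
    | zero => simp
    | add x y hx hy =>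
      rw [mul_add, add_mul, add_sub_add_comm]
      exact add_mem hx hy
    | tmul v y =>
      have h1 : ((1 : V) ⊗ₜ[O] f) * v ⊗ₜ y - v ⊗ₜ y * 1 ⊗ₜ f =
          v • ((1 : V) ⊗ₜ[O] (f * y - y * f)) := by
        rw [TensorProduct.smul_tmul', smul_eq_mul, mul_one, TensorProduct.tmul_sub]
        simp
      rw [h1]
      exact Submodule.smul_mem _ _ (one_tmul_mem_smul_top (hc y))
  generalize aeval ((1 : V) ⊗ₜ[O] f) Q = e at he hef ⊢
  refine commute_of_sub_mem_smul_top (V := V) he (fun x => ?_) x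
  have h1 : e * x - x * e = (e - 1 ⊗ₜ f) * x - x * (e - 1 ⊗ₜ f) +
      (1 ⊗ₜ f * x - x * 1 ⊗ₜ f) := by noncomm_ring
  rw [h1]
  have h2 := mul_mem_smul_top (O := V) (Λ := V ⊗[O] Λ) (I := maximalIdeal V) hef x
  exact add_mem (sub_mem h2.1 h2.2) (hfc x)

end LocalBase

section Spanning

variable {O : Type*} [CommRing O] {F : Type*} [Field F] [Algebra O F]
  {ι : Type} [DecidableEq ι] {d : ι → ℕ} {Λ : Type*} [Ring Λ] [Algebra O Λ]
  {ρ : Λ →ₐ[O] MatrixProd d F}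

/-- An idempotent commuting with the image of a spanning representation is attached to a set. -/
theorem exists_eq_unitOn_of_commute {K : Type*} [Field K] [Algebra F K]
    (hspan : Submodule.span F (Set.range ρ) = ⊤) {y : MatrixProd d K} (hy : IsIdempotentElem y)
    (hc : ∀ x, Commute y (matrixProdMap d (Algebra.ofId F K) (ρ x))) :
    ∃ S, y = unitOn d K S := by
  have hcomm : ∀ x, Commute y (matrixProdMap d (Algebra.ofId F K) x) := by
    intro x
    have hx : x ∈ Submodule.span F (Set.range ρ) := hspan ▸ trivial
    induction hx using Submodule.span_induction with
    | mem x hx =>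
      obtain ⟨z, rfl⟩ := hx
      exact hc z
    | zero => rw [map_zero]; exact Commute.zero_right _
    | add x y _ _ hx hy => rw [map_add]; exact hx.add_right hy
    | smul c x _ hx => rw [map_smul]; exact hx.smul_right c
  refine exists_eq_unitOn (fun i k l => ?_) hy
  convert hcomm (Pi.single i (Matrix.single k l 1)) using 1
  ext i' : 1
  rw [matrixProdMap_apply]
  rcases eq_or_ne i' i with rfl | hi
  · ext
    simp [Matrix.single_apply, Algebra.ofId_apply, apply_ite]
  · simp [hi]

end Spanning

/-! ### Lifting over an integrally closed local domain -/

section IdempotentLift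

variable {O : Type*} [CommRing O] [IsLocalRing O] {F : Type*} [Field F] [Algebra O F]
  {ι : Type} [DecidableEq ι] {d : ι → ℕ} {Λ : Type*} [Ring Λ] [Algebra O Λ] [Module.Finite O Λ]
  {ρ : Λ →ₐ[O] MatrixProd d F}

/-- If `f` is a central idempotent modulo the maximal ideal, then on each factor the eigenvalues of
`f` reduce either all to `0` or all to `1`. -/
theorem exists_set_forall_eigenvalue {V K : Type*} [CommRing V] [IsDomain V] [IsLocalRing V]
    [IsIntegrallyClosed V] [Algebra O V] [IsLocalHom (algebraMap O V)] [Field K] [IsAlgClosed K]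
    [Algebra V K] [IsFractionRing V K] [Algebra O K] [IsScalarTower O V K] [Algebra F K]
    [IsScalarTower O F K] (hspan : Submodule.span F (Set.range ρ) = ⊤) {f : Λ}
    (hf : f * f - f ∈ maximalIdeal O • (⊤ : Submodule O Λ))
    (hc : ∀ x, f * x - x * f ∈ maximalIdeal O • (⊤ : Submodule O Λ)) :
    ∃ S : Set ι,
      (∀ i ∉ S, ∀ l ∈ ((ρ f i).charpoly.map (algebraMap F K)).roots,
        ∃ l' ∈ {l : V | l ∈ maximalIdeal V}, algebraMap V K l' = l) ∧
      (∀ i ∈ S, ∀ l ∈ ((ρ f i).charpoly.map (algebraMap F K)).roots,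
        ∃ l' ∈ {l : V | l - 1 ∈ maximalIdeal V}, algebraMap V K l' = l) := by
  obtain ⟨P, hP, hPf, hroot⟩ := exists_monic_forall_root (V := V) (K := K) hf
  obtain ⟨Q, hQ0, hQ1, hPQ⟩ := exists_dvd_mul_one_sub (K := K) (hP.map (algebraMap O V))
    (by simpa only [aeval_map_algebraMap] using hroot)
  have hPfV : aeval ((1 : V) ⊗ₜ[O] f) (P.map (algebraMap O V)) = 0 := by
    have h1 : aeval ((1 : V) ⊗ₜ[O] f) P =
        (Algebra.TensorProduct.includeRight : Λ →ₐ[O] V ⊗[O] Λ) (aeval f P) :=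
      aeval_algHom_apply (Algebra.TensorProduct.includeRight : Λ →ₐ[O] V ⊗[O] Λ) f P
    rw [aeval_map_algebraMap, h1, hPf, map_zero]
  -- P(f) = 0 and P divides Q(1 - Q).
  have he : IsIdempotentElem (aeval ((1 : V) ⊗ₜ[O] f) Q) := by
    obtain ⟨G, hG⟩ := hPQ
    have h2 := congrArg (aeval ((1 : V) ⊗ₜ[O] f)) hG
    rw [map_mul _ _ G, hPfV, zero_mul, map_mul, map_sub, map_one, mul_sub, mul_one,
      sub_eq_zero] at h2
    exact h2.symm
  have hec := aeval_one_tmul_commute hf hc hQ0 hQ1 he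
  let ρ' : Λ →ₐ[O] MatrixProd d K :=
    ((matrixProdMap d (Algebra.ofId F K)).restrictScalars O).comp ρ
  let ρK : V ⊗[O] Λ →ₐ[V] MatrixProd d K :=
    Algebra.TensorProduct.lift (Algebra.ofId V _) ρ' fun x y => Algebra.commutes x (ρ' y)
  have hρK : ∀ y, ρK (1 ⊗ₜ y) = matrixProdMap d (Algebra.ofId F K) (ρ y) := fun y => by
    refine (Algebra.TensorProduct.lift_tmul _ _ _ _ _).trans ?_
    rw [map_one, one_mul]
    rfl
  -- Over V the idempotent Q(f) is central, hence attached to a set S of factors; this S is the one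
  -- sought.
  obtain ⟨S, hS⟩ := exists_eq_unitOn_of_commute hspan (he.map ρK) fun x => by
    rw [← hρK]
    exact (hec _).map ρK
  have hQe : ∀ i, aeval ((algebraMap F K).mapMatrix (ρ f i)) (Q.map (algebraMap V K)) =
      unitOn d K S i := by
    intro i
    rw [aeval_map_algebraMap, ← hS]
    change _ = (Pi.evalAlgHom V (fun i => Matrix (Fin (d i)) (Fin (d i)) K) i) (ρK (aeval _ Q))
    rw [← aeval_algHom_apply, ← aeval_algHom_apply]
    congr 2
    change _ = ρK (1 ⊗ₜ f) i
    rw [hρK]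
    rfl
  have hev : ∀ i, ∀ l ∈ ((ρ f i).charpoly.map (algebraMap F K)).roots, ∃ l' : V,
      algebraMap V K l' = l ∧ (l' ∈ maximalIdeal V ∨ l' - 1 ∈ maximalIdeal V) ∧
      ∀ c : V, unitOn d K S i = (algebraMap V K c) • 1 → Q.eval l' = c := by
    intro i l hl
    rw [← Matrix.charpoly_map] at hl
    obtain ⟨l', rfl, h2⟩ := hroot l (by
      rw [← eval_map_algebraMap]
      refine eval_eq_of_aeval_eq_smul_one hl ?_
      rw [zero_smul, aeval_map_algebraMap]
      have h3 : aeval (((Pi.evalAlgHom O (fun i => Matrix (Fin (d i)) (Fin (d i)) K) i).comp ρ') f)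
          P = 0 := by
        rw [aeval_algHom_apply, hPf, map_zero]
      exact h3)
    refine ⟨l', rfl, h2, fun c hc => ?_⟩
    apply FaithfulSMul.algebraMap_injective V K
    rw [← eval_eq_of_aeval_eq_smul_one hl ((hQe i).trans hc), eval_map_algebraMap,
      aeval_algebraMap_apply_eq_algebraMap_eval]
  refine ⟨S, fun i hi l hl => ?_, fun i hi l hl => ?_⟩
  -- Off S the eigenvalue satisfies Q(l') = 0, whereas a reduction to 1 would give Q(l') ≡ Q(1) = 1.
  -- On S the roles of 0 and 1 are exchanged.
  · obtain ⟨l', h1, h2, h3⟩ := hev i l hl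
    refine ⟨l', h2.resolve_right fun h4 => ?_, h1⟩
    have h5 := h3 0 (by rw [unitOn_apply_notMem hi, map_zero, zero_smul])
    have h6 := Ideal.mem_of_dvd _ (sub_dvd_eval_sub l' 1 Q) h4
    rw [h5, hQ1] at h6
    simp at h6
  · obtain ⟨l', h1, h2, h3⟩ := hev i l hl
    refine ⟨l', h2.resolve_left fun h4 => ?_, h1⟩
    have h5 := h3 1 (by rw [unitOn_apply_mem hi, map_one, one_smul])
    have h6 := Ideal.mem_of_dvd _ (sub_dvd_eval_sub l' 0 Q) (by rwa [sub_zero])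
    rw [h5, hQ0] at h6
    simp at h6

/-- Over an integrally closed local domain, an element of an order in a product of matrix algebras
that is a central idempotent modulo the maximal ideal is congruent to a central idempotent. -/
theorem exists_unitOn_sub_mem_smul_top [IsDomain O] [IsIntegrallyClosed O] [IsFractionRing O F]
    [Fintype ι] (hspan : Submodule.span F (Set.range ρ) = ⊤) {f : Λ}
    (hf : f * f - f ∈ maximalIdeal O • (⊤ : Submodule O Λ))
    (hc : ∀ x, f * x - x * f ∈ maximalIdeal O • (⊤ : Submodule O Λ)) :
    ∃ (S : Set ι) (e : Λ), ρ e = unitOn d F S ∧ e - f ∈ maximalIdeal O • (⊤ : Submodule O Λ) := by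
  classical
  let K := AlgebraicClosure F
  -- A valuation ring of the algebraic closure dominating O contains all the eigenvalues. It serves
  -- only to sort them by residue; the idempotent itself is built over O.
  obtain ⟨V, hV, hloc⟩ := IsLocalRing.exists_factor_valuationRing (algebraMap O K)
  let : Algebra O V := ((algebraMap O K).codRestrict V.toSubring hV).toAlgebra
  have : IsLocalHom (algebraMap O V) := hloc
  have : IsScalarTower O V K := IsScalarTower.of_algebraMap_eq fun _ => rfl
  obtain ⟨S, hS0, hS1⟩ := exists_set_forall_eigenvalue (V := V) (K := K) hspan hf hc
  have hint : ∀ i, IsIntegral O (ρ f i) := fun i =>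
    (Algebra.IsIntegral.isIntegral (R := O) f).map
      ((Pi.evalAlgHom O (fun i => Matrix (Fin (d i)) (Fin (d i)) F) i).comp ρ)
  choose P hPm hP using fun i => exists_monic_map_eq_charpoly (hint i)
  have hPV : ∀ i, ((P i).map (algebraMap O V)).map (algebraMap V K) =
      (ρ f i).charpoly.map (algebraMap F K) := fun i => by
    rw [← hP, Polynomial.map_map, Polynomial.map_map, ← IsScalarTower.algebraMap_eq,
      ← IsScalarTower.algebraMap_eq]
  have hPl : ∀ (W : Set V) i, (∀ l ∈ ((ρ f i).charpoly.map (algebraMap F K)).roots,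
      ∃ l' ∈ W, algebraMap V K l' = l) → (P i).map (algebraMap O V) ∈ linearProducts W :=
    fun W i h => mem_linearProducts (K := K) (((hPm i).map _).map _) (IsAlgClosed.splits _)
      (by rwa [hPV])
  -- The characteristic polynomials of the factors off S and on S; the factors X and X - 1 again
  -- normalize the values at 0 and 1.
  let P0 := X * ∏ i ∈ Finset.univ.filter (· ∉ S), P i
  let P1 := (X - C 1) * ∏ i ∈ Finset.univ.filter (· ∈ S), P i
  have hP0 : P0.Monic := monic_X.mul (monic_prod_of_monic _ _ fun i _ => hPm i)
  have hcopV : IsCoprime (P0.map (algebraMap O V)) (P1.map (algebraMap O V)) := by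
    apply isCoprime_of_mem_linearProducts
    · rw [Polynomial.map_mul, Polynomial.map_prod, map_X]
      refine mul_mem (Submonoid.subset_closure ⟨0, by simp, by simp⟩) (prod_mem fun i hi => ?_)
      exact hPl _ i (hS0 i (Finset.mem_filter.1 hi).2)
    · rw [Polynomial.map_mul, Polynomial.map_prod, Polynomial.map_sub, map_X, map_C, map_one]
      refine mul_mem (Submonoid.subset_closure ⟨1, by simp, rfl⟩) (prod_mem fun i hi => ?_)
      exact hPl _ i (hS1 i (Finset.mem_filter.1 hi).2)
  -- Coprimality descends from V to O: the resultant of two monic polynomials lies in O, and it is a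
  -- unit there as soon as it is one in V, because O → V is local.
  have hcop : IsCoprime P0 P1 := by
    rw [← isUnit_resultant_iff_isCoprime (hP0.map _)] at hcopV
    rw [← isUnit_resultant_iff_isCoprime hP0]
    have hP1 : P1.Monic := (monic_X_sub_C 1).mul (monic_prod_of_monic _ _ fun i _ => hPm i)
    rw [hP0.natDegree_map, hP1.natDegree_map, resultant_map_map] at hcopV
    exact isUnit_of_map_unit _ _ hcopV
  obtain ⟨U, W, hUW⟩ := hcop
  have hQ0 : (U * P0).eval 0 = 0 := by simp [P0]
  have hQ1 : (U * P0).eval 1 = 1 := by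
    rw [eq_sub_of_add_eq hUW]
    simp [P1]
  have hval : ∀ (i : ι) (Q : O[X]), ρ (aeval f Q) i = aeval (ρ f i) Q := fun i Q =>
    (aeval_algHom_apply ((Pi.evalAlgHom O (fun i => Matrix (Fin (d i)) (Fin (d i)) F) i).comp ρ)
      f Q).symm
  -- Cayley–Hamilton on the i-th factor. It makes U·P0 take the value 0 off S, and 1 = U·P0 + W·P1
  -- take care of S.
  have hvan : ∀ (i : ι) (Q : O[X]), P i ∣ Q → aeval (ρ f i) Q = 0 := by
    rintro i _ ⟨G, rfl⟩
    rw [map_mul, ← aeval_map_algebraMap F, hP, Matrix.aeval_self_charpoly, zero_mul]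
  refine ⟨S, aeval f (U * P0), funext fun i => ?_, ?_⟩
  · rw [hval]
    by_cases hi : i ∈ S
    · rw [unitOn_apply_mem hi, eq_sub_of_add_eq hUW, map_sub, map_one, hvan i, sub_zero]
      exact Dvd.dvd.mul_left (Dvd.dvd.mul_left
        (Finset.dvd_prod_of_mem P (Finset.mem_filter.2 ⟨Finset.mem_univ i, hi⟩)) _) _
    · rw [unitOn_apply_notMem hi, hvan i]
      exact Dvd.dvd.mul_left (Dvd.dvd.mul_left
        (Finset.dvd_prod_of_mem P (Finset.mem_filter.2 ⟨Finset.mem_univ i, hi⟩)) _) _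
  · obtain ⟨G, hG⟩ := exists_eq_X_add_mul hQ0 hQ1
    have h1 : aeval f (U * P0) - f = (f * f - f) * aeval f G := by
      rw [hG, map_add, map_mul, map_sub, map_pow, aeval_X, add_sub_cancel_left, sq]
    rw [h1]
    exact (mul_mem_smul_top (I := maximalIdeal O) hf _).1

end IdempotentLift

end LiftingTheorem

/-! ### Laurent polynomial rings -/

section LaurentRings

theorem isNoetherianRing_laurent (R : Type u) [CommRing R] [IsNoetherianRing R] (n : ℕ) :
    IsNoetherianRing (Laurent R n) := by
  have : AddMonoid.FG (Fin n → ℤ) := by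
    rw [← AddGroup.fg_iff_addMonoid_fg, ← Module.Finite.iff_addGroup_fg]
    infer_instance
  exact Algebra.FiniteType.isNoetherianRing R _

/-- Adding one variable amounts to localizing a polynomial ring at the powers of X, and both
operations preserve integral closedness. -/
theorem isIntegrallyClosed_laurent (R : Type u) [CommRing R] [IsDomain R] [IsIntegrallyClosed R]
    (n : ℕ) : IsIntegrallyClosed (Laurent R n) := by
  induction n with
  | zero => exact IsIntegrallyClosed.of_equiv (AddMonoidAlgebra.uniqueRingEquiv (Fin 0 → ℤ)).symm
  | succ n ih =>
    let e : (Fin (n + 1) → ℤ) ≃+ ℤ × (Fin n → ℤ) :=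
      { (Fin.consEquiv fun _ => ℤ).symm with
        map_add' := fun _ _ => rfl }
    have : IsIntegrallyClosed (LaurentPolynomial (Laurent R n)) :=
      isIntegrallyClosed_of_isLocalization (R := Polynomial (Laurent R n)) _
        (Submonoid.powers Polynomial.X) (by
          rw [Submonoid.powers_le]
          exact mem_nonZeroDivisors_of_ne_zero Polynomial.X_ne_zero)
    exact IsIntegrallyClosed.of_equiv
      ((AddMonoidAlgebra.domCongr R R e).toRingEquiv.trans
        AddMonoidAlgebra.curryRingEquiv).symm

theorem mem_extendedIdeal_iff {R : Type u} [CommRing R] {p : Ideal R} {n : ℕ} {x : Laurent R n} :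
    x ∈ extendedIdeal p n ↔ ∀ g, x.coeff g ∈ p := by
  rw [← ker_mapRingHom_mk, RingHom.mem_ker, ← AddMonoidAlgebra.coeff_inj, DFunLike.ext_iff]
  simp [Ideal.Quotient.eq_zero_iff_mem]

theorem single_mem_extendedIdeal {R : Type u} [CommRing R] {p : Ideal R} {n : ℕ} {r : R}
    (hr : r ∈ p) (g : Fin n → ℤ) : (AddMonoidAlgebra.single g r : Laurent R n) ∈
      extendedIdeal p n := by
  rw [mem_extendedIdeal_iff]
  intro g'
  rw [AddMonoidAlgebra.coeff_single, Finsupp.single_apply]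
  split_ifs
  exacts [hr, p.zero_mem]

/-- In the quotient by M - 1 the class of M is the unit 1, so its negative powers are 1 as well. -/
theorem single_zsmul_sub_one_mem {R : Type u} [CommRing R] {n : ℕ} (a : Fin n → ℤ) (k : ℤ) :
    (AddMonoidAlgebra.single (k • a) 1 : Laurent R n) - 1 ∈ Ideal.span {monomial R a - 1} := by
  let π := Ideal.Quotient.mk (Ideal.span {monomial R a - 1})
  let θ : Multiplicative (Fin n → ℤ) →* (Laurent R n ⧸ Ideal.span {monomial R a - 1}) :=
    (π : Laurent R n →* _).comp (AddMonoidAlgebra.of R (Fin n → ℤ))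
  have h1 : θ (Multiplicative.ofAdd a) = 1 := by
    have : π (monomial R a - 1) = 0 :=
      Ideal.Quotient.eq_zero_iff_mem.2 (Ideal.subset_span rfl)
    rw [map_sub, map_one, sub_eq_zero] at this
    exact this
  have h1' : θ.toHomUnits (Multiplicative.ofAdd a) = 1 := Units.ext h1
  have h2 : θ.toHomUnits (Multiplicative.ofAdd (k • a)) = 1 := by
    rw [ofAdd_zsmul, map_zpow, h1', one_zpow]
  apply Ideal.Quotient.eq_zero_iff_mem.1
  rw [map_sub, map_one, sub_eq_zero]
  exact congrArg Units.val h2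

/-- The ideal `𝔮_M` is the inverse image of `𝔭` under any morphism contracting `M`. -/
theorem mem_monomialIdeal_iff {R : Type u} [CommRing R] {p : Ideal R} {n k : ℕ} {a : Fin n → ℤ}
    {f : (Fin n → ℤ) →+ (Fin k → ℤ)} (hf : f.ker = AddSubgroup.zmultiples a) {x : Laurent R n} :
    x ∈ monomialIdeal p a ↔
      AddMonoidAlgebra.mapDomainAlgHom R R f x ∈ extendedIdeal p k := by
  have hσ : ∀ g r, AddMonoidAlgebra.mapDomainAlgHom R R f (AddMonoidAlgebra.single g r) =
      AddMonoidAlgebra.single (f g) r := fun g r => by simp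
  constructor
  · intro hx
    refine (show monomialIdeal p a ≤ (extendedIdeal p k).comap
      (AddMonoidAlgebra.mapDomainAlgHom R R f) from sup_le ?_ ?_) hx
    · rw [Ideal.span_singleton_le_iff_mem, Ideal.mem_comap]
      have h0 : f a = 0 := by
        rw [← AddMonoidHom.mem_ker, hf]
        exact AddSubgroup.mem_zmultiples a
      have : AddMonoidAlgebra.mapDomainAlgHom R R f (monomial R a - 1) = 0 := by
        rw [map_sub, map_one, monomial, hσ, h0, sub_eq_zero]
        rfl
      rw [this]
      exact zero_mem _
    · refine Ideal.map_le_iff_le_comap.2 fun r hr => ?_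
      rw [Ideal.mem_comap, Ideal.mem_comap, AlgHom.commutes]
      exact Ideal.mem_map_of_mem _ hr
  · intro hx
    -- A set-theoretic section of f over its image. Transport of exponents along s is only additive,
    -- which suffices: monomials with the same image under f differ by a power of M.
    let s : (Fin k → ℤ) → (Fin n → ℤ) := Function.invFun f
    have hs : ∀ g, ∃ z : ℤ, g = s (f g) + z • a := by
      intro g
      have h1 : f (s (f g)) = f g := Function.invFun_eq ⟨g, rfl⟩
      have h2 : g - s (f g) ∈ f.ker := by rw [AddMonoidHom.mem_ker, map_sub, h1, sub_self]
      rw [hf] at h2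
      obtain ⟨z, hz⟩ := h2
      exact ⟨z, by simp only at hz; rw [hz]; abel⟩
    have h1 : ∀ x : Laurent R n, x - AddMonoidAlgebra.mapDomain s
        (AddMonoidAlgebra.mapDomainAlgHom R R f x) ∈ Ideal.span {monomial R a - 1} := by
      intro x
      induction x using AddMonoidAlgebra.induction_linear with
      | zero => simp
      | add x y hx hy =>
        rw [map_add, AddMonoidAlgebra.mapDomain_add, add_sub_add_comm]
        exact Ideal.add_mem _ hx hy
      | single g r =>
        obtain ⟨z, hz⟩ := hs g
        have : (AddMonoidAlgebra.single g r : Laurent R n) -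
            AddMonoidAlgebra.single (s (f g)) r =
            AddMonoidAlgebra.single (s (f g)) r *
              ((AddMonoidAlgebra.single (z • a) 1 : Laurent R n) - 1) := by
          rw [mul_sub, mul_one, AddMonoidAlgebra.single_mul_single, mul_one, ← hz]
        rw [hσ, AddMonoidAlgebra.mapDomain_single, this]
        exact Ideal.mul_mem_left _ _ (single_zsmul_sub_one_mem a z)
    have h2 : ∀ y ∈ extendedIdeal p k,
        (AddMonoidAlgebra.mapDomain s y : Laurent R n) ∈ extendedIdeal p n := by
      intro y hy
      rw [← AddMonoidAlgebra.sum_coeff_single y, AddMonoidAlgebra.mapDomain_sum, Finsupp.sum]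
      refine sum_mem fun g _ => ?_
      rw [AddMonoidAlgebra.mapDomain_single]
      exact single_mem_extendedIdeal (mem_extendedIdeal_iff.1 hy g) _
    rw [← sub_add_cancel x (AddMonoidAlgebra.mapDomain s
        (AddMonoidAlgebra.mapDomainAlgHom R R f x))]
    exact Ideal.add_mem _ (Ideal.mem_sup_left (h1 x)) (Ideal.mem_sup_right (h2 _ hx))

/-- By Bézout some linear form u has u(a) = 1, and g ↦ g - u(g)a is the projection along a. -/
theorem exists_ker_eq_zmultiples {n : ℕ} {a : Fin n → ℤ} (ha : IsPrimitiveExponent a) :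
    ∃ f : (Fin n → ℤ) →+ (Fin n → ℤ), f.ker = AddSubgroup.zmultiples a := by
  obtain ⟨c, hc⟩ := Finset.gcd_eq_sum_mul Finset.univ a
  rw [ha] at hc
  let u : (Fin n → ℤ) →+ ℤ :=
    { toFun := fun g => ∑ i, g i * c i
      map_zero' := by simp
      map_add' := fun g g' => by simp [add_mul, Finset.sum_add_distrib] }
  have hu : u a = 1 := hc.symm
  refine ⟨AddMonoidHom.id _ - (zmultiplesHom _ a).comp u, ?_⟩
  ext g
  rw [AddMonoidHom.mem_ker, AddSubgroup.mem_zmultiples_iff]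
  constructor
  · intro h
    exact ⟨u g, (sub_eq_zero.1 h).symm⟩
  · rintro ⟨k, rfl⟩
    change k • a - u (k • a) • a = 0
    rw [map_zsmul, hu, smul_eq_mul, mul_one, sub_self]

/-- A zero divisor in a group algebra of an ordered group annihilates a multiple of its partner by
a power product of its coefficients. -/
theorem exists_mem_smul_eq_zero_of_mul_eq_zero {Q G : Type*} [CommRing Q] [AddCommGroup G]
    [LinearOrder G] [IsOrderedAddMonoid G] (S : Submonoid Q) {v : AddMonoidAlgebra Q G} {g₀ : G}
    (hv : v.coeff g₀ ∈ S) (f : AddMonoidAlgebra Q G) (hfv : f * v = 0) :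
    ∃ c ∈ S, c • f = 0 := by
  induction hn : f.coeff.support.card using Nat.strong_induction_on generalizing f with
  | _ n ih =>
  subst hn
  -- The outer induction is on the size of the support of f. Inside, the coefficients of v are
  -- treated from the top exponent downwards, s being the set of those already dealt with.
  have key : ∀ s : Finset G, (∀ g ∈ v.coeff.support, g ∉ s → ∀ x ∈ s, g < x) →
      ∃ c ∈ S, ∀ x ∈ s, (c * v.coeff x) • f = 0 := by
    intro s
    induction s using Finset.induction_on_min with
    | empty => exact fun _ => ⟨1, S.one_mem, by simp⟩
    | insert a s has ihs =>
      intro hs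
      obtain ⟨c, hc, hcs⟩ := ihs fun g hg hgs x hx => by
        rcases eq_or_ne g a with rfl | hga
        · exact has x hx
        · exact (hs g hg (by simp [hga, hgs]) a (Finset.mem_insert_self _ _)).trans (has x hx)
      by_cases h0 : (c • f).coeff.support.Nonempty
      · let m := (c • f).coeff.support.max' h0
        have hm : (c • f).coeff m ≠ 0 :=
          Finsupp.mem_support_iff.1 ((c • f).coeff.support.max'_mem h0)
        have hmul : (c • f) * v = 0 := by rw [smul_mul_assoc, hfv, smul_zero]
        -- In degree m + a of (cf)v, a term of cf below m meets a coefficient of v above a, which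
        -- either annihilates cf or is zero. Only the product of the two displayed coefficients
        -- remains.
        have htop : v.coeff a * (c • f).coeff m = 0 := by
          have h1 := congrArg (fun x => x.coeff (m + a)) hmul
          simp only [AddMonoidAlgebra.coeff_mul_apply_left, AddMonoidAlgebra.coeff_zero,
            Finsupp.coe_zero, Pi.zero_apply, Finsupp.sum] at h1
          rw [Finset.sum_eq_single_of_mem m ((c • f).coeff.support.max'_mem h0),
            neg_add_cancel_left, mul_comm] at h1
          · exact h1
          intro h hh hne
          have hlt : h < m := lt_of_le_of_ne (Finset.le_max' _ _ hh) hne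
          have hlt' : a < -h + (m + a) := by
            have : (0 : G) < -h + m := by rwa [neg_add_eq_sub, sub_pos]
            rw [← add_assoc]
            exact lt_add_of_pos_left a this
          by_cases hmem : -h + (m + a) ∈ s
          · have h2 := congrArg (fun x => x.coeff h) (hcs _ hmem)
            simp only [mul_comm c, mul_smul] at h2
            rw [mul_comm]
            exact h2
          · by_cases hsup : -h + (m + a) ∈ v.coeff.support
            · exact absurd (hs _ hsup (by simp [hmem, hlt'.ne']) a (Finset.mem_insert_self _ _))
                (not_lt.2 hlt'.le)
            · rw [Finsupp.notMem_support_iff.1 hsup, mul_zero]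
        -- Multiplication by the coefficient of v at a kills the leading term of cf, so the outer
        -- induction applies.
        have hcard : (v.coeff a • c • f).coeff.support.card < f.coeff.support.card := by
          have hsub : (c • f).coeff.support ⊆ f.coeff.support := Finsupp.support_smul
          refine Finset.card_lt_card ((Finset.ssubset_iff_of_subset
            (Finsupp.support_smul.trans hsub)).2
              ⟨m, hsub ((c • f).coeff.support.max'_mem h0), ?_⟩)
          exact Finsupp.notMem_support_iff.2 htop
        obtain ⟨c', hc', h'⟩ := ih _ hcard (v.coeff a • c • f)
          (by rw [smul_mul_assoc, hmul, smul_zero]) rfl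
        refine ⟨c' * c, S.mul_mem hc' hc, fun x hx => ?_⟩
        rcases Finset.mem_insert.1 hx with rfl | hx
        · rw [← h', smul_smul, smul_smul]
          congr 1
          ring
        · rw [mul_assoc, mul_smul, hcs x hx, smul_zero]
      · have h1 : c • f = 0 := by
          rw [← AddMonoidAlgebra.coeff_eq_zero, ← Finsupp.support_eq_empty]
          exact Finset.not_nonempty_iff_eq_empty.1 h0
        exact ⟨c, hc, fun x _ => by rw [mul_comm, mul_smul, h1, smul_zero]⟩
  obtain ⟨c, hc, h⟩ := key (insert g₀ v.coeff.support) fun g hg hg' => by simp_all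
  exact ⟨c * v.coeff g₀, S.mul_mem hc hv, h g₀ (Finset.mem_insert_self _ _)⟩

/-- If `f v` is divisible by `ξ ∈ R` and `v ∉ 𝔭A`, then `c f` is divisible by `ξ` for some
`c ∈ R ∖ 𝔭`. -/
theorem exists_notMem_mul_dvd {R : Type u} [CommRing R] {p : Ideal R} (hp : p.IsPrime) {n : ℕ}
    {ξ : R} {f v : Laurent R n} (hv : v ∉ extendedIdeal p n)
    (h : algebraMap R (Laurent R n) ξ ∣ f * v) :
    ∃ c ∉ p, algebraMap R (Laurent R n) ξ ∣ algebraMap R (Laurent R n) c * f := by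
  -- Divisibility by ξ is vanishing over R/ξ, where f becomes a zero divisor annihilated by v, and v
  -- keeps a coefficient in the image of R ∖ 𝔭.
  let π := AddMonoidAlgebra.mapRingHom (Fin n → ℤ) (Ideal.Quotient.mk (Ideal.span {ξ}))
  have hker : ∀ x : Laurent R n, π x = 0 ↔ algebraMap R (Laurent R n) ξ ∣ x := by
    intro x
    rw [← RingHom.mem_ker, ker_mapRingHom_mk, extendedIdeal, Ideal.map_span, Set.image_singleton,
      Ideal.mem_span_singleton]
  obtain ⟨g₀, hg₀⟩ : ∃ g, v.coeff g ∉ p := by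
    by_contra! h
    exact hv (mem_extendedIdeal_iff.2 h)
  have h0 : π f * π v = 0 := by rw [← map_mul, hker]; exact h
  have hmem : (π v).coeff g₀ ∈ p.primeCompl.map (Ideal.Quotient.mk (Ideal.span {ξ})) :=
    ⟨v.coeff g₀, hg₀, by simp [π]⟩
  -- The lexicographic order makes the group of exponents an ordered group.
  obtain ⟨_, ⟨c, hc, rfl⟩, hcf⟩ := @exists_mem_smul_eq_zero_of_mul_eq_zero _ (Fin n → ℤ) _ _
    (inferInstanceAs (LinearOrder (Lex (Fin n → ℤ))))
    (inferInstanceAs (IsOrderedAddMonoid (Lex (Fin n → ℤ)))) _ _ _ hmem (π f) h0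
  refine ⟨c, hc, ?_⟩
  rw [← hker, map_mul, ← hcf]
  have : π (algebraMap R (Laurent R n) c) =
      algebraMap _ _ (Ideal.Quotient.mk (Ideal.span {ξ}) c) := by
    simp [π]
  rw [this, ← Algebra.smul_def]

end LaurentRings

/-! ### Essential factorizations -/

section Factorizations

open Polynomial

theorem isUnit_monomial (R : Type u) [CommRing R] {n : ℕ} (a : Fin n → ℤ) :
    IsUnit (monomial R a) := by
  refine IsUnit.of_mul_eq_one (monomial R (-a)) ?_
  rw [monomial, monomial, AddMonoidAlgebra.single_mul_single, add_neg_cancel, mul_one]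
  rfl

theorem monomial_add (R : Type u) [CommRing R] {n : ℕ} (a b : Fin n → ℤ) :
    monomial R (a + b) = monomial R a * monomial R b := by
  rw [monomial, monomial, monomial, AddMonoidAlgebra.single_mul_single, mul_one]

theorem monomial_nsmul (R : Type u) [CommRing R] {n : ℕ} (k : ℕ) (a : Fin n → ℤ) :
    monomial R (k • a) = monomial R a ^ k := by
  rw [monomial, monomial, AddMonoidAlgebra.single_pow, one_pow]

theorem eq_or_eq_neg_of_mem_zmultiples {n : ℕ} {a b : Fin n → ℤ} (hb : IsPrimitiveExponent b)
    (h : b ∈ AddSubgroup.zmultiples a) : b = a ∨ b = -a := by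
  obtain ⟨k, rfl⟩ := h
  have h1 : k ∣ 1 := by
    rw [← show Finset.univ.gcd (k • a) = 1 from hb]
    exact Finset.dvd_gcd fun i _ => ⟨a i, rfl⟩
  rcases Int.isUnit_iff.1 (isUnit_of_dvd_one h1) with rfl | rfl
  · left; simp
  · right; simp

theorem IsPrimitiveExponent.neg {n : ℕ} {a : Fin n → ℤ} (ha : IsPrimitiveExponent a) :
    IsPrimitiveExponent (-a) := by
  rw [IsPrimitiveExponent, ← Finset.normalize_gcd, normalize_eq_one]
  refine isUnit_of_dvd_one ?_
  rw [← show Finset.univ.gcd a = 1 from ha]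
  exact Finset.dvd_gcd fun i hi => (dvd_neg (b := a i)).1 (Finset.gcd_dvd (f := -a) hi)

/-- A monic polynomial does not vanish at a monomial independent of `M`. -/
theorem aeval_monomial_notMem_monomialIdeal {R : Type u} [CommRing R] {p : Ideal R}
    (hp : p.IsPrime) {n : ℕ} {a b : Fin n → ℤ} (ha : IsPrimitiveExponent a)
    (hb : b ∉ AddSubgroup.zmultiples a) {Ψ : R[X]} (hΨ : Ψ.Monic) :
    aeval (monomial R b) Ψ ∉ monomialIdeal p a := by
  obtain ⟨f, hf⟩ := exists_ker_eq_zmultiples ha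
  have hfb : f b ≠ 0 := by rwa [← hf, AddMonoidHom.mem_ker] at hb
  rw [mem_monomialIdeal_iff hf, mem_extendedIdeal_iff]
  intro h
  -- As f(b) ≠ 0, its multiples are distinct exponents, so the leading coefficient 1 stands alone in
  -- its degree and cannot lie in 𝔭.
  have h1 := h (Ψ.natDegree • f b)
  rw [← aeval_algHom_apply, monomial, aeval_eq_sum_range, AddMonoidAlgebra.coeff_sum,
    Finsupp.finsetSum_apply, Finset.sum_eq_single_of_mem Ψ.natDegree (by simp)] at h1
  · have h2 : (Ψ.coeff Ψ.natDegree • (AddMonoidAlgebra.mapDomainAlgHom R R f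
        (AddMonoidAlgebra.single b 1)) ^ Ψ.natDegree).coeff (Ψ.natDegree • f b) = 1 := by
      rw [hΨ.coeff_natDegree, one_smul]
      simp [AddMonoidAlgebra.single_pow]
    rw [h2] at h1
    exact hp.ne_top ((Ideal.eq_top_iff_one _).2 h1)
  · intro k _ hk
    have : k • f b ≠ Ψ.natDegree • f b := fun h => hk <| by
      obtain ⟨j, hj⟩ := Function.ne_iff.1 hfb
      have hj' := congrFun h j
      simp only [Pi.smul_apply, nsmul_eq_mul] at hj'
      exact_mod_cast mul_right_cancel₀ hj hj'
    simp [AddMonoidAlgebra.single_pow, -nsmul_eq_mul, this]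

/-- Contracting M sends every power of M to 1, hence the value of Ψ to the constant Ψ(1). -/
theorem aeval_monomial_mem_monomialIdeal_iff {R : Type u} [CommRing R] {p : Ideal R}
    {n : ℕ} {a b : Fin n → ℤ} (ha : IsPrimitiveExponent a)
    (hb : b ∈ AddSubgroup.zmultiples a) (Ψ : R[X]) :
    aeval (monomial R b) Ψ ∈ monomialIdeal p a ↔ Ψ.eval 1 ∈ p := by
  obtain ⟨f, hf⟩ := exists_ker_eq_zmultiples ha
  have hfb : f b = 0 := by rwa [← hf, AddMonoidHom.mem_ker] at hb
  rw [mem_monomialIdeal_iff hf, ← aeval_algHom_apply]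
  have h1 : AddMonoidAlgebra.mapDomainAlgHom R R f (monomial R b) =
      algebraMap R (Laurent R n) 1 := by
    rw [monomial, map_one]
    simp [hfb, AddMonoidAlgebra.one_def]
  rw [h1, aeval_algebraMap_apply_eq_algebraMap_eval, mem_extendedIdeal_iff]
  constructor
  · intro h
    simpa using h 0
  · intro h g
    have := mem_extendedIdeal_iff.1 (single_mem_extendedIdeal (n := n) h 0) g
    simpa using this

/-- The cofactor of the coefficient in an essential factorization. -/
def EssentialFactorization.cofactor {R : Type u} [CommRing R] [IsDomain R] {n : ℕ}
    (d : EssentialFactorization R n) : Laurent R n :=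
  monomial R d.N * ∏ i, (aeval (monomial R (d.M i)) (d.Ψ i)) ^ d.mult i

theorem EssentialFactorization.value_eq {R : Type u} [CommRing R] [IsDomain R] {n : ℕ}
    (d : EssentialFactorization R n) :
    d.value = algebraMap R (Laurent R n) d.ξ * d.cofactor :=
  mul_assoc _ _ _

/-- Monomials are units and the ideal is prime, so each factor may be tested alone. A primitive
exponent is either ±a or independent of a. -/
theorem EssentialFactorization.cofactor_notMem {R : Type u} [CommRing R] [IsDomain R] {n : ℕ}
    (d : EssentialFactorization R n) {p : Ideal R} (hp : p.IsPrime) {a : Fin n → ℤ}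
    (ha : IsPrimitiveExponent a)
    (h : ∀ i, d.M i = a ∨ d.M i = -a → (d.Ψ i).eval 1 ∉ p) :
    d.cofactor ∉ monomialIdeal p a := by
  have hq := monomialIdeal_isPrime p hp a ha
  intro hmem
  rcases hq.mem_or_mem hmem with h1 | h1
  · exact hq.ne_top (Ideal.eq_top_of_isUnit_mem _ h1 (isUnit_monomial R _))
  obtain ⟨i, -, h2⟩ := hq.prod_mem_iff.1 h1
  have h3 := hq.mem_of_pow_mem _ h2
  by_cases hi : d.M i ∈ AddSubgroup.zmultiples a
  · rw [aeval_monomial_mem_monomialIdeal_iff ha hi] at h3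
    exact h i (eq_or_eq_neg_of_mem_zmultiples (d.M_primitive i) hi) h3
  · exact aeval_monomial_notMem_monomialIdeal hp ha hi (d.Ψ_monic i) h3

theorem EssentialFactorization.eval_one_ne_zero {R : Type u} [CommRing R] [IsDomain R] {n : ℕ}
    (d : EssentialFactorization R n) (i : Fin d.card) : (d.Ψ i).eval 1 ≠ 0 := by
  intro h
  obtain ⟨u, w, huw⟩ := d.Ψ_coprime_X_sub_one i
  have := congrArg (eval 1) huw
  simp [eval_map, eval₂_at_one, h] at this

theorem natDegree_reverse_of_coeff_zero_ne_zero {R : Type u} [Semiring R] {f : R[X]}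
    (hf : f.coeff 0 ≠ 0) : f.reverse.natDegree = f.natDegree := by
  rw [reverse_natDegree, natTrailingDegree_eq_zero.2 (Or.inr hf), Nat.sub_zero]

theorem reverse_reverse_of_coeff_zero_ne_zero {R : Type u} [Semiring R] {f : R[X]}
    (hf : f.coeff 0 ≠ 0) : f.reverse.reverse = f := by
  ext k
  rw [coeff_reverse, coeff_reverse, natDegree_reverse_of_coeff_zero_ne_zero hf, revAt_invol]

/-- Reversal is multiplicative, and it is an involution preserving the degree on polynomials with
nonzero constant term. -/
theorem irreducible_reverse {K : Type u} [Field K] {f : K[X]} (hf : Irreducible f)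
    (h0 : f.coeff 0 ≠ 0) : Irreducible f.reverse := by
  have hunit : ∀ g : K[X], g.coeff 0 ≠ 0 → IsUnit g.reverse → IsUnit g := by
    intro g hg hu
    rw [isUnit_iff_degree_eq_zero] at hu ⊢
    have hne : g ≠ 0 := by rintro rfl; simp at hg
    rw [degree_eq_natDegree (by simpa using hne),
      natDegree_reverse_of_coeff_zero_ne_zero hg] at hu
    rw [degree_eq_natDegree hne, hu]
  refine ⟨fun hu => hf.not_isUnit (hunit f h0 hu), fun g h hgh => ?_⟩
  have hc : g.coeff 0 * h.coeff 0 ≠ 0 := by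
    rw [← mul_coeff_zero, ← hgh, coeff_zero_reverse]
    exact leadingCoeff_ne_zero.2 hf.ne_zero
  have hf' : f = g.reverse * h.reverse := by
    rw [← reverse_mul_of_domain, ← hgh, reverse_reverse_of_coeff_zero_ne_zero h0]
  exact (hf.isUnit_or_isUnit hf').imp (hunit g (left_ne_zero_of_mul hc))
    (hunit h (right_ne_zero_of_mul hc))

/-- The monic polynomial whose roots are the inverses of the roots of `Ψ`. -/
def invRootsPoly {R : Type u} [CommRing R] (Ψ : R[X]) (c : Rˣ) : R[X] := C (↑c⁻¹ : R) * Ψ.reverse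

section InvRoots

variable {R : Type u} [CommRing R] {Ψ : R[X]} {c : Rˣ}

theorem coeff_zero_invRootsPoly (hm : Ψ.Monic) : (invRootsPoly Ψ c).coeff 0 = ↑c⁻¹ := by
  rw [invRootsPoly, coeff_C_mul, coeff_zero_reverse, hm, mul_one]

theorem eval_one_invRootsPoly : (invRootsPoly Ψ c).eval 1 = ↑c⁻¹ * Ψ.eval 1 := by
  let _ : Invertible (1 : R) := invertibleOne
  have h := eval₂_reverse_mul_pow (RingHom.id R) 1 Ψ
  rw [invOf_one, one_pow, mul_one, eval₂_id, eval₂_id] at h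
  rw [invRootsPoly, eval_mul, eval_C, h]

/-- This makes a monomial and its inverse interchangeable in a factorization, at the price of a unit
of R and a monomial. -/
theorem aeval_invRootsPoly {n : ℕ} (b : Fin n → ℤ) :
    aeval (monomial R b) Ψ = algebraMap R (Laurent R n) c * monomial R (Ψ.natDegree • b) *
      aeval (monomial R (-b)) (invRootsPoly Ψ c) := by
  let _ : Invertible (monomial R b) :=
    { invOf := monomial R (-b)
      invOf_mul_self := by rw [← monomial_add, neg_add_cancel]; rfl
      mul_invOf_self := by rw [← monomial_add, add_neg_cancel]; rfl }
  have h := eval₂_reverse_mul_pow (algebraMap R (Laurent R n)) (monomial R b) Ψ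
  have hinv : ⅟(monomial R b) = monomial R (-b) := rfl
  rw [hinv, ← monomial_nsmul] at h
  rw [aeval_def, ← h, invRootsPoly, map_mul, aeval_C, aeval_def]
  have h1 : algebraMap R (Laurent R n) c * algebraMap R (Laurent R n) ↑c⁻¹ = 1 := by
    rw [← map_mul, Units.mul_inv, map_one]
  linear_combination (-(eval₂ (algebraMap R (Laurent R n)) (monomial R (-b)) Ψ.reverse *
    monomial R (Ψ.natDegree • b))) * h1

variable [IsDomain R] (hc : Ψ.coeff 0 = c)

include hc

theorem natDegree_invRootsPoly : (invRootsPoly Ψ c).natDegree = Ψ.natDegree := by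
  rw [invRootsPoly, natDegree_C_mul (Units.ne_zero _), natDegree_reverse_of_coeff_zero_ne_zero]
  rw [hc]
  exact Units.ne_zero _

theorem monic_invRootsPoly : (invRootsPoly Ψ c).Monic := by
  have h0 : Ψ.coeff 0 ≠ 0 := by rw [hc]; exact Units.ne_zero _
  have ht : Ψ.natTrailingDegree = 0 := natTrailingDegree_eq_zero.2 (Or.inr h0)
  rw [Monic, invRootsPoly, leadingCoeff_mul, leadingCoeff_C, reverse_leadingCoeff, trailingCoeff,
    ht, hc, Units.inv_mul]

theorem irreducible_map_invRootsPoly (hm : Ψ.Monic)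
    (hΨ : Irreducible (Ψ.map (algebraMap R (FractionRing R)))) :
    Irreducible ((invRootsPoly Ψ c).map (algebraMap R (FractionRing R))) := by
  have h1 : Ψ.reverse.map (algebraMap R (FractionRing R)) =
      (Ψ.map (algebraMap R (FractionRing R))).reverse := by
    ext k
    rw [coeff_map, coeff_reverse, coeff_reverse, coeff_map, hm.natDegree_map]
  rw [invRootsPoly, Polynomial.map_mul, map_C, h1]
  have hu : IsUnit (C (algebraMap R (FractionRing R) ↑c⁻¹)) :=
    isUnit_C.2 ((Units.isUnit c⁻¹).map (algebraMap R (FractionRing R)))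
  rw [irreducible_isUnit_mul hu]
  refine irreducible_reverse hΨ ?_
  rw [coeff_map, hc]
  exact (c.isUnit.map (algebraMap R (FractionRing R))).ne_zero

end InvRoots

/-- Replacing a monomial `Mᵢ` by its inverse in an essential factorization. -/
def EssentialFactorization.flip {R : Type u} [CommRing R] [IsDomain R] {n : ℕ}
    (d : EssentialFactorization R n) (i : Fin d.card) : EssentialFactorization R n where
  -- The unit and the monomial of `aeval_invRootsPoly`, raised to the multiplicity, go into the
  -- coefficient and into N.
  ξ := d.ξ * ((d.Ψ_const i).unit : R) ^ d.mult i
  N := d.N + (d.mult i * (d.Ψ i).natDegree) • d.M i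
  N_degree := by
    simp only [Pi.add_apply, Pi.smul_apply, Finset.sum_add_distrib, d.N_degree,
      ← Finset.smul_sum, d.M_degree, smul_zero, add_zero]
  card := d.card
  Ψ := Function.update d.Ψ i (invRootsPoly (d.Ψ i) (d.Ψ_const i).unit)
  Ψ_monic j := by
    rcases eq_or_ne j i with rfl | h
    · rw [Function.update_self]
      exact monic_invRootsPoly rfl
    · rw [Function.update_of_ne h]
      exact d.Ψ_monic j
  Ψ_degree j := by
    rcases eq_or_ne j i with rfl | h
    · rw [Function.update_self, natDegree_invRootsPoly rfl]
      exact d.Ψ_degree j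
    · rw [Function.update_of_ne h]
      exact d.Ψ_degree j
  Ψ_irreducible j := by
    rcases eq_or_ne j i with rfl | h
    · rw [Function.update_self]
      exact irreducible_map_invRootsPoly rfl (d.Ψ_monic j) (d.Ψ_irreducible j)
    · rw [Function.update_of_ne h]
      exact d.Ψ_irreducible j
  Ψ_coprime_X j := by
    rcases eq_or_ne j i with rfl | h
    · rw [Function.update_self, isCoprime_comm, irreducible_X.coprime_iff_not_dvd, X_dvd_iff,
        coeff_map, coeff_zero_invRootsPoly (d.Ψ_monic j)]
      exact ((Units.isUnit _).map (algebraMap R (FractionRing R))).ne_zero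
    · rw [Function.update_of_ne h]
      exact d.Ψ_coprime_X j
  Ψ_coprime_X_sub_one j := by
    rcases eq_or_ne j i with rfl | h
    · rw [Function.update_self, isCoprime_comm, ← C_1,
        (irreducible_X_sub_C (1 : FractionRing R)).coprime_iff_not_dvd, dvd_iff_isRoot, IsRoot,
        eval_map, eval₂_at_one, eval_one_invRootsPoly]
      refine fun h0 => d.eval_one_ne_zero j ?_
      have h1 := (IsFractionRing.injective R (FractionRing R)) (h0.trans (map_zero _).symm)
      exact (mul_eq_zero.1 h1).resolve_left (Units.ne_zero _)
    · rw [Function.update_of_ne h]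
      exact d.Ψ_coprime_X_sub_one j
  Ψ_const j := by
    rcases eq_or_ne j i with rfl | h
    · rw [Function.update_self, coeff_zero_invRootsPoly (d.Ψ_monic j)]
      exact Units.isUnit _
    · rw [Function.update_of_ne h]
      exact d.Ψ_const j
  M := Function.update d.M i (-d.M i)
  M_degree j := by
    rcases eq_or_ne j i with rfl | h
    · simp [d.M_degree]
    · rw [Function.update_of_ne h]
      exact d.M_degree j
  M_primitive j := by
    rcases eq_or_ne j i with rfl | h
    · rw [Function.update_self]
      exact (d.M_primitive j).neg
    · rw [Function.update_of_ne h]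
      exact d.M_primitive j
  mult := d.mult
  mult_pos := d.mult_pos

theorem EssentialFactorization.flip_value {R : Type u} [CommRing R] [IsDomain R] {n : ℕ}
    (d : EssentialFactorization R n) (i : Fin d.card) : (d.flip i).value = d.value := by
  have h1 : ∏ j, (aeval (monomial R ((d.flip i).M j)) ((d.flip i).Ψ j)) ^ (d.flip i).mult j =
      (aeval (monomial R (-d.M i)) (invRootsPoly (d.Ψ i) (d.Ψ_const i).unit)) ^ d.mult i *
      ∏ j ∈ Finset.univ.erase i, (aeval (monomial R (d.M j)) (d.Ψ j)) ^ d.mult j := by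
    refine (Finset.mul_prod_erase (Finset.univ : Finset (Fin d.card)) (fun j =>
      (aeval (monomial R ((d.flip i).M j)) ((d.flip i).Ψ j)) ^ (d.flip i).mult j)
      (Finset.mem_univ i)).symm.trans ?_
    congr 1
    · simp [EssentialFactorization.flip]
    · refine Finset.prod_congr rfl fun j hj => ?_
      have hj' : j ≠ i := Finset.ne_of_mem_erase hj
      simp [EssentialFactorization.flip, hj']
  rw [EssentialFactorization.value, EssentialFactorization.value, h1,
    ← Finset.mul_prod_erase _ _ (Finset.mem_univ i),
    aeval_invRootsPoly (c := (d.Ψ_const i).unit) (d.M i)]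
  simp only [EssentialFactorization.flip]
  rw [mul_smul, monomial_add, monomial_nsmul R (d.mult i), map_mul, map_pow]
  ring

/-- The factors of a factorization of the Schur element of a character for which `M` is not
essential. -/
theorem eval_one_notMem_of_not_isEssentialMonomial {R : Type u} [CommRing R] [IsDomain R] {n : ℕ}
    {H : Type v} [Ring H] [Algebra (Laurent R n) H] {t : H →ₗ[Laurent R n] Laurent R n}
    {p : Ideal R} {a : Fin n → ℤ} {χ : IrrGeneric (Laurent R n) H}
    (hχ : ¬ IsEssentialMonomial t p a χ) (d : EssentialFactorization R n)
    (hd : IsSchurElement t χ (algebraMap (Laurent R n) (FractionRing (Laurent R n)) d.value))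
    (i : Fin d.card) (hi : d.M i = a ∨ d.M i = -a) : (d.Ψ i).eval 1 ∉ p := by
  intro hp
  rcases hi with hi | hi
  · exact hχ ⟨d, hd, i, hi, hp⟩
  -- When Mᵢ is the inverse of M, the flipped factorization exhibits M itself, and the new Ψᵢ(1) is
  -- a unit times the old one.
  · refine hχ ⟨d.flip i, (d.flip_value i).symm ▸ hd, i, ?_, ?_⟩
    · simp [EssentialFactorization.flip, hi]
    · have : (d.flip i).Ψ i = invRootsPoly (d.Ψ i) (d.Ψ_const i).unit := Function.update_self ..
      rw [this, eval_one_invRootsPoly]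
      exact p.mul_mem_left _ hp

end Factorizations

/-! ### Symmetrizing forms and Schur elements -/

section Schur

variable {A : Type u} [CommRing A] [IsDomain A] {H : Type v} [Ring H] [Algebra A H]

theorem extendForm_tmul (t : H →ₗ[A] A) (x : FractionRing A) (h : H) :
    extendForm t (x ⊗ₜ h) = x * algebraMap A (FractionRing A) (t h) := by
  simp [extendForm, Algebra.smul_def, mul_comm]

/-- The elements of the generic fibre are detected by the form on a finite family, integrally. -/
theorem IsSymmetrizing.exists_family [Module.Free A H] [Module.Finite A H] {t : H →ₗ[A] A}
    (ht : IsSymmetrizing t) :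
    ∃ (n : ℕ) (b b' : Fin n → H), ∀ x : GenericFiber A H,
      x = ∑ l, extendForm t (x * 1 ⊗ₜ b l) • (1 ⊗ₜ b' l) := by
  let b := Module.Free.chooseBasis A H
  let b₀ := b.reindex (Fintype.equivFin _)
  let T : H ≃ₗ[A] Module.Dual A H := LinearEquiv.ofBijective
    (LinearMap.compRight A t ∘ₗ (LinearMap.mul A H)) ht.bijective
  -- The basis dual to b₀ for t: the coordinates of x in b' are the values t(x b_l).
  let b' := b₀.dualBasis.map T.symm
  have hδ : ∀ j l, t (b' j * b₀ l) = if j = l then 1 else 0 := by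
    intro j l
    have h1 : T (b' j) = b₀.dualBasis j := by simp [b']
    have h2 : t (b' j * b₀ l) = T (b' j) (b₀ l) := rfl
    rw [h2, h1, Module.Basis.dualBasis_apply, Module.Basis.repr_self, Finsupp.single_apply]
    simp only [eq_comm]
  refine ⟨_, b₀, b', fun x => ?_⟩
  let B := Algebra.TensorProduct.basis (FractionRing A) b'
  conv_lhs => rw [← B.sum_repr x]
  refine Finset.sum_congr rfl fun l _ => ?_
  rw [Algebra.TensorProduct.basis_apply]
  congr 1
  conv_rhs => rw [← B.sum_repr x]
  have hcoef : ∀ j, extendForm t ((B.repr x j • B j) * 1 ⊗ₜ b₀ l) =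
      B.repr x j * if j = l then 1 else 0 := fun j => by
    rw [Algebra.TensorProduct.basis_apply, smul_mul_assoc, map_smul, smul_eq_mul,
      Algebra.TensorProduct.tmul_mul_tmul, one_mul, extendForm_tmul, hδ, one_mul, apply_ite
        (algebraMap A (FractionRing A)), map_one, map_zero]
  rw [Finset.sum_mul, map_sum, Finset.sum_congr rfl fun j _ => hcoef j]
  simp

theorem IsSymmetrizing.eq_zero_of_forall [Module.Free A H] [Module.Finite A H] {t : H →ₗ[A] A}
    (ht : IsSymmetrizing t) {x : GenericFiber A H}
    (hx : ∀ y, extendForm t (x * y) = 0) : x = 0 := by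
  obtain ⟨n, b, b', h⟩ := ht.exists_family
  rw [h x]
  exact Finset.sum_eq_zero fun l _ => by rw [hx, zero_smul]

/-- An element of the generic fibre lies in the localized algebra if the form takes values in the
localized ring on its multiples. -/
theorem IsSymmetrizing.exists_smul_eq_tmul [Module.Free A H] [Module.Finite A H]
    {t : H →ₗ[A] A} (ht : IsSymmetrizing t) (M : Submonoid A) {O : Type*} [CommRing O]
    [Algebra A O] [IsLocalization M O] [Algebra O (FractionRing A)]
    [IsScalarTower A O (FractionRing A)] {x : GenericFiber A H}
    (hx : ∀ h : H, ∃ o : O, extendForm t (x * 1 ⊗ₜ h) = algebraMap O (FractionRing A) o) :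
    ∃ v ∈ M, ∃ h : H, v • x = 1 ⊗ₜ h := by
  obtain ⟨n, b, b', hb⟩ := ht.exists_family
  choose o ho using fun l => hx (b l)
  obtain ⟨v, hv⟩ := IsLocalization.exist_integer_multiples_of_finite M o
  choose c hc using hv
  refine ⟨v, v.2, ∑ l, c l • b' l, ?_⟩
  conv_lhs => rw [hb x]
  rw [Finset.smul_sum, TensorProduct.tmul_sum]
  refine Finset.sum_congr rfl fun l _ => ?_
  rw [← smul_assoc, ho, TensorProduct.tmul_smul, ← algebraMap_smul (FractionRing A) (c l)]
  congr 1
  have h1 : algebraMap A O (c l) = (v : A) • o l := hc l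
  rw [IsScalarTower.algebraMap_apply A O (FractionRing A), h1, Algebra.smul_def, Algebra.smul_def,
    map_mul, ← IsScalarTower.algebraMap_apply A O (FractionRing A)]

variable {ι : Type} {d : ι → ℕ} [∀ i, NeZero (d i)]
  (Φ : GenericFiber A H ≃ₐ[FractionRing A] MatrixProd d (FractionRing A))

/-- The characters take integral values on `H`. -/
theorem exists_algebraMap_eq_trace [IsIntegrallyClosed A] [Module.Finite A H] (h : H) (i : ι) :
    ∃ a : A, algebraMap A (FractionRing A) a = (rep Φ h i).trace := by
  have hint : IsIntegral A (rep Φ h i) :=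
    (Algebra.IsIntegral.isIntegral (R := A) h).map
      ((Pi.evalAlgHom A (fun i => Matrix (Fin (d i)) (Fin (d i)) (FractionRing A)) i).comp (rep Φ))
  obtain ⟨P, -, hP⟩ := exists_monic_map_eq_charpoly hint
  rw [Matrix.trace_eq_neg_charpoly_coeff, ← hP, Polynomial.coeff_map, ← map_neg]
  exact ⟨_, rfl⟩

variable [Fintype ι] [DecidableEq ι]

/-- The symmetrizing form is the sum of the traces weighted by the inverses of the Schur
elements. -/
theorem IsSymmetrizing.extendForm_eq_sum [Module.Free A H] [Module.Finite A H]
    {t : H →ₗ[A] A} (ht : IsSymmetrizing t) {s : ι → FractionRing A}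
    (hs : ∀ i, IsSchurElement t (irrEquiv.{u, v} Φ i) (s i)) :
    (∀ i, s i ≠ 0) ∧ ∀ x, extendForm t x = ∑ i, (s i)⁻¹ * (Φ x i).trace := by
  -- χ^∨ is s_χ times the central idempotent of its factor: it acts there by the scalar s_χ, and
  -- nondegeneracy of t kills its other components since χ vanishes on them. Were s_χ zero, χ would
  -- vanish, but its value at a diagonal matrix unit is 1.
  have key : ∀ i, s i ≠ 0 ∧ ∀ x, s i * extendForm t (Φ.symm (Pi.single i 1) * x) =
      (Φ x i).trace := by
    intro i
    obtain ⟨c, hc, hact⟩ := hs i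
    rw [actsAsScalar_irrEquiv_iff] at hact
    simp only [irrEquiv_apply] at hc
    have h0 : c * Φ.symm (1 - Pi.single i 1) = 0 := ht.eq_zero_of_forall fun y => by
      rw [mul_assoc, hc, map_mul, AlgEquiv.apply_symm_apply, Pi.mul_apply, Pi.sub_apply,
        Pi.single_eq_same, Pi.one_apply, sub_self, zero_mul, Matrix.trace_zero]
    have h1 : c = s i • Φ.symm (Pi.single i 1) := by
      apply Φ.injective
      rw [map_smul, AlgEquiv.apply_symm_apply]
      have h2 := congrArg Φ h0
      rw [map_mul, AlgEquiv.apply_symm_apply, map_zero, mul_sub, mul_one, sub_eq_zero] at h2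
      rw [h2]
      ext j : 1
      rcases eq_or_ne j i with rfl | hj
      · simp [hact]
      · simp [hj]
    have h3 : ∀ x, s i * extendForm t (Φ.symm (Pi.single i 1) * x) = (Φ x i).trace := fun x => by
      rw [← hc, h1, smul_mul_assoc, map_smul, smul_eq_mul]
    refine ⟨fun hsi => ?_, h3⟩
    have h4 := h3 (Φ.symm (Pi.single i (Matrix.single 0 0 1)))
    rw [hsi, zero_mul, AlgEquiv.apply_symm_apply, Pi.single_eq_same,
      Matrix.trace_single_eq_same] at h4
    exact zero_ne_one h4
  refine ⟨fun i => (key i).1, fun x => ?_⟩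
  have h1 : x = ∑ i, Φ.symm (Pi.single i 1) * x := by
    rw [← Finset.sum_mul, ← map_sum]
    have : ∑ i, Pi.single i (1 : Matrix (Fin (d i)) (Fin (d i)) (FractionRing A)) =
        (1 : MatrixProd d (FractionRing A)) :=
      Finset.univ_sum_single (1 : MatrixProd d (FractionRing A))
    rw [this, map_one, one_mul]
  conv_lhs => rw [h1, map_sum]
  refine Finset.sum_congr rfl fun i _ => ?_
  rw [← (key i).2 x, inv_mul_cancel_left₀ (key i).1]

end Schur

/-! ### Comparison of the blocks at `𝔭A` and at `𝔮_M` -/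

section Comparison

variable {R : Type u} [CommRing R] {n : ℕ}

theorem algebraMap_notMem_monomialIdeal {p : Ideal R} {a : Fin n → ℤ}
    (ha : IsPrimitiveExponent a) {c : R} (hc : c ∉ p) :
    algebraMap R (Laurent R n) c ∉ monomialIdeal p a := by
  have := aeval_monomial_mem_monomialIdeal_iff (p := p) ha (AddSubgroup.mem_zmultiples a)
    (Polynomial.C c)
  rwa [Polynomial.aeval_C, Polynomial.eval_C, ← not_iff_not, iff_true_right hc] at this

variable {H : Type v} [Ring H] [Algebra (Laurent R n) H] {ι : Type} {d : ι → ℕ}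
  (Φ : GenericFiber (Laurent R n) H ≃ₐ[FractionRing (Laurent R n)]
    MatrixProd d (FractionRing (Laurent R n)))

/-- An element outside 𝔮_M is outside the smaller ideal 𝔭A. -/
theorem IsClosedAt.extendedIdeal_of_monomialIdeal {p : Ideal R} {a : Fin n → ℤ} {S : Set ι}
    (h : IsClosedAt (rep Φ) (monomialIdeal p a) S) : IsClosedAt (rep Φ) (extendedIdeal p n) S := by
  obtain ⟨v, hv, h, hh⟩ := h
  exact ⟨v, fun hv' => hv (Ideal.mem_sup_right hv'), h, hh⟩

variable [Fintype ι] [DecidableEq ι] [∀ i, NeZero (d i)] [Module.Free (Laurent R n) H]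
  [Module.Finite (Laurent R n) H] [IsDomain R] [IsIntegrallyClosed R]

/-- A set of characters for which `M` is not essential and whose idempotent is defined at `𝔭A` has
its idempotent defined at `𝔮_M`. -/
theorem IsClosedAt.monomialIdeal_of_extendedIdeal {t : H →ₗ[Laurent R n] Laurent R n}
    (ht : IsSymmetrizing t) (hess : IsEssential t) {p : Ideal R} (hp : p.IsPrime)
    {a : Fin n → ℤ} (ha : IsPrimitiveExponent a) {S : Set ι}
    (hS : ∀ i ∈ S, ¬ IsEssentialMonomial t p a (irrEquiv.{u, v} Φ i))
    (h : IsClosedAt (rep Φ) (extendedIdeal p n) S) :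
    IsClosedAt (rep Φ) (monomialIdeal p a) S := by
  classical
  have hA := isIntegrallyClosed_laurent R n
  have hq := monomialIdeal_isPrime p hp a ha
  let O := Localization.AtPrime (monomialIdeal p a)
  let F := FractionRing (Laurent R n)
  let _ : Algebra O F := (localizationToFraction (monomialIdeal p a)).toAlgebra
  have _ : IsScalarTower (Laurent R n) O F :=
    .of_algebraMap_eq fun x => ((localizationToFraction (monomialIdeal p a)).commutes x).symm
  choose D hD using fun i => hess (irrEquiv.{u, v} Φ i)
  obtain ⟨hs, hform⟩ := ht.extendForm_eq_sum Φ hD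
  obtain ⟨v₀, hv₀, h₀, hh₀⟩ := h
  have hx₀ : v₀ • Φ.symm (unitOn d F S) = 1 ⊗ₜ h₀ := by
    apply Φ.injective
    rw [← rep_apply, hh₀, ← algebraMap_smul F v₀, ← algebraMap_smul F v₀, map_smul,
      AlgEquiv.apply_symm_apply]
  let T := Finset.univ.filter (· ∈ S)
  -- The product of the Schur elements over S is ξg. Non-essentiality puts g outside 𝔮_M, and only
  -- the constant ξ remains to be removed from the denominator.
  let ξ := ∏ i ∈ T, (D i).ξ
  let g := ∏ i ∈ T, (D i).cofactor
  have hg : g ∉ monomialIdeal p a := by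
    intro hmem
    obtain ⟨i, hi, h1⟩ := hq.prod_mem_iff.1 hmem
    exact (D i).cofactor_notMem hp ha (eval_one_notMem_of_not_isEssentialMonomial
      (hS i (Finset.mem_filter.1 hi).2) (D i) (hD i)) h1
  have hξg : ∏ i ∈ T, (D i).value = algebraMap R _ ξ * g := by
    rw [map_prod, ← Finset.prod_mul_distrib]
    exact Finset.prod_congr rfl fun i _ => (D i).value_eq
  obtain ⟨v, hv, h, hh⟩ := ht.exists_smul_eq_tmul (monomialIdeal p a).primeCompl (O := O)
    (x := Φ.symm (unitOn d F S)) fun h => by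
      choose c hc using exists_algebraMap_eq_trace Φ h
      let z := extendForm t (Φ.symm (unitOn d F S) * 1 ⊗ₜ h)
      have hz : z = ∑ i ∈ T, (algebraMap (Laurent R n) F (D i).value)⁻¹ *
          algebraMap (Laurent R n) F (c i) := by
        simp only [z]
        rw [hform, Finset.sum_filter]
        refine Finset.sum_congr rfl fun i _ => ?_
        rw [map_mul, AlgEquiv.apply_symm_apply, Pi.mul_apply, ← rep_apply]
        split_ifs with hi
        · rw [unitOn_apply_mem hi, one_mul, hc]
        · rw [unitOn_apply_notMem hi, zero_mul, Matrix.trace_zero, mul_zero]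
      have hz₀ : algebraMap (Laurent R n) F v₀ * z =
          algebraMap (Laurent R n) F (t (h₀ * h)) := by
        rw [← smul_eq_mul, ← map_smul, algebraMap_smul, ← smul_mul_assoc, hx₀,
          Algebra.TensorProduct.tmul_mul_tmul, one_mul, extendForm_tmul, one_mul]
      let y := ∑ i ∈ T, (∏ j ∈ T.erase i, (D j).value) * c i
      have hy : algebraMap (Laurent R n) F (algebraMap R _ ξ * g) * z =
          algebraMap (Laurent R n) F y := by
        rw [hz, Finset.mul_sum, map_sum]
        refine Finset.sum_congr rfl fun i hi => ?_
        rw [← hξg, ← Finset.mul_prod_erase _ _ hi, map_mul, map_mul,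
          mul_comm (algebraMap _ F (D i).value), mul_assoc, mul_inv_cancel_left₀ (hs i)]
      -- Here y = ξgz, while v₀z = t(h₀h) lies in A because e_S is defined at 𝔭A.
      have hdvd : algebraMap R (Laurent R n) ξ ∣ y * v₀ := by
        refine ⟨g * t (h₀ * h), IsFractionRing.injective (Laurent R n) F ?_⟩
        rw [map_mul, ← hy, ← mul_assoc, map_mul _ _ (t (h₀ * h)), ← hz₀]
        ring
      obtain ⟨e, he, w, hw⟩ := exists_notMem_mul_dvd hp hv₀ hdvd
      have hξ : algebraMap R (Laurent R n) ξ ≠ 0 := by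
        intro h0
        have : ∏ i ∈ T, (D i).value = 0 := by rw [hξg, h0, zero_mul]
        obtain ⟨i, -, hi⟩ := Finset.prod_eq_zero_iff.1 this
        exact hs i (by rw [hi, map_zero])
      have heg : algebraMap R (Laurent R n) e * g ∉ monomialIdeal p a := fun h0 =>
        (hq.mem_or_mem h0).elim (algebraMap_notMem_monomialIdeal ha he) hg
      -- Cancelling ξ leaves z = w/(eg), whose denominator avoids 𝔮_M.
      have hzw : algebraMap (Laurent R n) F (algebraMap R _ e * g) * z =
          algebraMap (Laurent R n) F w := by
        have hξ' : algebraMap (Laurent R n) F (algebraMap R _ ξ) ≠ 0 := by simpa using hξ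
        apply mul_left_cancel₀ hξ'
        rw [← map_mul _ _ w, ← hw, map_mul _ _ y, ← hy]
        simp only [map_mul]
        ring
      refine ⟨IsLocalization.mk' O w (⟨_, heg⟩ : (monomialIdeal p a).primeCompl), ?_⟩
      have hne : algebraMap (Laurent R n) F (algebraMap R _ e * g) ≠ 0 := by
        have : algebraMap R (Laurent R n) e * g ≠ 0 := fun h0 => heg (h0 ▸ zero_mem _)
        simpa using this
      apply mul_left_cancel₀ hne
      refine hzw.trans ?_
      have h1 := IsLocalization.mk'_spec' O w (⟨_, heg⟩ : (monomialIdeal p a).primeCompl)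
      have h2 := congrArg (algebraMap O F) h1
      rw [map_mul, ← IsScalarTower.algebraMap_apply, ← IsScalarTower.algebraMap_apply] at h2
      exact h2.symm
  refine ⟨v, hv, h, ?_⟩
  rw [rep_apply, ← hh, ← algebraMap_smul F v, map_smul, AlgEquiv.apply_symm_apply,
    algebraMap_smul]

end Comparison

/-! ### Integral models over a principal ideal domain -/

section IntegralModel

open scoped Matrix in
/-- A matrix representation over the fraction field of a principal ideal domain of a module-finite
algebra is conjugate to one with integral entries. -/
theorem exists_algEquiv_mem_range {O F : Type*} [CommRing O] [IsDomain O] [IsPrincipalIdealRing O]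
    [Field F] [Algebra O F] [IsFractionRing O F] {Λ : Type*} [Ring Λ] [Algebra O Λ]
    [Module.Finite O Λ] {n : ℕ} (ρ : Λ →ₐ[O] Matrix (Fin n) (Fin n) F) :
    ∃ κ : Matrix (Fin n) (Fin n) F ≃ₐ[F] Matrix (Fin n) (Fin n) F,
      ∀ x j k, κ (ρ x) j k ∈ Set.range (algebraMap O F) := by
  let T : (Fin n → O) →ₗ[O] Λ →ₗ[O] (Fin n → F) :=
    LinearMap.mk₂ O (fun w x => ρ x *ᵥ (algebraMap O F ∘ w))
      (fun w w' x => by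
        rw [← Matrix.mulVec_add]; congr 1; ext; simp)
      (fun c w x => by
        rw [← Matrix.mulVec_smul]; congr 1; ext; simp [Algebra.smul_def])
      (fun w x y => by rw [map_add, Matrix.add_mulVec])
      (fun c w x => by rw [map_smul, Matrix.smul_mulVec])
  have hT : ∀ w x, T w x = ρ x *ᵥ (algebraMap O F ∘ w) := fun _ _ => rfl
  -- The lattice spanned by the translates of the standard lattice under Λ is stable and finitely
  -- generated. Over a principal ideal domain it is free, and a basis of it makes all the matrices
  -- integral.
  let L : Submodule O (Fin n → F) := LinearMap.range (TensorProduct.lift T)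
  have hL : ∀ w x, ρ x *ᵥ (algebraMap O F ∘ w) ∈ L := fun w x => ⟨w ⊗ₜ x, by simp [hT]⟩
  have hstab : ∀ x, ∀ y ∈ L, ρ x *ᵥ y ∈ L := by
    rintro x _ ⟨z, rfl⟩
    induction z with
    | zero => simp
    | add z z' h h' => rw [map_add, Matrix.mulVec_add]; exact add_mem h h'
    | tmul w z =>
      rw [TensorProduct.lift.tmul, hT, Matrix.mulVec_mulVec, ← map_mul]
      exact hL _ _
  have _ : Submodule.IsLattice F L :=
    { fg := (Submodule.fg_top _).1 (Module.Finite.fg_top (R := O) (M := L))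
      span_eq_top := by
        rw [eq_top_iff, ← (Pi.basisFun F (Fin n)).span_eq, Submodule.span_le]
        rintro _ ⟨k, rfl⟩
        refine Submodule.subset_span ?_
        have h1 := hL (Pi.single k 1) 1
        rw [map_one, Matrix.one_mulVec] at h1
        have h2 : Pi.basisFun F (Fin n) k = algebraMap O F ∘ Pi.single k 1 := by
          ext j
          rw [Pi.basisFun_apply, Function.comp_apply, Pi.single_apply, Pi.single_apply,
            apply_ite (algebraMap O F), map_one, map_zero]
        rw [h2]
        exact h1 }
  let b : Module.Basis (Fin n) O L := Module.finBasisOfFinrankEq O L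
    ((Submodule.IsLattice.finrank_of_pi F L).trans (Fintype.card_fin n))
  let c := b.extendOfIsLattice F
  have hc : ∀ k, c k = (b k : Fin n → F) := fun k => b.extendOfIsLattice_apply F k
  refine ⟨Matrix.toLinAlgEquiv'.trans (LinearMap.toMatrixAlgEquiv c), fun x j k => ?_⟩
  let y : L := ⟨ρ x *ᵥ (b k : Fin n → F), hstab x _ (b k).2⟩
  refine ⟨b.repr y j, ?_⟩
  rw [AlgEquiv.trans_apply, LinearMap.toMatrixAlgEquiv_apply, Matrix.toLinAlgEquiv'_apply, hc]
  have hy : ρ x *ᵥ (b k : Fin n → F) = ∑ j, algebraMap O F (b.repr y j) • c j := by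
    have := congrArg Subtype.val (b.sum_repr y)
    rw [Submodule.coe_sum] at this
    refine this.symm.trans (Finset.sum_congr rfl fun j _ => ?_)
    rw [hc, algebraMap_smul, Submodule.coe_smul]
  rw [hy, c.repr_sum_self]

end IntegralModel

/-! ### The valuation ring attached to a monomial -/

section ValuationRing

variable {R : Type u} [CommRing R]

theorem monomialIdeal_bot {n : ℕ} (a : Fin n → ℤ) :
    monomialIdeal (⊥ : Ideal R) a = Ideal.span {monomial R a - 1} := by
  rw [monomialIdeal, extendedIdeal, Ideal.map_bot, sup_bot_eq]

/-- The localization is a Noetherian local domain whose maximal ideal is generated by M - 1. -/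
theorem isPrincipalIdealRing_localization [IsDomain R] [IsNoetherianRing R] {n : ℕ}
    (a : Fin n → ℤ) [(monomialIdeal (⊥ : Ideal R) a).IsPrime] :
    IsPrincipalIdealRing (Localization.AtPrime (monomialIdeal (⊥ : Ideal R) a)) := by
  let q := monomialIdeal (⊥ : Ideal R) a
  have _ := isNoetherianRing_laurent R n
  have _ : IsNoetherianRing (Localization.AtPrime q) :=
    IsLocalization.isNoetherianRing q.primeCompl _ inferInstance
  have _ : IsDomain (Localization.AtPrime q) :=
    IsLocalization.isDomain_localization q.primeCompl_le_nonZeroDivisors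
  refine ((tfae_of_isNoetherianRing_of_isLocalRing_of_isDomain
    (Localization.AtPrime q)).out 0 4).2 ?_
  have h := congrArg (Ideal.map (algebraMap (Laurent R n) (Localization.AtPrime q)))
    (monomialIdeal_bot (R := R) a)
  rw [Ideal.map_span, Set.image_singleton] at h
  exact ⟨_, Localization.AtPrime.map_eq_maximalIdeal.symm.trans h⟩

end ValuationRing

/-! ### Integral matrix representations and their specializations -/

section Specialize

theorem matrixProdMap_injective {ι : Type} {d : ι → ℕ} {A K L : Type*} [CommRing A] [CommRing K]
    [CommRing L] [Algebra A K] [Algebra A L] {g : K →ₐ[A] L} (hg : Function.Injective g) :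
    Function.Injective (matrixProdMap d g) := fun x y h => by
  ext i j k
  exact hg (congrFun (congrFun (congrFun h i) j) k)

/-- The extension of a representation of `H` to a base change of `H`. -/
def liftRep {A O H E : Type*} [CommRing A] [CommRing O] [Algebra A O] [Ring H] [Algebra A H]
    [Ring E] [Algebra A E] [Algebra O E] [IsScalarTower A O E] (ρ : H →ₐ[A] E) :
    O ⊗[A] H →ₐ[O] E :=
  Algebra.TensorProduct.lift (Algebra.ofId O E) ρ fun x y => by
    rw [Algebra.ofId_apply]
    exact Algebra.commute_algebraMap_left x (ρ y)

theorem liftRep_tmul {A O H E : Type*} [CommRing A] [CommRing O] [Algebra A O] [Ring H]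
    [Algebra A H] [Ring E] [Algebra A E] [Algebra O E] [IsScalarTower A O E] (ρ : H →ₐ[A] E)
    (x : O) (h : H) : liftRep ρ (x ⊗ₜ[A] h) = x • ρ h := by
  rw [liftRep, Algebra.TensorProduct.lift_tmul, Algebra.smul_def, Algebra.ofId_apply]

theorem liftRep_liftRep {A B L H E : Type*} [CommRing A] [CommRing B] [CommRing L] [Algebra A B]
    [Algebra A L] [Algebra B L] [IsScalarTower A B L] [Ring H] [Algebra A H] [Ring E] [Algebra A E]
    [Algebra B E] [Algebra L E] [IsScalarTower A L E] [IsScalarTower B L E] [IsScalarTower A B E]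
    (ρ : H →ₐ[A] E) (x : L ⊗[B] (B ⊗[A] H)) :
    liftRep (O := L) (liftRep (O := B) ρ) x = liftRep (O := L) ρ
      (TensorProduct.AlgebraTensorModule.cancelBaseChange A B L L H x) := by
  induction x with
  | zero => simp only [map_zero]
  | add x y hx hy => simp only [map_add, hx, hy]
  | tmul x y =>
    induction y with
    | zero => simp only [TensorProduct.tmul_zero, map_zero]
    | add y z hy hz => simp only [TensorProduct.tmul_add, map_add, hy, hz]
    | tmul b h =>
      rw [liftRep_tmul, liftRep_tmul, TensorProduct.AlgebraTensorModule.cancelBaseChange_tmul,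
        liftRep_tmul, smul_comm, smul_assoc]

variable {A : Type u} [CommRing A] [IsDomain A] {H : Type v} [Ring H] [Algebra A H]
  {ι : Type} {d : ι → ℕ}

/-- Conjugating each factor separately makes all matrices integral over O, so that they can be
reduced to another field. -/
theorem exists_integralRep (Φ : GenericFiber A H ≃ₐ[FractionRing A] MatrixProd d (FractionRing A))
    (O : Type*) [CommRing O] [IsDomain O] [IsPrincipalIdealRing O] [Algebra A O]
    [Algebra O (FractionRing A)] [IsScalarTower A O (FractionRing A)]
    [IsFractionRing O (FractionRing A)] [Module.Finite A H] :
    ∃ (Φ' : GenericFiber A H ≃ₐ[FractionRing A] MatrixProd d (FractionRing A))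
      (ρ : H →ₐ[A] MatrixProd d O),
      ∀ h, rep Φ' h = matrixProdMap d (IsScalarTower.toAlgHom A O (FractionRing A)) (ρ h) := by
  let F := FractionRing A
  choose κ hκ using fun i => exists_algEquiv_mem_range
    ((Pi.evalAlgHom O (fun i => Matrix (Fin (d i)) (Fin (d i)) F) i).comp
      (liftRep (O := O) (rep Φ)))
  let Φ' : GenericFiber A H ≃ₐ[F] MatrixProd d F := Φ.trans (AlgEquiv.piCongrRight κ)
  let g := matrixProdMap d (IsScalarTower.toAlgHom A O F)
  have hg : Function.Injective g := matrixProdMap_injective (IsFractionRing.injective O F)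
  have hrange : ∀ h, rep Φ' h ∈ g.range := by
    intro h
    choose y hy using fun i j k => hκ i (1 ⊗ₜ h) j k
    refine ⟨fun i => Matrix.of fun j k => y i j k, ?_⟩
    ext i j k
    refine (hy i j k).trans ?_
    rw [AlgHom.comp_apply, liftRep_tmul, one_smul]
    rfl
  refine ⟨Φ', (AlgEquiv.ofInjective g hg).symm.toAlgHom.comp ((rep Φ').codRestrict g.range hrange),
    fun h => ?_⟩
  exact congrArg Subtype.val
    ((AlgEquiv.ofInjective g hg).apply_symm_apply ⟨rep Φ' h, hrange h⟩).symm

variable [Fintype ι] [DecidableEq ι] [Module.Free A H] [Module.Finite A H]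
  {O : Type*} [CommRing O] [Algebra A O] {ρ : H →ₐ[A] MatrixProd d O}

/-- A representation of `H` by integral matrices that is generically split, and onto up to scalars,
stays split under base change to a field. -/
theorem liftRep_bijective
    (Φ : GenericFiber A H ≃ₐ[FractionRing A] MatrixProd d (FractionRing A))
    {L : Type*} [Field L] [Algebra A L] (g : O →ₐ[A] L)
    (hsurj : ∀ Y : MatrixProd d O, ∃ v : A, algebraMap A L v ≠ 0 ∧ ∃ h, ρ h = v • Y) :
    Function.Bijective (liftRep (O := L) ((matrixProdMap d g).comp ρ)) := by
  let θ := liftRep (O := L) ((matrixProdMap d g).comp ρ)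
  have hunit : ∀ i j k, (Pi.single i (Matrix.single j k 1) : MatrixProd d L) ∈
      LinearMap.range θ.toLinearMap := by
    intro i j k
    obtain ⟨v, hv, h, hh⟩ := hsurj (Pi.single i (Matrix.single j k 1))
    refine ⟨(algebraMap A L v)⁻¹ ⊗ₜ h, ?_⟩
    rw [AlgHom.toLinearMap_apply]
    simp only [θ]
    rw [liftRep_tmul, AlgHom.comp_apply, hh, map_smul, ← algebraMap_smul L v, smul_smul,
      inv_mul_cancel₀ hv, one_smul]
    ext i' : 1
    rw [matrixProdMap_apply]
    rcases eq_or_ne i' i with rfl | hi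
    · rw [Pi.single_eq_same, Pi.single_eq_same, Matrix.map_single, map_one]
    · rw [Pi.single_eq_of_ne hi, Pi.single_eq_of_ne hi, Matrix.map_zero _ (map_zero g)]
  have hrange : LinearMap.range θ.toLinearMap = ⊤ := by
    rw [eq_top_iff]
    intro X _
    have hX : X = ∑ i, ∑ j, ∑ k, X i j k •
        (Pi.single i (Matrix.single j k 1) : MatrixProd d L) := by
      ext i' j' k'
      simp only [Finset.sum_apply, Matrix.sum_apply, Pi.smul_apply, Matrix.smul_apply]
      rw [Finset.sum_eq_single i', Finset.sum_eq_single j', Finset.sum_eq_single k']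
      · simp
      · intro k _ hk
        simp [hk]
      · simp
      · intro j _ hj
        simp [hj]
      · simp
      · intro i _ hi
        simp [Pi.single_eq_of_ne hi.symm]
      · simp
    rw [hX]
    exact sum_mem fun i _ => sum_mem fun j _ => sum_mem fun k _ =>
      Submodule.smul_mem _ _ (hunit i j k)
  have hs : Function.Surjective θ.toLinearMap := LinearMap.range_eq_top.1 hrange
  -- Both dimensions equal the rank of H, which is the sum of the squares of the sizes; so
  -- surjectivity suffices.
  have hdim : Module.finrank L (L ⊗[A] H) = Module.finrank L (MatrixProd d L) := by
    rw [Module.finrank_baseChange]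
    have h1 : Module.finrank (FractionRing A) (GenericFiber A H) = Module.finrank A H :=
      Module.finrank_baseChange
    rw [← h1, Φ.toLinearEquiv.finrank_eq, Module.finrank_pi_fintype, Module.finrank_pi_fintype]
    simp [Module.finrank_matrix]
  exact ⟨(LinearMap.injective_iff_surjective_of_finrank_eq_finrank hdim).2 hs, hs⟩

variable [∀ i, NeZero (d i)] [Algebra O (FractionRing A)] [IsScalarTower A O (FractionRing A)]
  {Φ : GenericFiber A H ≃ₐ[FractionRing A] MatrixProd d (FractionRing A)}

/-- If the Schur elements are invertible in a localization, then the localized algebra is a product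
of matrix algebras. -/
theorem IsSymmetrizing.exists_integralRep_eq_smul
    (hρ : ∀ h, rep Φ h = matrixProdMap d (IsScalarTower.toAlgHom A O (FractionRing A)) (ρ h))
    (hO : Function.Injective (algebraMap O (FractionRing A)))
    {t : H →ₗ[A] A} (ht : IsSymmetrizing t) (M : Submonoid A) [IsLocalization M O] {s : ι → A}
    (hs : ∀ i, IsSchurElement t (irrEquiv.{u, v} Φ i) (algebraMap A (FractionRing A) (s i)))
    (hsM : ∀ i, s i ∈ M) (Y : MatrixProd d O) :
    ∃ v ∈ M, ∃ h, ρ h = v • Y := by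
  let F := FractionRing A
  let g := matrixProdMap d (IsScalarTower.toAlgHom A O F)
  have hg : Function.Injective g := matrixProdMap_injective hO
  obtain ⟨hs0, hform⟩ := ht.extendForm_eq_sum Φ hs
  obtain ⟨v, hv, h, hh⟩ := ht.exists_smul_eq_tmul M (O := O) (x := Φ.symm (g Y)) fun h => by
    -- The form on multiples of Y is a sum of integral traces divided by Schur elements, which are
    -- units of O.
    refine ⟨∑ i, IsLocalization.mk' O 1 ⟨s i, hsM i⟩ * (Y i * ρ h i).trace, ?_⟩
    rw [hform, map_sum]
    refine Finset.sum_congr rfl fun i _ => ?_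
    rw [map_mul, AlgEquiv.apply_symm_apply, ← rep_apply, hρ, ← map_mul, matrixProdMap_apply,
      map_mul, Pi.mul_apply]
    congr 1
    · rw [inv_eq_iff_eq_inv, eq_comm, inv_eq_iff_eq_inv]
      apply eq_inv_of_mul_eq_one_left
      rw [IsScalarTower.algebraMap_apply A O F, ← map_mul, IsLocalization.mk'_spec, map_one,
        map_one]
    · exact (AddMonoidHom.map_trace (algebraMap O F).toAddMonoidHom _).symm
  refine ⟨v, hv, h, hg ?_⟩
  have h1 := congrArg (Φ.toAlgHom.restrictScalars A) hh
  rw [map_smul] at h1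
  refine (hρ h).symm.trans (h1.symm.trans ?_)
  rw [map_smul]
  congr 1
  exact Φ.apply_symm_apply _

end Specialize

section SpecializedRep

variable {A B : Type u} [CommRing A] [IsDomain A] [CommRing B] [IsDomain B] {H : Type v} [Ring H]
  [Algebra A H] [Module.Free A H] [Module.Finite A H]
  {ι : Type} {d : ι → ℕ} [Fintype ι] [DecidableEq ι] [∀ i, NeZero (d i)]

/-- A matrix representation of the generic fibre of `H` and one of the generic fibre of `H_φ` are
compatible: central elements and traces of elements of `H` correspond under `φ`. -/
structure IsCompatible (φ : A →+* B)
    (Φ : GenericFiber A H ≃ₐ[FractionRing A] MatrixProd d (FractionRing A))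
    (Φ' : GenericFiber B (Specialization φ H) ≃ₐ[FractionRing B] MatrixProd d (FractionRing B)) :
    Prop where
  unitOn : ∀ (h : H) (v : A) (S : Set ι), rep Φ h = v • unitOn d _ S →
    rep Φ' (Specialization.of φ h) = φ v • unitOn d _ S
  trace : ∀ (h : H) (c : A) (i : ι), algebraMap A (FractionRing A) c = (rep Φ h i).trace →
    algebraMap B (FractionRing B) (φ c) = (rep Φ' (Specialization.of φ h) i).trace

/-- If the Schur elements do not vanish under `φ`, then the matrix representation of the generic
fibre of `H` specializes, provided that the local ring of `A` at the kernel of `φ` is principal. -/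
theorem IsSymmetrizing.exists_isCompatible (φ : A →+* B)
    (Φ₀ : GenericFiber A H ≃ₐ[FractionRing A] MatrixProd d (FractionRing A))
    {t : H →ₗ[A] A} (ht : IsSymmetrizing t) (q : Ideal A) [q.IsPrime]
    (hq : ∀ x, φ x = 0 ↔ x ∈ q) [IsPrincipalIdealRing (Localization.AtPrime q)]
    (hs : ∀ χ : IrrGeneric A H, ∃ s ∉ q, IsSchurElement t χ (algebraMap A (FractionRing A) s)) :
    ∃ (Φ : GenericFiber A H ≃ₐ[FractionRing A] MatrixProd d (FractionRing A))
      (Φ' : GenericFiber B (Specialization φ H) ≃ₐ[FractionRing B] MatrixProd d (FractionRing B)),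
      IsCompatible φ Φ Φ' := by
  let O := Localization.AtPrime q
  let F := FractionRing A
  let L := FractionRing B
  let _ : Algebra O F := (localizationToFraction q).toAlgebra
  have _ : IsScalarTower A O F :=
    .of_algebraMap_eq fun x => ((localizationToFraction q).commutes x).symm
  have _ : IsDomain O := IsLocalization.isDomain_localization q.primeCompl_le_nonZeroDivisors
  have _ : IsFractionRing O F :=
    IsFractionRing.isFractionRing_of_isDomain_of_isLocalization q.primeCompl O F
  let _ : Algebra A B := φ.toAlgebra
  have hAL : ∀ x, algebraMap A L x = algebraMap B L (φ x) := fun x =>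
    IsScalarTower.algebraMap_apply A B L x
  have hne : ∀ x ∉ q, algebraMap A L x ≠ 0 := fun x hx h0 => hx <| (hq x).1 <|
    IsFractionRing.injective B L <| by rw [← hAL, h0, map_zero]
  -- As q is the kernel of φ, the map from A to L extends to the local ring O.
  let g : O →ₐ[A] L := IsLocalization.liftAlgHom (M := q.primeCompl) (f := Algebra.ofId A L)
    fun s => IsUnit.mk0 _ (hne s s.2)
  obtain ⟨Φ, ρ, hρ⟩ := exists_integralRep Φ₀ O
  choose s hsq hs using fun i => hs (irrEquiv.{u, v} Φ i)
  have hsurj := ht.exists_integralRep_eq_smul hρ (IsFractionRing.injective O F) q.primeCompl hs hsq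
  let σ : H →ₐ[A] MatrixProd d L := (matrixProdMap d g).comp ρ
  have hσ : Function.Bijective (liftRep (O := L) σ) := liftRep_bijective Φ g fun Y => by
    obtain ⟨v, hv, h, hh⟩ := hsurj Y
    exact ⟨v, hne v hv, h, hh⟩
  have hσ' : Function.Bijective (liftRep (O := L) (liftRep (O := B) σ)) := by
    have := funext (liftRep_liftRep (B := B) (L := L) σ)
    rw [this]
    exact hσ.comp
      (TensorProduct.AlgebraTensorModule.cancelBaseChange A B L L H).bijective
  let Φ' : GenericFiber B (Specialization φ H) ≃ₐ[L] MatrixProd d L := AlgEquiv.ofBijective _ hσ'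
  have hΦ' : ∀ h, rep Φ' (Specialization.of φ h) = matrixProdMap d g (ρ h) := by
    intro h
    refine (liftRep_tmul (liftRep (O := B) σ) (1 : L) (1 ⊗ₜ h)).trans ?_
    rw [one_smul, liftRep_tmul, one_smul]
    rfl
  have hinj : Function.Injective (matrixProdMap d (IsScalarTower.toAlgHom A O F)) :=
    matrixProdMap_injective (IsFractionRing.injective O F)
  refine ⟨Φ, Φ', fun h v S hh => ?_, fun h c i hc => ?_⟩
  -- The relation over F already holds over O, where g can be applied to it.
  · have h1 : ρ h = v • unitOn d O S := hinj <| by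
      rw [← hρ, hh, map_smul, matrixProdMap_unitOn]
    rw [hΦ', h1, map_smul, matrixProdMap_unitOn, ← algebraMap_smul L v, hAL, algebraMap_smul]
  · have h1 : algebraMap A O c = (ρ h i).trace := IsFractionRing.injective O F <| by
      rw [← IsScalarTower.algebraMap_apply A O F, hc, hρ]
      exact (AddMonoidHom.map_trace (algebraMap O F).toAddMonoidHom _).symm
    rw [hΦ', ← hAL, ← g.commutes c, h1]
    exact AddMonoidHom.map_trace g.toAddMonoidHom _

end SpecializedRep

/-! ### Idempotents of the specialized algebra -/

section Separation

open Polynomial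

variable {B : Type*} [CommRing B] {Λ : Type*} [Ring Λ] [Algebra B Λ] [Module.Finite B Λ] {L : Type*}
  [Field L] [Algebra B L] [IsFractionRing B L] {ι : Type} {d : ι → ℕ} [∀ i, NeZero (d i)]
  {σ : Λ →ₐ[B] MatrixProd d L}

/-- On a factor in T but not in S, g acts as the scalar c. A monic relation for g with lower
coefficients in q then forces a power of c into q. -/
theorem subset_of_smul_unitOn_sub_mem {q : Ideal B} [q.IsPrime] {g : Λ}
    (hg : g ∈ q • (⊤ : Submodule B Λ)) {c : B} (hc : c ∉ q) {S T : Set ι}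
    (hσ : σ g = c • (unitOn d L T - unitOn d L S)) : T ⊆ S := by
  intro i hi
  by_contra hiS
  obtain ⟨p, hp, hpq, hpg⟩ := exists_monic_aeval_eq_zero_of_mem_smul_top q hg
  let ev := (Pi.evalAlgHom B (fun i => Matrix (Fin (d i)) (Fin (d i)) L) i).comp σ
  have hev : ev g = algebraMap B _ c := by
    change σ g i = _
    rw [hσ, Pi.smul_apply, Pi.sub_apply, unitOn_apply_mem hi, unitOn_apply_notMem hiS, sub_zero,
      Algebra.algebraMap_eq_smul_one]
  have h1 : algebraMap B (Matrix (Fin (d i)) (Fin (d i)) L) (p.eval c) = 0 := by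
    rw [← coe_aeval_eq_eval, ← aeval_algebraMap_apply, ← hev, aeval_algHom_apply, hpg, map_zero]
  have h2 : p.eval c = 0 := by
    refine IsFractionRing.injective B L ?_
    have h3 := congrFun (congrFun h1 0) 0
    rw [Matrix.algebraMap_matrix_apply, if_pos rfl, Matrix.zero_apply] at h3
    rw [h3, map_zero]
  rw [hp.as_sum, eval_add, eval_pow, eval_X, eval_finsetSum, add_eq_zero_iff_eq_neg] at h2
  refine hc (Ideal.IsPrime.mem_of_pow_mem ‹_› p.natDegree ?_)
  rw [h2]
  refine neg_mem (sum_mem fun k hk => ?_)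
  rw [eval_mul, eval_C]
  exact Ideal.mul_mem_right _ _ (hpq k (Finset.mem_range.1 hk))

theorem eq_of_smul_unitOn_sub_mem {q : Ideal B} [q.IsPrime] {g : Λ}
    (hg : g ∈ q • (⊤ : Submodule B Λ)) {c : B} (hc : c ∉ q) {S T : Set ι}
    (hσ : σ g = c • (unitOn d L T - unitOn d L S)) : T = S :=
  (subset_of_smul_unitOn_sub_mem hg hc hσ).antisymm <|
    subset_of_smul_unitOn_sub_mem (neg_mem hg) hc (σ := σ) <| by
      rw [map_neg, hσ, ← smul_neg, neg_sub]

end Separation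

/-! ### The map from H to its specialization -/

section Specialization

variable {A B : Type u} [CommRing A] [CommRing B] (φ : A →+* B) {H : Type v} [Ring H] [Algebra A H]

/-- The canonical map `h ↦ 1 ⊗ h` as a ring morphism. -/
def Specialization.ofHom : H →+* Specialization φ H :=
  letI := φ.toAlgebra
  (Algebra.TensorProduct.includeRight : H →ₐ[A] B ⊗[A] H).toRingHom

theorem Specialization.ofHom_apply (h : H) : Specialization.ofHom φ h = Specialization.of φ h := rfl

theorem Specialization.ofHom_smul (x : A) (h : H) :
    Specialization.ofHom φ (x • h) = φ x • Specialization.ofHom φ h := by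
  let _ := φ.toAlgebra
  change (1 : B) ⊗ₜ[A] (x • h) = (algebraMap A B x) • ((1 : B) ⊗ₜ[A] h)
  rw [TensorProduct.tmul_smul, algebraMap_smul]

instance [Module.Finite A H] : Module.Finite B (Specialization φ H) :=
  letI := φ.toAlgebra
  (inferInstance : Module.Finite B (B ⊗[A] H))

instance [Module.Free A H] : Module.Free B (Specialization φ H) :=
  letI := φ.toAlgebra
  (inferInstance : Module.Free B (B ⊗[A] H))

variable {φ}

theorem Specialization.ofHom_surjective (hφ : Function.Surjective φ) :
    Function.Surjective (Specialization.ofHom φ : H → Specialization φ H) := by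
  let _ := φ.toAlgebra
  intro x
  change B ⊗[A] H at x
  induction x with
  | zero => exact ⟨0, map_zero _⟩
  | add x y hx hy =>
    obtain ⟨h, rfl⟩ := hx
    obtain ⟨k, rfl⟩ := hy
    exact ⟨h + k, map_add _ _ _⟩
  | tmul b h =>
    obtain ⟨x, rfl⟩ := hφ b
    refine ⟨x • h, (ofHom_smul φ x h).trans ?_⟩
    change φ x • ((1 : B) ⊗ₜ[A] h) = _
    rw [TensorProduct.smul_tmul', smul_eq_mul, mul_one]

/-- In a basis of H all coordinates of h lie in the kernel of φ. -/
theorem Specialization.mem_smul_top_of_ofHom_eq_zero [Module.Free A H] {q : Ideal A}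
    (hq : ∀ x, φ x = 0 → x ∈ q) {h : H} (hh : Specialization.ofHom φ h = 0) :
    h ∈ q • (⊤ : Submodule A H) := by
  let _ := φ.toAlgebra
  let b := Module.Free.chooseBasis A H
  have h0 : (1 : B) ⊗ₜ[A] h = 0 := hh
  rw [← b.linearCombination_repr h, Finsupp.linearCombination_apply]
  refine Submodule.sum_mem _ fun i _ => Submodule.smul_mem_smul (hq _ ?_) trivial
  have h1 := congrArg (fun z => (Algebra.TensorProduct.basis B b).repr z i) h0
  simp only [Algebra.TensorProduct.basis_repr_tmul, one_smul, map_zero, Finsupp.coe_zero,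
    Pi.zero_apply, Finsupp.mapRange_apply] at h1
  exact h1

theorem Specialization.ofHom_mem_smul_top {q : Ideal A} {q' : Ideal B} (hq : ∀ x ∈ q, φ x ∈ q')
    {h : H} (hh : h ∈ q • (⊤ : Submodule A H)) :
    Specialization.ofHom φ h ∈ q' • (⊤ : Submodule B (Specialization φ H)) := by
  refine Submodule.smul_induction_on hh (fun r hr n _ => ?_) fun x y hx hy => ?_
  · rw [ofHom_smul]
    exact Submodule.smul_mem_smul (hq r hr) trivial
  · rw [map_add]
    exact add_mem hx hy

end Specialization

/-! ### Denominators in multiples of the maximal ideal -/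

section LocalizedAlgebra

variable {A : Type*} [CommRing A] {H : Type*} [Ring H] [Algebra A H] {q : Ideal A} [q.IsPrime]

theorem tmul_mem_maximalIdeal_smul_top (x : Localization.AtPrime q) {y : H}
    (hy : y ∈ q • (⊤ : Submodule A H)) :
    x ⊗ₜ[A] y ∈ IsLocalRing.maximalIdeal (Localization.AtPrime q) •
      (⊤ : Submodule (Localization.AtPrime q) (Localization.AtPrime q ⊗[A] H)) := by
  refine Submodule.smul_induction_on hy (fun r hr n _ => ?_) fun x y hx hy => ?_
  · rw [TensorProduct.tmul_smul, ← algebraMap_smul (Localization.AtPrime q) r]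
    refine Submodule.smul_mem_smul ?_ trivial
    rw [← Localization.AtPrime.map_eq_maximalIdeal]
    exact Ideal.mem_map_of_mem _ hr
  · rw [TensorProduct.tmul_add]
    exact add_mem hx hy

theorem exists_smul_eq_one_tmul_of_mem_smul_top {z : Localization.AtPrime q ⊗[A] H}
    (hz : z ∈ IsLocalRing.maximalIdeal (Localization.AtPrime q) •
      (⊤ : Submodule (Localization.AtPrime q) (Localization.AtPrime q ⊗[A] H))) :
    ∃ u ∉ q, ∃ y ∈ q • (⊤ : Submodule A H), u • z = 1 ⊗ₜ[A] y := by
  refine Submodule.smul_induction_on hz (fun r hr n _ => ?_) fun x y hx hy => ?_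
  · obtain ⟨⟨b, s⟩, hs⟩ := IsLocalization.surj q.primeCompl r
    obtain ⟨s', hs', n', hn⟩ := exists_smul_eq_one_tmul q.primeCompl n
    have hb : b ∈ q := by
      rw [← Localization.AtPrime.under_maximalIdeal (I := q), Ideal.mem_comap, ← hs]
      exact Ideal.mul_mem_right _ _ hr
    refine ⟨s * s', q.primeCompl.mul_mem s.2 hs', b • n',
      Submodule.smul_mem_smul hb trivial, ?_⟩
    rw [mul_smul, smul_comm s' r, hn, TensorProduct.tmul_smul, ← smul_assoc,
      ← algebraMap_smul (Localization.AtPrime q) b, ← hs, Algebra.smul_def, mul_comm]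
  · obtain ⟨u, hu, x', hx', hux⟩ := hx
    obtain ⟨w, hw, y', hy', hwy⟩ := hy
    refine ⟨u * w, q.primeCompl.mul_mem hu hw, w • x' + u • y',
      add_mem (Submodule.smul_mem _ _ hx') (Submodule.smul_mem _ _ hy'), ?_⟩
    rw [smul_add, mul_comm, mul_smul, hux, mul_comm, mul_smul, hwy, TensorProduct.tmul_add,
      TensorProduct.tmul_smul, TensorProduct.tmul_smul]

end LocalizedAlgebra

section Injectivity

variable {A : Type u} [CommRing A] {H : Type v} [Ring H] [Algebra A H] {ι : Type} {d : ι → ℕ}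
  (Φ : GenericFiber A H ≃ₐ[FractionRing A] MatrixProd d (FractionRing A))

theorem rep_injective [Module.Free A H] : Function.Injective (rep Φ) :=
  Φ.injective.comp
    (Algebra.TensorProduct.includeRight_injective (IsFractionRing.injective A (FractionRing A)))

theorem span_range_rep [IsDomain A] : Submodule.span (FractionRing A) (Set.range (rep Φ)) = ⊤ := by
  rw [eq_top_iff]
  intro y _
  obtain ⟨s, hs, h, hh⟩ := exists_smul_eq_one_tmul (nonZeroDivisors A) (Φ.symm y)
  have hs0 : algebraMap A (FractionRing A) s ≠ 0 := by
    simpa using nonZeroDivisors.ne_zero hs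
  have hy : y = (algebraMap A (FractionRing A) s)⁻¹ • rep Φ h := by
    rw [rep_apply, ← hh, ← algebraMap_smul (FractionRing A) s, map_smul, smul_smul,
      inv_mul_cancel₀ hs0, one_smul, AlgEquiv.apply_symm_apply]
  rw [hy]
  exact Submodule.smul_mem _ _ (Submodule.subset_span ⟨h, rfl⟩)

end Injectivity

/-! ### Specializing and lifting the idempotents of sets of factors -/

section ClosedSets

variable {A B : Type u} [CommRing A] [CommRing B] {φ : A →+* B}
  {H : Type v} [Ring H] [Algebra A H] {ι : Type} {d : ι → ℕ}
  {Φ : GenericFiber A H ≃ₐ[FractionRing A] MatrixProd d (FractionRing A)}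
  {Φ' : GenericFiber B (Specialization φ H) ≃ₐ[FractionRing B] MatrixProd d (FractionRing B)}

theorem IsClosedAt.specialize (hΦ : IsCompatible φ Φ Φ') {q : Ideal A} {q' : Ideal B}
    (hq : ∀ x, φ x ∈ q' ↔ x ∈ q) {S : Set ι} (hS : IsClosedAt (rep Φ) q S) :
    IsClosedAt (rep Φ') q' S := by
  obtain ⟨v, hv, h, hh⟩ := hS
  exact ⟨φ v, fun h0 => hv ((hq v).1 h0), _, hΦ.unitOn h v S hh⟩

/-- The idempotents of the localization of the specialized algebra lift. -/
theorem IsClosedAt.of_specialize [IsDomain A] [IsDomain B] [IsIntegrallyClosed A]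
    [Module.Free A H] [Module.Finite A H]
    [Fintype ι] [DecidableEq ι] [∀ i, NeZero (d i)]
    (hΦ : IsCompatible φ Φ Φ') (hφ : Function.Surjective φ) {q : Ideal A} {q' : Ideal B}
    [q.IsPrime] [q'.IsPrime] (hq : ∀ x, φ x ∈ q' ↔ x ∈ q) {S : Set ι}
    (hS : IsClosedAt (rep Φ') q' S) : IsClosedAt (rep Φ) q S := by
  obtain ⟨v, hv, h, hh⟩ := hS
  obtain ⟨v, rfl⟩ := hφ v
  obtain ⟨h, rfl⟩ := Specialization.ofHom_surjective hφ h
  have hv' : v ∉ q := fun h0 => hv ((hq v).2 h0)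
  let O := Localization.AtPrime q
  let F := FractionRing A
  let _ : Algebra O F := (localizationToFraction q).toAlgebra
  have _ : IsScalarTower A O F :=
    .of_algebraMap_eq fun x => ((localizationToFraction q).commutes x).symm
  have _ : IsDomain O := IsLocalization.isDomain_localization q.primeCompl_le_nonZeroDivisors
  have _ : IsFractionRing O F :=
    IsFractionRing.isFractionRing_of_isDomain_of_isLocalization q.primeCompl O F
  have _ : IsIntegrallyClosed O :=
    isIntegrallyClosed_of_isLocalization O q.primeCompl q.primeCompl_le_nonZeroDivisors
  have hker : ∀ x, φ x = 0 → x ∈ q := fun x hx => (hq x).1 (hx ▸ q'.zero_mem)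
  -- The relations of a central idempotent with denominator v hold exactly in the specialized
  -- algebra, hence in H modulo the kernel of φ, which lies in q.
  have hidem : h * h - v • h ∈ q • (⊤ : Submodule A H) := by
    apply Specialization.mem_smul_top_of_ofHom_eq_zero hker
    apply rep_injective Φ'
    rw [map_sub, map_mul, Specialization.ofHom_smul, map_sub, map_mul, map_smul, hh,
      smul_mul_smul_comm, unitOn_mul, Set.inter_self, smul_smul, sub_self, map_zero]
  have hcomm : ∀ k, h * k - k * h ∈ q • (⊤ : Submodule A H) := fun k => by
    apply Specialization.mem_smul_top_of_ofHom_eq_zero hker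
    apply rep_injective Φ'
    rw [map_sub, map_mul, map_mul, map_sub, map_mul, map_mul, hh, smul_mul_assoc, mul_smul_comm,
      (unitOn_commute S _).eq, sub_self, map_zero]
  let c : O := IsLocalization.mk' O 1 (⟨v, hv'⟩ : q.primeCompl)
  have hcv : v • c = 1 := by
    rw [Algebra.smul_def]
    exact (IsLocalization.mk'_spec' O 1 (⟨v, hv'⟩ : q.primeCompl)).trans (map_one _)
  let f : O ⊗[A] H := c ⊗ₜ h
  have hf : f * f - f ∈ IsLocalRing.maximalIdeal O • (⊤ : Submodule O (O ⊗[A] H)) := by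
    have h1 : f * f - f = (c * c) ⊗ₜ (h * h - v • h) := by
      rw [TensorProduct.tmul_sub, Algebra.TensorProduct.tmul_mul_tmul, ← TensorProduct.smul_tmul,
        ← mul_smul_comm, hcv, mul_one]
    rw [h1]
    exact tmul_mem_maximalIdeal_smul_top (q := q) _ hidem
  have hfc : ∀ x, f * x - x * f ∈ IsLocalRing.maximalIdeal O • (⊤ : Submodule O (O ⊗[A] H)) := by
    intro x
    induction x with
    | zero => simp
    | add x y hx hy =>
      rw [mul_add, add_mul, add_sub_add_comm]
      exact add_mem hx hy
    | tmul x k =>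
      rw [Algebra.TensorProduct.tmul_mul_tmul, Algebra.TensorProduct.tmul_mul_tmul, mul_comm x c,
        ← TensorProduct.tmul_sub]
      exact tmul_mem_maximalIdeal_smul_top (q := q) _ (hcomm k)
  have hspan : Submodule.span F (Set.range (liftRep (O := O) (rep Φ))) = ⊤ := by
    rw [eq_top_iff, ← span_range_rep Φ]
    refine Submodule.span_mono ?_
    rintro _ ⟨k, rfl⟩
    exact ⟨1 ⊗ₜ k, by rw [liftRep_tmul, one_smul]⟩
  obtain ⟨T, e, heT, hef⟩ := exists_unitOn_sub_mem_smul_top (O := O) (Λ := O ⊗[A] H) hspan hf hfc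
  obtain ⟨w, hw, k, hk⟩ := exists_smul_eq_one_tmul q.primeCompl e
  have hkT : rep Φ k = w • unitOn d F T := by
    have h1 := congrArg ((liftRep (O := O) (rep Φ)).restrictScalars A) hk
    rw [map_smul] at h1
    have h2 : liftRep (O := O) (rep Φ) (1 ⊗ₜ k) = rep Φ k := by rw [liftRep_tmul, one_smul]
    rw [← h2, ← heT]
    exact h1.symm
  obtain ⟨u, hu, y, hy, huy⟩ := exists_smul_eq_one_tmul_of_mem_smul_top (q := q) hef
  -- The congruence e ≡ f modulo the maximal ideal, with all denominators cleared so that φ can be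
  -- applied.
  have hdiff : (v * w) • y = u • (v • k - w • h) := by
    apply rep_injective Φ
    have h1 : (1 : O) ⊗ₜ[A] ((v * w) • y) = 1 ⊗ₜ (u • (v • k - w • h)) := by
      have h2 : v • f = 1 ⊗ₜ h := by rw [TensorProduct.smul_tmul', hcv]
      rw [TensorProduct.tmul_smul, ← huy, TensorProduct.tmul_smul, TensorProduct.tmul_sub,
        TensorProduct.tmul_smul, TensorProduct.tmul_smul, ← hk, ← h2, smul_comm w v f,
        smul_comm (v * w), smul_sub (v * w), mul_smul, mul_smul]
    have h3 := congrArg (liftRep (O := O) (rep Φ)) h1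
    rwa [liftRep_tmul, liftRep_tmul, one_smul, one_smul] at h3
  -- The lift is a priori attached to some other set T. In the specialized algebra the two
  -- idempotents differ, up to a scalar outside q', by an element of q' times the algebra, which
  -- forces the sets to agree.
  have hTS : T = S := by
    have hvw : (v * w) • y ∈ q • (⊤ : Submodule A H) := Submodule.smul_mem _ (v * w) hy
    have hmem : Specialization.ofHom φ ((v * w) • y) ∈
        q' • (⊤ : Submodule B (Specialization φ H)) :=
      Specialization.ofHom_mem_smul_top (fun x hx => (hq x).2 hx) hvw
    have huvw : φ (u * (v * w)) ∉ q' := fun h0 =>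
      q.primeCompl.mul_mem hu (q.primeCompl.mul_mem hv' hw) ((hq _).1 h0)
    have hrep : rep Φ' (Specialization.ofHom φ ((v * w) • y)) =
        φ (u * (v * w)) • (unitOn d _ T - unitOn d _ S) := by
      rw [hdiff, Specialization.ofHom_smul, map_sub, Specialization.ofHom_smul,
        Specialization.ofHom_smul, map_smul, map_sub, map_smul, map_smul, hh,
        Specialization.ofHom_apply, hΦ.unitOn k w T hkT, smul_smul, smul_smul, ← map_mul, ← map_mul,
        mul_comm w v, ← smul_sub, smul_smul, ← map_mul]
    exact eq_of_smul_unitOn_sub_mem (Λ := Specialization φ H) (q := q') hmem huvw hrep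
  exact ⟨w, hw, k, hTS ▸ hkT⟩

end ClosedSets

/-! ### Blocks and essential monomials -/

theorem IsMinimalNonempty.of_imp {ι : Type*} {P Q : Set ι → Prop} {S : Set ι}
    (hS : IsMinimalNonempty P S) (hQP : ∀ T, Q T → P T) (h : Q S) : IsMinimalNonempty Q S :=
  ⟨hS.1, h, fun T hT hne hQ => hS.2.2 T hT hne (hQP T hQ)⟩

/-- This is the case 𝔭 = 0, in which no monomial is essential: Ψ(1) ≠ 0 because Ψ is prime to X - 1.
The coefficient ξ is nonzero because Schur elements are. -/
theorem IsEssential.exists_isSchurElement_notMem {R : Type u} [CommRing R] [IsDomain R] {n : ℕ}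
    {H : Type v} [Ring H] [Algebra (Laurent R n) H] [Module.Free (Laurent R n) H]
    [Module.Finite (Laurent R n) H] {ι : Type} {d : ι → ℕ} [Fintype ι] [DecidableEq ι]
    [∀ i, NeZero (d i)]
    (Φ : GenericFiber (Laurent R n) H ≃ₐ[FractionRing (Laurent R n)]
      MatrixProd d (FractionRing (Laurent R n)))
    {t : H →ₗ[Laurent R n] Laurent R n} (ht : IsSymmetrizing t) (hess : IsEssential t)
    {a : Fin n → ℤ} (ha : IsPrimitiveExponent a) (χ : IrrGeneric (Laurent R n) H) :
    ∃ s ∉ monomialIdeal (⊥ : Ideal R) a,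
      IsSchurElement t χ (algebraMap _ (FractionRing (Laurent R n)) s) := by
  choose D hD using fun i => hess (irrEquiv.{u, v} Φ i)
  obtain ⟨i, rfl⟩ := (irrEquiv.{u, v} Φ).surjective χ
  have hbot : (⊥ : Ideal R).IsPrime := Ideal.isPrime_bot
  have hs := (ht.extendForm_eq_sum Φ hD).1 i
  refine ⟨(D i).value, fun h0 => ?_, hD i⟩
  rw [(D i).value_eq] at h0
  rcases (monomialIdeal_isPrime _ hbot a ha).mem_or_mem h0 with h1 | h1
  · refine algebraMap_notMem_monomialIdeal ha (fun hξ => hs ?_) h1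
    rw [(D i).value_eq, (Ideal.mem_bot).1 hξ, map_zero, zero_mul, map_zero]
  · exact (D i).cofactor_notMem hbot ha (fun j _ h2 => (D i).eval_one_ne_zero j h2) h1

/-! ### Morphisms associated with a monomial -/

section Morphism

variable {R : Type u} [CommRing R] {m : ℕ} {a : Fin (m + 1) → ℤ}
  {φ : Laurent R (m + 1) →ₐ[R] Laurent R m}

theorem IsAssociatedMorphism.surjective (hφ : IsAssociatedMorphism a φ) :
    Function.Surjective φ := by
  obtain ⟨f, hf, -, rfl⟩ := hφ
  intro x
  induction x using AddMonoidAlgebra.induction_linear with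
  | zero => exact ⟨0, map_zero _⟩
  | add x y hx hy =>
    obtain ⟨x, rfl⟩ := hx
    obtain ⟨y, rfl⟩ := hy
    exact ⟨x + y, map_add _ _ _⟩
  | single g r =>
    obtain ⟨g, rfl⟩ := hf g
    exact ⟨AddMonoidAlgebra.single g r, by simp⟩

theorem IsAssociatedMorphism.mem_extendedIdeal_iff (hφ : IsAssociatedMorphism a φ) (p : Ideal R)
    (x : Laurent R (m + 1)) : φ x ∈ extendedIdeal p m ↔ x ∈ monomialIdeal p a := by
  obtain ⟨f, -, hf, rfl⟩ := hφ
  exact (mem_monomialIdeal_iff hf).symm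

theorem IsAssociatedMorphism.eq_zero_iff (hφ : IsAssociatedMorphism a φ)
    (x : Laurent R (m + 1)) : φ x = 0 ↔ x ∈ monomialIdeal (⊥ : Ideal R) a := by
  rw [← hφ.mem_extendedIdeal_iff, extendedIdeal, Ideal.map_bot, Ideal.mem_bot]

end Morphism

section Blocks

variable {R : Type u} [CommRing R] [IsDomain R] [IsIntegrallyClosed R] {n : ℕ} {H : Type v}
  [Ring H] [Algebra (Laurent R n) H] [Module.Free (Laurent R n) H] [Module.Finite (Laurent R n) H]
  {t : H →ₗ[Laurent R n] Laurent R n} {p : Ideal R} {a : Fin n → ℤ}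

theorem IsBlockAt.monomialIdeal (ht : IsSymmetrizing t)
    (hH : IsSplitSemisimple (FractionRing (Laurent R n)) (GenericFiber (Laurent R n) H))
    (hess : IsEssential t) (hp : p.IsPrime) (ha : IsPrimitiveExponent a)
    {C : Set (IrrGeneric (Laurent R n) H)}
    (hC : IsBlockAt (extendedIdeal p n) (extendedIdeal_isPrime p hp n) C)
    (hCM : ∀ χ ∈ C, ¬ IsEssentialMonomial t p a χ) :
    IsBlockAt (EssentialAlgebra.monomialIdeal p a) (monomialIdeal_isPrime p hp a ha) C := by
  obtain ⟨k, d, hd, ⟨Φ⟩⟩ := hH.exists_algEquiv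
  rw [isBlockAt_iff Φ] at hC ⊢
  exact hC.of_imp (fun T => IsClosedAt.extendedIdeal_of_monomialIdeal Φ)
    (IsClosedAt.monomialIdeal_of_extendedIdeal Φ ht hess hp ha (fun i hi => hCM _ hi) hC.2.1)

theorem isBlockAt_extendedIdeal_iff_monomialIdeal (ht : IsSymmetrizing t)
    (hH : IsSplitSemisimple (FractionRing (Laurent R n)) (GenericFiber (Laurent R n) H))
    (hess : IsEssential t) (hp : p.IsPrime) (ha : IsPrimitiveExponent a)
    (hM : ∀ χ, ¬ IsEssentialMonomial t p a χ) (C : Set (IrrGeneric (Laurent R n) H)) :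
    IsBlockAt (extendedIdeal p n) (extendedIdeal_isPrime p hp n) C ↔
      IsBlockAt (monomialIdeal p a) (monomialIdeal_isPrime p hp a ha) C := by
  refine ⟨fun hC => hC.monomialIdeal ht hH hess hp ha fun χ _ => hM χ, fun hC => ?_⟩
  obtain ⟨k, d, hd, ⟨Φ⟩⟩ := hH.exists_algEquiv
  rw [isBlockAt_iff Φ] at hC ⊢
  exact hC.of_imp
    (fun T => IsClosedAt.monomialIdeal_of_extendedIdeal Φ ht hess hp ha fun i _ => hM _)
    (hC.2.1.extendedIdeal_of_monomialIdeal Φ)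

end Blocks

/-- The blocks at `𝔮_M` are the blocks at `𝔭B` of the algebra specialized by a morphism associated
with `M`. -/
theorem exists_equiv_isSpecializedCharacter {R : Type u} [CommRing R] [IsDomain R]
    [IsNoetherianRing R] [IsIntegrallyClosed R] {m : ℕ} {H : Type v} [Ring H]
    [Algebra (Laurent R (m + 1)) H] [Module.Free (Laurent R (m + 1)) H]
    [Module.Finite (Laurent R (m + 1)) H] {t : H →ₗ[Laurent R (m + 1)] Laurent R (m + 1)}
    (ht : IsSymmetrizing t)
    (hH : IsSplitSemisimple (FractionRing (Laurent R (m + 1)))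
      (GenericFiber (Laurent R (m + 1)) H))
    (hess : IsEssential t) {p : Ideal R} (hp : p.IsPrime) {a : Fin (m + 1) → ℤ}
    (ha : IsPrimitiveExponent a) {φ : Laurent R (m + 1) →ₐ[R] Laurent R m}
    (hφ : IsAssociatedMorphism a φ) :
    ∃ τ : IrrGeneric (Laurent R (m + 1)) H ≃
        IrrGeneric (Laurent R m) (Specialization φ.toRingHom H),
      (∀ χ, IsSpecializedCharacter φ.toRingHom χ (τ χ)) ∧
      ∀ C : Set (IrrGeneric (Laurent R (m + 1)) H),
        IsBlockAt (monomialIdeal p a) (monomialIdeal_isPrime p hp a ha) C ↔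
        IsBlockAt (extendedIdeal p m) (extendedIdeal_isPrime p hp m) (τ '' C) := by
  obtain ⟨k, d, hd, ⟨Φ₀⟩⟩ := hH.exists_algEquiv
  have _ := isIntegrallyClosed_laurent R (m + 1)
  have _ := monomialIdeal_isPrime ⊥ (Ideal.isPrime_bot (α := R)) a ha
  have _ := monomialIdeal_isPrime p hp a ha
  have _ := extendedIdeal_isPrime p hp m
  have _ := isPrincipalIdealRing_localization (R := R) a
  -- The representation is specialized at ker φ = (M - 1)A; the prime 𝔭 enters only when idempotents
  -- are compared.
  obtain ⟨Φ, Φ', hΦ⟩ := ht.exists_isCompatible φ.toRingHom Φ₀ (monomialIdeal ⊥ a)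
    hφ.eq_zero_iff (hess.exists_isSchurElement_notMem Φ₀ ht ha)
  refine ⟨(irrEquiv.{u, v} Φ).symm.trans (irrEquiv.{u, max u v} Φ'), fun χ h => ?_, fun C => ?_⟩
  · obtain ⟨i, rfl⟩ := (irrEquiv.{u, v} Φ).surjective χ
    obtain ⟨c, hc⟩ := exists_algebraMap_eq_trace Φ h i
    refine ⟨c, ?_, ?_⟩
    · rw [irrEquiv_apply, hc, rep_apply]
    · rw [Equiv.trans_apply, Equiv.symm_apply_apply, irrEquiv_apply, hΦ.trace h c i hc, rep_apply]
  · rw [isBlockAt_iff Φ, isBlockAt_iff Φ']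
    have h1 : irrEquiv.{u, max u v} Φ' ⁻¹'
        ((irrEquiv.{u, v} Φ).symm.trans (irrEquiv.{u, max u v} Φ') '' C) =
        irrEquiv.{u, v} Φ ⁻¹' C := by
      rw [Equiv.coe_trans, Set.image_comp, Set.preimage_image_eq _ (Equiv.injective _),
        Equiv.image_symm_eq_preimage]
    -- τ matches equal factors, so it is enough that the same sets are closed on both sides.
    have h2 : IsClosedAt (rep Φ') (extendedIdeal p m) = IsClosedAt (rep Φ) (monomialIdeal p a) := by
      ext S
      exact ⟨fun h => h.of_specialize hΦ hφ.surjective (hφ.mem_extendedIdeal_iff p),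
        fun h => h.specialize hΦ (hφ.mem_extendedIdeal_iff p)⟩
    rw [h1, h2]

end EssentialAlgebra

end

theorem mainTheorem6
    {R : Type*} [CommRing R] [IsDomain R] [IsNoetherianRing R] [IsIntegrallyClosed R]
    {m : ℕ} {H : Type*} [Ring H] [Algebra (Laurent R (m + 1)) H]
    [Module.Free (Laurent R (m + 1)) H] [Module.Finite (Laurent R (m + 1)) H]
    (t : H →ₗ[Laurent R (m + 1)] Laurent R (m + 1)) (ht : IsSymmetrizing t)
    (hH : IsSplitSemisimple (FractionRing (Laurent R (m + 1)))
      (GenericFiber (Laurent R (m + 1)) H))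
    (hess : IsEssential t)
    (p : Ideal R) (hp : p.IsPrime)
    (a : Fin (m + 1) → ℤ) (ha : IsPrimitiveExponent a) :
    (∀ C : Set (IrrGeneric (Laurent R (m + 1)) H),
      IsBlockAt (extendedIdeal p (m + 1)) (extendedIdeal_isPrime p hp (m + 1)) C →
      (∀ χ ∈ C, ¬ IsEssentialMonomial t p a χ) →
      IsBlockAt (monomialIdeal p a) (monomialIdeal_isPrime p hp a ha) C) ∧
    ((∀ χ, ¬ IsEssentialMonomial t p a χ) →
      ∀ C : Set (IrrGeneric (Laurent R (m + 1)) H),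
        IsBlockAt (extendedIdeal p (m + 1)) (extendedIdeal_isPrime p hp (m + 1)) C ↔
        IsBlockAt (monomialIdeal p a) (monomialIdeal_isPrime p hp a ha) C) ∧
    ∀ φ : Laurent R (m + 1) →ₐ[R] Laurent R m, IsAssociatedMorphism a φ →
      ∃ τ : IrrGeneric (Laurent R (m + 1)) H ≃
          IrrGeneric (Laurent R m) (Specialization φ.toRingHom H),
        (∀ χ, IsSpecializedCharacter φ.toRingHom χ (τ χ)) ∧
        (∀ C : Set (IrrGeneric (Laurent R (m + 1)) H),
          IsBlockAt (extendedIdeal p (m + 1)) (extendedIdeal_isPrime p hp (m + 1)) C →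
          (∀ χ ∈ C, ¬ IsEssentialMonomial t p a χ) →
          IsBlockAt (extendedIdeal p m) (extendedIdeal_isPrime p hp m) (τ '' C)) ∧
        ((∀ χ, ¬ IsEssentialMonomial t p a χ) →
          ∀ C : Set (IrrGeneric (Laurent R (m + 1)) H),
            IsBlockAt (extendedIdeal p (m + 1)) (extendedIdeal_isPrime p hp (m + 1)) C ↔
            IsBlockAt (extendedIdeal p m) (extendedIdeal_isPrime p hp m) (τ '' C)) := by
  refine ⟨fun C hC hCM => hC.monomialIdeal ht hH hess hp ha hCM,
    isBlockAt_extendedIdeal_iff_monomialIdeal ht hH hess hp ha, fun φ hφ => ?_⟩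
  obtain ⟨τ, hτ, hblock⟩ := exists_equiv_isSpecializedCharacter ht hH hess hp ha hφ
  exact ⟨τ, hτ, fun C hC hCM => (hblock C).1 (hC.monomialIdeal ht hH hess hp ha hCM),
    fun hM C => (isBlockAt_extendedIdeal_iff_monomialIdeal ht hH hess hp ha hM C).trans (hblock C)⟩
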